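/- **Setting.** Let $b:\mathbb R\to\mathbb R$ be strictly convex and three times differentiable, and let $p_\eta(y)=\exp\{y\eta-b(\eta)+k(y)\}$ be a probability density with respect to a measure $\mu$ on $\mathbb R$ for every $\eta\in\mathbb R$. Assume that there are constants $C_{\rm dev}\ge 1$ and $C_3$ with $b''(x+y)\le C_{\rm dev}\,b''(x)$ for all $x$ and $|y|\le 1/2$, and $|b'''|\le C_3\,b''$ on $\mathbb R$. For a fixed design $\mathbf X\in\mathbb R^{n\times p}$ with rows $x_i$ and a coefficient $\theta_0\in\mathbb R^p\setminus\{0\}$, let $Y_1,\dots,Y_n$ be independent, $Y_i$ with density $p_{x_i^\top\theta_0}$; $\mathbb P_0^{(n)}$ is their joint law, $S_0=\{j:\theta_{0,j}\ne0\}$, $s_0=|S_0|$. For $S\subseteq[p]$ and $\theta_S\in\mathbb R^{S}$ put $L_{n,\theta_S}=\sum_i\log p_{x_{i,S}^\top\theta_S}(Y_i)$, ${\bf F}_{n,\theta_S}=\sum_i b''(x_{i,S}^\top\theta_S)x_{i,S}x_{i,S}^\top$, ${\bf W}_0=\operatorname{diag}(b''(x_i^\top\theta_0))_i$, ${\bf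 F}_{n,\theta_0}=\mathbf X^\top{\bf W}_0\mathbf X$; $\widehat\theta_S$ is the maximizer of $L_{n,\theta_S}$, $\theta_S^*$ the maximizer of $\mathbb E L_{n,\theta_S}$, $\rho_{\max,S},\rho_{\min,S}$ are the largest and smallest singular values of ${\bf F}_{n,\theta_S^*}$, $\zeta_{n,S}=\max_i\|{\bf F}_{n,\theta_S^*}^{-1/2}x_{i,S}\|_2$, $\sigma_{\max}^2=\max_i b''(x_i^\top\theta_0)$, and $\phi_2(s)\ge 0$ is given by $\phi_2(s)^2=\inf\{n^{-1}\theta^\top\mathbf X^\top{\bf W}_0\mathbf X\theta/\|\theta\|_2^2:\ 0<|\{j:\theta_j\neq0\}|\le s\}$. Also $\|\mathbf X\|_{\max}=\max_{i,j}|x_{ij}|$ and $\|\mathbf X_{S_0}\|_\infty=\max_i\sum_{j\in S_0}|x_{ij}|$. *Prior and posterior.* $\pi_n(S)=w_n(|S|)\binom p{|S|}^{-1}$, where $w_n$ is a probability mass function on $\{0,\dots,s_{\max}\}$, $s_0\le s_{\max}\le\operatorname{rank}\mathbf X$, with $A_1p^{-A_3}w_n(s-1)\le w_n(s)\le A_2p^{-A_4}w_n(s-1)$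 for $1\le s\le s_{\max}$ $(A_1,\dots,A_4>0)$; given $S$, $\theta_S$ has the density $g_S$ of $\mathcal N(\widehat\theta_S,\{\lambda{\bf F}_{n,\widehat\theta_S}\}^{-1})$. Put $\mathcal M_\alpha^n(S)=\int\exp(\alpha L_{n,\theta_S})g_S(\theta_S)\,d\theta_S$, $\widehat{\mathcal M}_\alpha^n(S)=\exp(\alpha L_{n,\widehat\theta_S})(1+\alpha/\lambda)^{-|S|/2}$, $\pi_\alpha^n(S)=\pi_n(S)\mathcal M_\alpha^n(S)/\sum_{S'}\pi_n(S')\mathcal M_\alpha^n(S')$. *Models.* For constants $K_{\rm dim}>1$, $K_{\rm theta}>0$, let $\mathscr S_{\Theta_n}$ be the set of $S\subseteq[p]$ with $|S|\le K_{\rm dim}s_0$ for which some vector $\theta\in\mathbb R^p$ vanishing outside $S$ satisfies $\|{\bf F}_{n,\theta_0}^{1/2}(\theta-\theta_0)\|_2^2\le K_{\rm theta}s_0\log p$; let $\overline{\mathscr S}_{\Theta_n}=\mathscr S_{\Theta_n}\cup\{S\cup S_0:S\in\mathscr S_{\Theta_n}\}$, $\tilde s_n=(K_{\rm dim}+1)s_0$,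 $\phi_2=\phi_2(\tilde s_n)$. For $M>0$, $K_{\rm cubic}>0$ let $$\tilde r_{p,s}=(M^2s\log p)^{1/2},\quad \tilde\delta_{n,S}=\bigl(2\tilde r_{p,|S|}\zeta_{n,S}\bigr)\wedge\Bigl(\frac{8\sqrt2K_{\rm cubic}}{\phi_2^3}\sigma_{\max}^2\,\tilde r_{p,|S|}n^{-1/2}\Bigr),\quad \tau_{n,p,S}=6|S|\tilde\delta_{n,S}+2p^{-1}.$$ **Conclusion $\mathcal C(M)$.** $\tau_{n,p,S}\le 1/3$ for all nonempty $S\in\mathscr S_{\Theta_n}$, and there is one event of $\mathbb P_0^{(n)}$-probability at least $1-p^{-1}$ on which, simultaneously for all nonempty $S\in\mathscr S_{\Theta_n}$: $\widehat\theta_S$ exists and is unique, $$\Bigl|1-\frac{\mathcal M_\alpha^n(S)}{\widehat{\mathcal M}_\alpha^n(S)}\Bigr|\le\tau_{n,p,S},\qquad \frac{\pi_\alpha^n(S)}{\pi_\alpha^n(S_0)}\le\frac{1+\tau_{n,p,S}}{1-\tau_{n,p,S_0}}\cdot\frac{\pi_n(S)\widehat{\mathcal M}_\alpha^n(S)}{\pi_n(S_0)\widehat{\mathcal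 M}_\alpha^n(S_0)},\qquad \frac{\pi_\alpha^n(S)}{\pi_\alpha^n(S_0)}\le 2\,\frac{\pi_n(S)\widehat{\mathcal M}_\alpha^n(S)}{\pi_n(S_0)\widehat{\mathcal M}_\alpha^n(S_0)}.$$ **Theorem.** There are constants $C=C(C_3,K_{\rm dim},K_{\rm theta})$ and $C'=C'(C_{\rm dev},C_3,\alpha,A_5,A_6,A_8)$ such that the following hold. (i) *Non-asymptotic form.* Let $0<\alpha\le1$, $A_5,A_6,A_8>0$, $A_7\ge0$. $\mathcal C(M)$ holds whenever $p^{-A_5}\le\lambda\le A_6p^{-A_7}$; $\phi_2>0$ and $n\ge C\,\phi_2^{-2}\|\mathbf X\|_{\max}^2s_0^2\log p$; $n^{-1}\sum_i|x_{i,S}^\top u|^3\le K_{\rm cubic}$ for all $S\in\overline{\mathscr S}_{\Theta_n}$ and unit vectors $u\in\mathbb R^{S}$; $\rho_{\max,S}\le p^{A_8}$ for $S\in\mathscr S_{\Theta_n}$; $\tilde r_{p,|S|}\zeta_{n,S}\le1/5$ for $S\in\overline{\mathscr S}_{\Theta_n}$; $|S|\tilde\delta_{n,S}\le1/36$ for $S\in\mathscr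 S_{\Theta_n}$; $C'\le M$ and $C'M\le p$. (ii) *Asymptotic form.* Consider a sequence of such problems indexed by $n$ ($p,\mathbf X,\theta_0,\lambda,w_n,s_{\max}$ depending on $n$; $b,k,\mu,\alpha$, $A_1,\dots,A_8$ and the constants $C_{\rm dev},C_3,K_{\rm dim},K_{\rm theta},K_{\rm cubic}$ fixed) with $p\ge n^{c}$ for some constant $c>0$, and assume, with inequalities required for all large $n$: * (A1) There are nonrandom $D_n>\sqrt2$ and $\overline\theta_S\in\mathbb R^S$ with ${\bf F}_{n,\overline\theta_S}$ nonsingular for $|S|\le s_{\max}$ such that, with $\mathbb P_0^{(n)}$-probability at least $1-p^{-1}$, for all $|S|\le s_{\max}$ the estimate $\widehat\theta_S$ exists, $D_n^{-1}{\bf F}_{n,\overline\theta_S}\preceq{\bf F}_{n,\widehat\theta_S}\preceq D_n{\bf F}_{n,\overline\theta_S}$ and $\|{\bf F}_{n,\overline\theta_S}^{1/2}(\widehat\theta_S-\overline\theta_S)\|_2^2\le D_n|S|\log p$; moreover ${\bf F}_{n,\theta^*_{S_0}}$ is nonsingular and $\zeta_{n,S_0}^2s_0\log p=o(1)$. * (A2)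 $\log\bigl(\sigma_{\max}^2\vee\|\mathbf X_{S_0}\|_\infty\vee\rho_{\min,S_0}^{-1}\vee\rho_{\max,S_0}\bigr)=O(\log p)$; $s_0\log p=o(n)$; $p^{-A_5}\le\lambda\le A_6p^{-A_7}$ with $A_5,A_6>0$, $A_7\ge0$; $0<\alpha<1$; $A_6p^{-A_7}<A_4$; $\log_pD_n=o(1)$. * (A3) $\phi_2>0$ and $\|\mathbf X\|_{\max}^2s_0^2\log p/\phi_2^2=o(n)$. * (A4) $\max_{S\in\mathscr S_{\Theta_n}}\rho_{\max,S}\le p^{A_8}$ with $A_8>0$; $n^{-1}\sum_i|x_{i,S}^\top u|^3\le K_{\rm cubic}$ for all $S\in\overline{\mathscr S}_{\Theta_n}$ and unit $u\in\mathbb R^S$; and $\bigl[(s_0^3\log p)^{1/2}\max_{S\in\mathscr S_{\Theta_n}}\zeta_{n,S}\bigr]\wedge\bigl[\sigma_{\max}^2\phi_2^{-3}(s_0^3\log p/n)^{1/2}\bigr]=o(1)$. Then for every constant $M\ge C'$, $\mathcal C(M)$ holds for all sufficiently large $n$. -/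

import Mathlib

open MeasureTheory Filter Topology Matrix

namespace SparseGLM

noncomputable section

/-! ### The family of response distributions -/

/-- A canonical one-parameter exponential family on the real line: the densities
`y ↦ exp (y η - b η + k y)` with respect to a dominating measure `μ` (which carries the response
space), for every natural parameter `η : ℝ`, with `b` strictly convex and three times
differentiable. -/
structure Family where
  μ : Measure ℝ
  k : ℝ → ℝ
  b : ℝ → ℝ
  measurable_k : Measurable k
  normalized : ∀ η : ℝ, ∫⁻ y, ENNReal.ofReal (Real.exp (y * η - b η + k y)) ∂μ = 1
  strictConvex : StrictConvexOn ℝ Set.univ b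
  differentiable_b : Differentiable ℝ b
  differentiable_b' : Differentiable ℝ (deriv b)
  differentiable_b'' : Differentiable ℝ (deriv (deriv b))

namespace Family

variable (G : Family)

def b' : ℝ → ℝ := deriv G.b

def b'' : ℝ → ℝ := deriv G.b'

def b''' : ℝ → ℝ := deriv G.b''

/-- The density `p(y)` at natural parameter `η`. -/
def density (η y : ℝ) : ℝ := Real.exp (y * η - G.b η + G.k y)

/-- `b''(x + y) ≤ C b''(x)` whenever `|y| ≤ 1/2`. -/
def Doubling (C : ℝ) : Prop := ∀ x y : ℝ, |y| ≤ 1 / 2 → G.b'' (x + y) ≤ C * G.b'' x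

/-- `|b'''| ≤ C b''`. -/
def SelfConcordant (C : ℝ) : Prop := ∀ x : ℝ, |G.b''' x| ≤ C * G.b'' x

end Family

/-! ### The regression problem at a fixed sample size -/

/-- The data of the problem at sample size `n` with `p` covariates: design matrix, true
coefficient, prior scale `lam`, prior mass function `w` of the model size, and the bound `smax`
on the model size. -/
structure Problem (n p : ℕ) where
  X : Matrix (Fin n) (Fin p) ℝ
  θ₀ : Fin p → ℝ
  lam : ℝ
  w : ℕ → ℝ
  smax : ℕ

/-- The index set of the nonzero entries. -/
def supp {p : ℕ} (θ : Fin p → ℝ) : Finset (Fin p) := Finset.univ.filter fun j => θ j ≠ 0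

/-- The `p`-vector version of `θ_S`, with zeros outside `S`. -/
def extend {p : ℕ} (S : Finset (Fin p)) (θ : S → ℝ) : Fin p → ℝ :=
  fun j => if h : j ∈ S then θ ⟨j, h⟩ else 0

/-- Largest singular value of a square matrix. -/
def sigmaMax {m : Type*} [Fintype m] (A : Matrix m m ℝ) : ℝ :=
  sSup {r : ℝ | ∃ v : m → ℝ, v ⬝ᵥ v = 1 ∧ r = √((A *ᵥ v) ⬝ᵥ (A *ᵥ v))}

/-- Smallest singular value of a square matrix. -/
def sigmaMin {m : Type*} [Fintype m] (A : Matrix m m ℝ) : ℝ :=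
  sInf {r : ℝ | ∃ v : m → ℝ, v ⬝ᵥ v = 1 ∧ r = √((A *ᵥ v) ⬝ᵥ (A *ᵥ v))}

/-- The density of the normal distribution `N(m, Q)` with nonsingular covariance matrix `Q`. -/
def normalPdf {ι : Type*} [Fintype ι] [DecidableEq ι] (m : ι → ℝ) (Q : Matrix ι ι ℝ)
    (x : ι → ℝ) : ℝ :=
  (√(((2 * Real.pi) • Q).det))⁻¹ * Real.exp (-(1 / 2) * ((x - m) ⬝ᵥ (Q⁻¹ *ᵥ (x - m))))

section Fixed

variable {n p : ℕ} (G : Family) (D : Problem n p)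

/-- The true model `S₀`. -/
def Problem.S₀ : Finset (Fin p) := supp D.θ₀

/-- Its size `s₀`. -/
def Problem.s₀ : ℕ := D.S₀.card

/-- The restricted design matrix `X_S`. -/
def Problem.XS (S : Finset (Fin p)) : Matrix (Fin n) S ℝ := D.X.submatrix id Subtype.val

/-- The joint law of `(Y₁, …, Yₙ)` under the true coefficient. -/
def law : Measure (Fin n → ℝ) :=
  Measure.pi fun i =>
    G.μ.withDensity fun y => ENNReal.ofReal (G.density ((D.X *ᵥ D.θ₀) i) y)

/-- The log-likelihood `L_{n,θ_S}` of the model `S`. -/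
def logLik (S : Finset (Fin p)) (θ : S → ℝ) (Y : Fin n → ℝ) : ℝ :=
  ∑ i, Real.log (G.density ((D.XS S *ᵥ θ) i) (Y i))

/-- `θ` is a maximum likelihood estimate in the model `S`. -/
def IsMLE (S : Finset (Fin p)) (Y : Fin n → ℝ) (θ : S → ℝ) : Prop :=
  ∀ θ' : S → ℝ, logLik G D S θ' Y ≤ logLik G D S θ Y

open Classical in
/-- The maximum likelihood estimate in the model `S` (zero if there is none). -/
def mle (S : Finset (Fin p)) (Y : Fin n → ℝ) : S → ℝ :=
  if h : ∃ θ, IsMLE G D S Y θ then h.choose else 0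

/-- `θ` maximizes the expected log-likelihood in the model `S`. The expectation of the difference
is used, in which the terms `k (Y i)` cancel, so that it is always well defined. -/
def IsBest (S : Finset (Fin p)) (θ : S → ℝ) : Prop :=
  ∀ θ' : S → ℝ, ∫ Y, (logLik G D S θ' Y - logLik G D S θ Y) ∂(law G D) ≤ 0

open Classical in
/-- The best parameter `θ*_S` in the model `S`. -/
def best (S : Finset (Fin p)) : S → ℝ :=
  if h : ∃ θ, IsBest G D S θ then h.choose else 0

/-- The Fisher information matrix `X_Sᵀ W_{θ_S} X_S`. -/
def fisher (S : Finset (Fin p)) (θ : S → ℝ) : Matrix S S ℝ :=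
  (D.XS S)ᵀ * diagonal (fun i => G.b'' ((D.XS S *ᵥ θ) i)) * D.XS S

/-- The weight matrix `W₀ = diag (b''(xᵢᵀ θ₀))`. -/
def W₀ : Matrix (Fin n) (Fin n) ℝ := diagonal fun i => G.b'' ((D.X *ᵥ D.θ₀) i)

/-- The full Fisher information matrix `Xᵀ W₀ X` at the true coefficient. -/
def fisherFull : Matrix (Fin p) (Fin p) ℝ := D.Xᵀ * W₀ G D * D.X

/-- `ρ_{max,S}`. -/
def rhoMax (S : Finset (Fin p)) : ℝ := sigmaMax (fisher G D S (best G D S))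

/-- `ρ_{min,S}`. -/
def rhoMin (S : Finset (Fin p)) : ℝ := sigmaMin (fisher G D S (best G D S))

/-- The design regularity `ζ_{n,S} = maxᵢ ‖F^{-1/2} x_{i,S}‖₂` with `F` the Fisher information at
`θ*_S`, where `‖F^{-1/2} x‖₂² = xᵀ F⁻¹ x`. -/
def zeta (S : Finset (Fin p)) : ℝ :=
  ⨆ i : Fin n, √((D.XS S i) ⬝ᵥ ((fisher G D S (best G D S))⁻¹ *ᵥ (D.XS S i)))

/-- The sparse singular value `φ₂(s; W)`. -/
def phi2 (s : ℝ) (W : Matrix (Fin n) (Fin n) ℝ) : ℝ :=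
  √(sInf {r : ℝ | ∃ θ : Fin p → ℝ, 0 < (supp θ).card ∧ ((supp θ).card : ℝ) ≤ s ∧
    r = (θ ⬝ᵥ (((n : ℝ)⁻¹ • (D.Xᵀ * W * D.X)) *ᵥ θ)) / (θ ⬝ᵥ θ)})

/-- `‖X‖_max`. -/
def maxNorm : ℝ := ⨆ i : Fin n, ⨆ j : Fin p, |D.X i j|

/-- `σ_max² = maxᵢ b''(xᵢᵀ θ₀)`. -/
def sigmaMaxSq : ℝ := ⨆ i : Fin n, G.b'' ((D.X *ᵥ D.θ₀) i)

/-- The maximal absolute row sum `‖X_{S₀}‖_∞`. -/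
def rowSumNorm : ℝ := ⨆ i : Fin n, ∑ j : D.S₀, |D.XS D.S₀ i j|

/-- The class `𝒮_{Θₙ}`: the models with at most `Kdim s₀` elements that contain a parameter with
`‖F_{n,θ₀}^{1/2} (θ̃_S - θ₀)‖₂² ≤ Kth s₀ log p`. -/
def models (Kdim Kth : ℝ) : Set (Finset (Fin p)) :=
  {S | (S.card : ℝ) ≤ Kdim * D.s₀ ∧ ∃ θ : S → ℝ,
    (extend S θ - D.θ₀) ⬝ᵥ (fisherFull G D *ᵥ (extend S θ - D.θ₀)) ≤ Kth * D.s₀ * Real.log p}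

/-- The class `𝒮_{Θₙ} ∪ {S ∪ S₀ : S ∈ 𝒮_{Θₙ}}`. -/
def modelsBar (Kdim Kth : ℝ) : Set (Finset (Fin p)) :=
  models G D Kdim Kth ∪ (fun S => S ∪ D.S₀) '' models G D Kdim Kth

/-- `max_{S ∈ 𝒮_{Θₙ}} ζ_{n,S}`. -/
def zetaMax (Kdim Kth : ℝ) : ℝ := ⨆ S : models G D Kdim Kth, zeta G D S

/-- The bound `sup_u n⁻¹ ∑ᵢ |x_{i,S}ᵀ u|³ ≤ K` over unit vectors `u`, for every model in
`𝒮_{Θₙ} ∪ {S ∪ S₀ : S ∈ 𝒮_{Θₙ}}`. -/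
def CubicBound (Kdim Kth K : ℝ) : Prop :=
  ∀ S ∈ modelsBar G D Kdim Kth, ∀ u : S → ℝ, u ⬝ᵥ u = 1 →
    (n : ℝ)⁻¹ * ∑ i, |(D.XS S *ᵥ u) i| ^ 3 ≤ K

/-- The requirements on the prior of the model size. -/
structure PriorCond (A₁ A₂ A₃ A₄ : ℝ) : Prop where
  nonneg : ∀ s, 0 ≤ D.w s
  total : ∑ s ∈ Finset.range (D.smax + 1), D.w s = 1
  eq_zero : ∀ s, D.smax < s → D.w s = 0
  lower : ∀ s, 1 ≤ s → s ≤ D.smax → A₁ * (p : ℝ) ^ (-A₃) * D.w (s - 1) ≤ D.w s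
  upper : ∀ s, 1 ≤ s → s ≤ D.smax → D.w s ≤ A₂ * (p : ℝ) ^ (-A₄) * D.w (s - 1)
  smax_le : D.smax ≤ D.X.rank
  le_smax : D.s₀ ≤ D.smax

/-- The prior mass `π_n(S)`. -/
def priorMass (S : Finset (Fin p)) : ℝ := D.w S.card / (p.choose S.card : ℝ)

/-- The empirical prior density `g_S`. -/
def slab (S : Finset (Fin p)) (Y : Fin n → ℝ) (θ : S → ℝ) : ℝ :=
  normalPdf (mle G D S Y) (D.lam • fisher G D S (mle G D S Y))⁻¹ θ

/-- The marginal likelihood `ℳ_α^n(S)`. -/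
def marginal (α : ℝ) (S : Finset (Fin p)) (Y : Fin n → ℝ) : ℝ :=
  ∫ θ : S → ℝ, Real.exp (α * logLik G D S θ Y) * slab G D S Y θ

/-- Its Laplace approximation. -/
def laplace (α : ℝ) (S : Finset (Fin p)) (Y : Fin n → ℝ) : ℝ :=
  Real.exp (α * logLik G D S (mle G D S Y) Y) * (1 + α / D.lam) ^ (-(S.card : ℝ) / 2)

/-- The marginal posterior mass `π_α^n(S)`. -/
def postMass (α : ℝ) (S : Finset (Fin p)) (Y : Fin n → ℝ) : ℝ :=
  priorMass D S * marginal G D α S Y /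
    ∑ S' : Finset (Fin p), priorMass D S' * marginal G D α S' Y

/-- The radius `r̃ = (M² s log p)^{1/2}`. -/
def radius (p : ℕ) (M : ℝ) (s : ℕ) : ℝ := √(M ^ 2 * s * Real.log p)

/-- `δ̃_{n,S}`. -/
def delta (Kdim Kcub M : ℝ) (S : Finset (Fin p)) : ℝ :=
  min (2 * radius p M S.card * zeta G D S)
    (8 * √2 * Kcub / phi2 D ((Kdim + 1) * D.s₀) (W₀ G D) ^ 3 * sigmaMaxSq G D
      * radius p M S.card / √n)

/-- `τ_{n,p,S} = 6 |S| δ̃_{n,S} + 2 / p`. -/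
def tau (Kdim Kcub M : ℝ) (S : Finset (Fin p)) : ℝ :=
  6 * S.card * delta G D Kdim Kcub M S + 2 / p

/-- The conclusion at a fixed sample size: every `τ_S` is at most `1/3`, and there is one event of
probability at least `1 - p⁻¹` on which, for all nonempty `S ∈ 𝒮_{Θₙ}`, the maximum likelihood
estimate exists and is unique, the Laplace approximation has relative error at most `τ_S`, and the
posterior ratio is bounded by the approximate one. -/
def LaplaceAccurate (α Kdim Kth Kcub M : ℝ) : Prop :=
  (∀ S ∈ models G D Kdim Kth, S.Nonempty → tau G D Kdim Kcub M S ≤ 1 / 3) ∧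
  ∃ E : Set (Fin n → ℝ), MeasurableSet E ∧ ENNReal.ofReal (1 - (p : ℝ)⁻¹) ≤ law G D E ∧
    ∀ Y ∈ E, ∀ S ∈ models G D Kdim Kth, S.Nonempty →
      (∃! θ, IsMLE G D S Y θ) ∧
      |1 - marginal G D α S Y / laplace G D α S Y| ≤ tau G D Kdim Kcub M S ∧
      postMass G D α S Y / postMass G D α D.S₀ Y ≤
        (1 + tau G D Kdim Kcub M S) / (1 - tau G D Kdim Kcub M D.S₀) *
          (priorMass D S * laplace G D α S Y / (priorMass D D.S₀ * laplace G D α D.S₀ Y)) ∧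
      postMass G D α S Y / postMass G D α D.S₀ Y ≤
        2 * (priorMass D S * laplace G D α S Y / (priorMass D D.S₀ * laplace G D α D.S₀ Y))

end Fixed

/-! ### The asymptotic assumptions, along a sequence of problems indexed by the sample size -/

section Sequence

variable (G : Family) {p : ℕ → ℕ} (D : ∀ n, Problem n (p n))

/-- (A1): stability of the maximum likelihood estimates, for the nonrandom sequences `Dn` and `θbar`. The two-sided bound on
`F_{mle} F_{θbar}⁻¹` is `Dn⁻¹ F_{θbar} ⪯ F_{mle} ⪯ Dn F_{θbar}` in the Loewner order. -/
structure CondA1 (Dn : ℕ → ℝ) (θbar : ∀ n (S : Finset (Fin (p n))), S → ℝ) : Prop where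
  Dn_gt : ∀ᶠ n in atTop, √2 < Dn n
  nonsingular : ∀ᶠ n in atTop, ∀ S : Finset (Fin (p n)), S.card ≤ (D n).smax →
    IsUnit (fisher G (D n) S (θbar n S)).det
  mle_close : ∀ᶠ n in atTop, ENNReal.ofReal (1 - (p n : ℝ)⁻¹) ≤ law G (D n)
    {Y | ∀ S : Finset (Fin (p n)), S.card ≤ (D n).smax →
      IsMLE G (D n) S Y (mle G (D n) S Y) ∧
      (fisher G (D n) S (mle G (D n) S Y)
        - (Dn n)⁻¹ • fisher G (D n) S (θbar n S)).PosSemidef ∧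
      (Dn n • fisher G (D n) S (θbar n S)
        - fisher G (D n) S (mle G (D n) S Y)).PosSemidef ∧
      (mle G (D n) S Y - θbar n S) ⬝ᵥ
        (fisher G (D n) S (θbar n S) *ᵥ (mle G (D n) S Y - θbar n S))
          ≤ Dn n * S.card * Real.log (p n)}
  nonsingular_S₀ : ∀ᶠ n in atTop,
    IsUnit (fisher G (D n) (D n).S₀ (best G (D n) (D n).S₀)).det
  zeta_small : Tendsto
    (fun n => zeta G (D n) (D n).S₀ ^ 2 * (D n).s₀ * Real.log (p n)) atTop (𝓝 0)

/-- (A2): size conditions on the true model, the prior scale and the learning rate. -/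
structure CondA2 (α : ℝ) (Dn : ℕ → ℝ) (A₄ A₅ A₆ A₇ : ℝ) : Prop where
  log_bound : ∃ C : ℝ, ∀ᶠ n in atTop,
    Real.log (max (max (sigmaMaxSq G (D n)) (rowSumNorm (D n)))
      (max (rhoMin G (D n) (D n).S₀)⁻¹ (rhoMax G (D n) (D n).S₀))) ≤ C * Real.log (p n)
  size : Tendsto (fun n => ((D n).s₀ : ℝ) * Real.log (p n) / n) atTop (𝓝 0)
  lam_lower : ∀ᶠ n in atTop, (p n : ℝ) ^ (-A₅) ≤ (D n).lam
  lam_upper : ∀ᶠ n in atTop, (D n).lam ≤ A₆ * (p n : ℝ) ^ (-A₇)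
  alpha_pos : 0 < α
  alpha_lt : α < 1
  A₄_gt : ∀ᶠ n in atTop, A₆ * (p n : ℝ) ^ (-A₇) < A₄
  Dn_small : Tendsto (fun n => Real.logb (p n) (Dn n)) atTop (𝓝 0)

/-- (A3): identifiability, `‖X‖_max² s₀² log p / φ₂² = o(n)` with `φ₂ > 0`. -/
structure CondA3 (Kdim : ℝ) : Prop where
  phi2_pos : ∀ᶠ n in atTop, 0 < phi2 (D n) ((Kdim + 1) * (D n).s₀) (W₀ G (D n))
  size : Tendsto (fun n => maxNorm (D n) ^ 2 * ((D n).s₀ : ℝ) ^ 2 * Real.log (p n)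
    / phi2 (D n) ((Kdim + 1) * (D n).s₀) (W₀ G (D n)) ^ 2 / n) atTop (𝓝 0)

/-- (A4): conditions for the accuracy of the Laplace approximation. -/
structure CondA4 (Kdim Kth Kcub A₈ : ℝ) : Prop where
  rho_bound : ∀ᶠ n in atTop, ∀ S ∈ models G (D n) Kdim Kth,
    rhoMax G (D n) S ≤ (p n : ℝ) ^ A₈
  cubic : ∀ᶠ n in atTop, CubicBound G (D n) Kdim Kth Kcub
  size : Tendsto (fun n => min
    (√(((D n).s₀ : ℝ) ^ 3 * Real.log (p n)) * zetaMax G (D n) Kdim Kth)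
    (sigmaMaxSq G (D n) / phi2 (D n) ((Kdim + 1) * (D n).s₀) (W₀ G (D n)) ^ 3
      * √(((D n).s₀ : ℝ) ^ 3 * Real.log (p n) / n))) atTop (𝓝 0)

end Sequence

end

end SparseGLM

/-!
The prior of a model `S` is a normal distribution centred at the maximum likelihood estimate with
precision proportional to the Fisher information `F` there. Hence the ratio of the marginal
likelihood to its Laplace approximation is exactly the mean of `exp (α R)`, where `R` is the cubic
remainder of the log-likelihood at its maximum, under the normal distribution with precision
`(α + λ) F`. It remains to show that `R` is small relative to the quadratic term on an ellipsoid,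
and that the outside of the ellipsoid contributes at most `1 / p`. This is
`abs_one_sub_laplace_le`: inside, the comparison with the two Gaussian integrals of precision
`λ + α (1 ± δ)` costs a factor `1 + O(|S| δ)`; outside, concavity propagates the drop of the
likelihood from the boundary, and a radius of order `√(|S| log p)` makes this drop outweigh the
normalizing factor `(1 + α / λ)^(|S| / 2) ≤ p^((A₅ + 1) |S| / 2)`.

Both terms of the minimum that defines `delta` bound the remainder (`abs_drop_sub_le`), because
self-concordance gives `|R h| ≤ C₃ ∑ b'' |xᵢᵀ h|³`: one may bound a factor `|xᵢᵀ h|` by the design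
regularity `zeta`, or use the cubic moment bound and the sparse singular value. The constants that
appear, among them `C₃`, are absorbed by `M`, since the localization radius is a fixed multiple of
`√(|S| log p)` and `radius` is `M √(|S| log p)`.

The estimate is located in two stages, both by the principle `quad_le_of_convex`: a convex function
that is larger on the boundary of an ellipsoid than at its centre has its sublevel set inside. With
the expected loss, and a good approximation of the true coefficient as centre, it gives existence of
the best parameter and its closeness to the truth (`best_spec`), which the sample size condition
translates into equality of the weights `b''` up to a factor `2`. With the empirical loss and the
best parameter as centre it gives the maximum likelihood estimate (`mle_spec`), provided that the
score is at most of order `√(|S| log p)` in the norm dual to the Fisher information. This holds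
simultaneously for all models with probability `1 - 1 / p` (`exists_noise_event`), by Chernoff's
bound at the points of a grid of spacing `1 / p` and a union bound; the moment generating function
of a response is explicit and is controlled by the doubling property of `b''`.

In the asymptotic form the two remaining conditions of the fixed sample size result follow from the
limits: the regularity `zeta` is bounded by the maximal entry of the design and the sparse singular
value (`radius_mul_zeta_le`), and `|S| delta` by the minimum in the last assumption
(`card_mul_delta_le`).
-/

namespace SparseGLM

noncomputable section

/-! ### Analysis of the exponential family -/

namespace Family

variable (G : Family)

/-- The Bregman divergence of the cumulant function `b`: the remainder of its first order expansion
at `x` with increment `δ`. -/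
def breg (x δ : ℝ) : ℝ := G.b (x + δ) - G.b x - G.b' x * δ

lemma hasDerivAt_b (x : ℝ) : HasDerivAt G.b (G.b' x) x := (G.differentiable_b x).hasDerivAt

lemma hasDerivAt_b' (x : ℝ) : HasDerivAt G.b' (G.b'' x) x := (G.differentiable_b' x).hasDerivAt

lemma hasDerivAt_b'' (x : ℝ) : HasDerivAt G.b'' (G.b''' x) x :=
  (G.differentiable_b'' x).hasDerivAt

lemma continuous_b : Continuous G.b := G.differentiable_b.continuous

lemma monotone_b' : Monotone G.b' := by
  have h : MonotoneOn (deriv G.b) Set.univ := G.strictConvex.convexOn.monotoneOn_deriv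
    (fun x _ => G.differentiable_b x)
  exact fun x y hxy => h (Set.mem_univ _) (Set.mem_univ _) hxy

lemma b''_nonneg (x : ℝ) : 0 ≤ G.b'' x := G.monotone_b'.deriv_nonneg

variable {G} {Cdev C₃ : ℝ}

/-- A zero of `b''` would, by the doubling property, make `b'` constant on an interval, against
strict convexity. -/
lemma Doubling.b''_pos (hd : G.Doubling Cdev) (x : ℝ) : 0 < G.b'' x := by
  refine lt_of_le_of_ne (G.b''_nonneg x) fun h0 => ?_
  have hz : ∀ z ∈ Set.Icc x (x + 1 / 2), G.b'' z = 0 := by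
    intro z hz
    have h1 := hd x (z - x) (abs_le.2 ⟨by linarith [hz.1], by linarith [hz.2]⟩)
    rw [← h0, mul_zero, add_sub_cancel] at h1
    exact le_antisymm h1 (G.b''_nonneg z)
  have hc : ∀ z ∈ Set.Icc x (x + 1 / 2), G.b' z = G.b' x := by
    intro z hz'
    refine constant_of_has_deriv_right_zero
      (fun y _ => (G.hasDerivAt_b' y).continuousAt.continuousWithinAt) (fun y hy => ?_) z hz'
    have := (G.hasDerivAt_b' y).hasDerivWithinAt (s := Set.Ici y)
    rwa [hz y ⟨hy.1, hy.2.le⟩] at this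
  have hs : StrictMonoOn (deriv G.b) Set.univ := G.strictConvex.strictMonoOn_deriv
    (fun x _ => G.differentiable_b x)
  have := hs (Set.mem_univ x) (Set.mem_univ (x + 1 / 2)) (by linarith)
  exact absurd (hc (x + 1 / 2) ⟨by linarith, le_rfl⟩) (ne_of_gt this)

/-- Self-concordance makes `log b''` Lipschitz. -/
lemma SelfConcordant.b''_add_le (hs : G.SelfConcordant C₃) (hpos : ∀ x, 0 < G.b'' x)
    (x y : ℝ) : G.b'' (x + y) ≤ Real.exp (C₃ * |y|) * G.b'' x := by
  have hder : ∀ z, HasDerivAt (fun z => Real.log (G.b'' z)) (G.b''' z / G.b'' z) z := fun z =>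
    (G.hasDerivAt_b'' z).log (hpos z).ne'
  have h := Convex.norm_image_sub_le_of_norm_deriv_le (f := fun z => Real.log (G.b'' z))
    (C := C₃) (s := Set.univ) (x := x) (y := x + y) (fun z _ => (hder z).differentiableAt)
    (fun z _ => by
      rw [(hder z).deriv, Real.norm_eq_abs, abs_div, abs_of_pos (hpos z),
        div_le_iff₀ (hpos z)]
      exact hs z) convex_univ (Set.mem_univ _) (Set.mem_univ _)
  rw [Real.norm_eq_abs, Real.norm_eq_abs, add_sub_cancel_left] at h
  have h2 : Real.log (G.b'' (x + y)) ≤ C₃ * |y| + Real.log (G.b'' x) := by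
    linarith [le_abs_self (Real.log (G.b'' (x + y)) - Real.log (G.b'' x))]
  calc G.b'' (x + y) = Real.exp (Real.log (G.b'' (x + y))) := (Real.exp_log (hpos _)).symm
    _ ≤ Real.exp (C₃ * |y| + Real.log (G.b'' x)) := Real.exp_le_exp.2 h2
    _ = _ := by rw [Real.exp_add, Real.exp_log (hpos x)]

lemma SelfConcordant.nonneg (hs : G.SelfConcordant C₃) (hpos : ∀ x, 0 < G.b'' x) : 0 ≤ C₃ := by
  have := (abs_nonneg _).trans (hs 0)
  exact nonneg_of_mul_nonneg_left this (hpos 0)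

lemma SelfConcordant.b''_le_two_mul (hs : G.SelfConcordant C₃) (hpos : ∀ x, 0 < G.b'' x)
    {x y : ℝ} (hy : C₃ * |y - x| ≤ 1 / 2) : G.b'' y ≤ 2 * G.b'' x := by
  have h := hs.b''_add_le hpos x (y - x)
  rw [add_sub_cancel] at h
  refine h.trans (mul_le_mul_of_nonneg_right ?_ (hpos x).le)
  have h1 : Real.exp (C₃ * |y - x|) ≤ Real.exp (1 / 2) := Real.exp_le_exp.2 hy
  have h2 : Real.exp (1 / 2) ^ 2 = Real.exp 1 := by
    rw [← Real.exp_nat_mul]; norm_num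
  have h3 := Real.exp_one_lt_d9
  nlinarith [Real.exp_pos (1 / 2)]

lemma exp_sub_one_le {x : ℝ} (h0 : 0 ≤ x) (h1 : x ≤ 1) : Real.exp x - 1 ≤ 2 * x := by
  have h := Real.abs_exp_sub_one_le (x := x) (by rwa [abs_of_nonneg h0])
  rw [abs_of_nonneg h0] at h
  exact (le_abs_self _).trans h

/-- Local Lipschitz bound of `b''`, relative to its value. -/
lemma SelfConcordant.abs_b''_sub_le (hs : G.SelfConcordant C₃) (hpos : ∀ x, 0 < G.b'' x)
    {x y : ℝ} (hy : C₃ * |y| ≤ 1) : |G.b'' (x + y) - G.b'' x| ≤ 2 * C₃ * |y| * G.b'' x := by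
  have hC := hs.nonneg hpos
  have h0 : 0 ≤ C₃ * |y| := by positivity
  have h1 := hs.b''_add_le hpos x y
  have h2 := hs.b''_add_le hpos (x + y) (-y)
  rw [add_neg_cancel_right, abs_neg] at h2
  have h3 := exp_sub_one_le h0 hy
  have h4 : 1 - C₃ * |y| ≤ Real.exp (-(C₃ * |y|)) := by linarith [Real.add_one_le_exp (-(C₃ * |y|))]
  have h5 : Real.exp (-(C₃ * |y|)) * G.b'' x ≤ G.b'' (x + y) := by
    rw [Real.exp_neg, inv_mul_le_iff₀ (Real.exp_pos _)]; exact h2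
  have hp := hpos x
  rw [abs_le]
  constructor <;> nlinarith

variable (G)

/-- Second order lower bound on the unit interval. -/
lemma half_le_taylor_remainder {f f' f'' : ℝ → ℝ} (h0 : ∀ t, HasDerivAt f (f' t) t)
    (h1 : ∀ t, HasDerivAt f' (f'' t) t) {c : ℝ} (h : ∀ t ∈ Set.Icc (0 : ℝ) 1, c ≤ f'' t) :
    c / 2 ≤ f 1 - f 0 - f' 0 := by
  have hd1 : ∀ t : ℝ, HasDerivAt (fun t => f' t - c * t) (f'' t - c) t := fun t =>
    ((h1 t).sub ((hasDerivAt_id t).const_mul c)).congr_deriv (by simp)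
  have hd0 : ∀ t : ℝ, HasDerivAt (fun t => f t - f' 0 * t - c / 2 * t ^ 2)
      (f' t - f' 0 - c * t) t := fun t =>
    (((h0 t).sub ((hasDerivAt_id t).const_mul (f' 0))).sub
      (((hasDerivAt_id t).pow 2).const_mul (c / 2))).congr_deriv (by simp; ring)
  have hm1 : MonotoneOn (fun t => f' t - c * t) (Set.Icc 0 1) := by
    refine monotoneOn_of_deriv_nonneg (convex_Icc 0 1)
      (fun t _ => (hd1 t).continuousAt.continuousWithinAt)
      (fun t _ => (hd1 t).differentiableAt.differentiableWithinAt) (fun t ht => ?_)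
    rw [(hd1 t).deriv]
    exact sub_nonneg.2 (h t (interior_subset ht))
  have hm0 : MonotoneOn (fun t => f t - f' 0 * t - c / 2 * t ^ 2) (Set.Icc 0 1) := by
    refine monotoneOn_of_deriv_nonneg (convex_Icc 0 1)
      (fun t _ => (hd0 t).continuousAt.continuousWithinAt)
      (fun t _ => (hd0 t).differentiableAt.differentiableWithinAt) (fun t ht => ?_)
    rw [(hd0 t).deriv]
    have ht' := interior_subset ht
    have := hm1 (Set.left_mem_Icc.2 zero_le_one) ht' ht'.1
    simp only [mul_zero, sub_zero] at this
    linarith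
  have := hm0 (Set.left_mem_Icc.2 zero_le_one) (Set.right_mem_Icc.2 zero_le_one) zero_le_one
  simp only [mul_zero, sub_zero] at this
  linarith

lemma hasDerivAt_line (x δ t : ℝ) : HasDerivAt (fun t : ℝ => x + t * δ) δ t := by
  simpa using ((hasDerivAt_id t).mul_const δ).const_add x

lemma hasDerivAt_b_line (x δ t : ℝ) :
    HasDerivAt (fun t : ℝ => G.b (x + t * δ)) (G.b' (x + t * δ) * δ) t :=
  (G.hasDerivAt_b (x + t * δ)).comp t (hasDerivAt_line x δ t)

lemma hasDerivAt_b'_line (x δ t : ℝ) :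
    HasDerivAt (fun t : ℝ => G.b' (x + t * δ) * δ) (G.b'' (x + t * δ) * δ ^ 2) t :=
  (((G.hasDerivAt_b' (x + t * δ)).comp t (hasDerivAt_line x δ t)).mul_const δ).congr_deriv
    (by ring)

lemma le_breg {x δ c : ℝ} (h : ∀ t ∈ Set.Icc (0 : ℝ) 1, c ≤ G.b'' (x + t * δ)) :
    c * δ ^ 2 / 2 ≤ G.breg x δ := by
  have := half_le_taylor_remainder (G.hasDerivAt_b_line x δ) (G.hasDerivAt_b'_line x δ)
    (c := c * δ ^ 2) fun t ht => mul_le_mul_of_nonneg_right (h t ht) (sq_nonneg δ)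
  simpa [breg] using this

lemma breg_le {x δ c : ℝ} (h : ∀ t ∈ Set.Icc (0 : ℝ) 1, G.b'' (x + t * δ) ≤ c) :
    G.breg x δ ≤ c * δ ^ 2 / 2 := by
  have := half_le_taylor_remainder (fun t => (G.hasDerivAt_b_line x δ t).neg)
    (fun t => (G.hasDerivAt_b'_line x δ t).neg)
    (c := -(c * δ ^ 2)) fun t ht => neg_le_neg <|
      mul_le_mul_of_nonneg_right (h t ht) (sq_nonneg δ)
  simp only [one_mul, zero_mul, add_zero, Pi.neg_apply] at this
  unfold breg
  linarith

lemma breg_nonneg (x δ : ℝ) : 0 ≤ G.breg x δ := by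
  simpa using G.le_breg (x := x) (δ := δ) (c := 0) fun t _ => G.b''_nonneg _

variable {G}

lemma abs_mul_le_of_mem_Icc {t δ : ℝ} (ht : t ∈ Set.Icc (0 : ℝ) 1) : |t * δ| ≤ |δ| := by
  rw [abs_mul, abs_of_nonneg ht.1]
  exact mul_le_of_le_one_left (abs_nonneg _) ht.2

lemma Doubling.breg_le (hd : G.Doubling Cdev) {x δ : ℝ} (hδ : |δ| ≤ 1 / 2) :
    G.breg x δ ≤ Cdev * G.b'' x * δ ^ 2 / 2 :=
  G.breg_le fun _ ht => hd _ _ ((abs_mul_le_of_mem_Icc ht).trans hδ)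

lemma Doubling.le_breg (hd : G.Doubling Cdev) (hC : 1 ≤ Cdev) {x δ : ℝ} (hδ : |δ| ≤ 1 / 2) :
    G.b'' x / Cdev * δ ^ 2 / 2 ≤ G.breg x δ := by
  refine G.le_breg fun t ht => ?_
  rw [div_le_iff₀ (by linarith), mul_comm]
  have := hd (x + t * δ) (-(t * δ)) (by rw [abs_neg]; exact (abs_mul_le_of_mem_Icc ht).trans hδ)
  rwa [add_neg_cancel_right] at this

/-- Third order expansion of the cumulant function, with a remainder relative to `b''`. -/
lemma SelfConcordant.abs_breg_sub_le (hs : G.SelfConcordant C₃) (hpos : ∀ x, 0 < G.b'' x)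
    {x δ : ℝ} (hδ : C₃ * |δ| ≤ 1) :
    |G.breg x δ - G.b'' x * δ ^ 2 / 2| ≤ C₃ * G.b'' x * |δ| ^ 3 := by
  have hC := hs.nonneg hpos
  have key : ∀ t ∈ Set.Icc (0 : ℝ) 1,
      |G.b'' (x + t * δ) - G.b'' x| ≤ 2 * C₃ * |δ| * G.b'' x := fun t ht => by
    have h1 := abs_mul_le_of_mem_Icc (δ := δ) ht
    have h2 : C₃ * |t * δ| ≤ C₃ * |δ| := mul_le_mul_of_nonneg_left h1 hC
    have h3 := hs.abs_b''_sub_le hpos (x := x) (y := t * δ) (h2.trans hδ)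
    refine h3.trans ?_
    have := (hpos x).le
    have hC2 : 0 ≤ 2 * C₃ := by positivity
    gcongr
  have hl := G.le_breg (x := x) (δ := δ) (c := G.b'' x - 2 * C₃ * |δ| * G.b'' x)
    fun t ht => by linarith [(abs_le.1 (key t ht)).1]
  have hu := G.breg_le (x := x) (δ := δ) (c := G.b'' x + 2 * C₃ * |δ| * G.b'' x)
    fun t ht => by linarith [(abs_le.1 (key t ht)).2]
  have h3 : |δ| ^ 3 = |δ| * δ ^ 2 := by rw [pow_succ, sq_abs, mul_comm]
  rw [h3, abs_le]
  constructor <;> nlinarith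

lemma SelfConcordant.breg_le_of_le (hs : G.SelfConcordant C₃) (hpos : ∀ x, 0 < G.b'' x)
    {x δ : ℝ} (hδ : C₃ * |δ| ≤ 1 / 2) : G.breg x δ ≤ G.b'' x * δ ^ 2 := by
  have := G.breg_le (x := x) (δ := δ) (c := 2 * G.b'' x) fun t ht =>
    hs.b''_le_two_mul hpos (by
      rw [add_sub_cancel_left]
      exact (mul_le_mul_of_nonneg_left (abs_mul_le_of_mem_Icc ht) (hs.nonneg hpos)).trans hδ)
  linarith

lemma SelfConcordant.le_breg_of_le (hs : G.SelfConcordant C₃) (hpos : ∀ x, 0 < G.b'' x)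
    {x δ : ℝ} (hδ : C₃ * |δ| ≤ 1 / 2) : G.b'' x * δ ^ 2 / 4 ≤ G.breg x δ := by
  have := G.le_breg (x := x) (δ := δ) (c := G.b'' x / 2) fun t ht => by
    have := hs.b''_le_two_mul hpos (x := x + t * δ) (y := x) (by
      rw [sub_add_cancel_left, abs_neg]
      exact (mul_le_mul_of_nonneg_left (abs_mul_le_of_mem_Icc ht) (hs.nonneg hpos)).trans hδ)
    linarith
  linarith

variable (G)

/-! ### Moments of the responses -/

/-- The law of one response at natural parameter `η`. -/
def respLaw (η : ℝ) : Measure ℝ := G.μ.withDensity fun y => ENNReal.ofReal (G.density η y)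

lemma measurable_density (η : ℝ) : Measurable (G.density η) := by
  have := G.measurable_k
  unfold density
  fun_prop

instance (η : ℝ) : IsProbabilityMeasure (G.respLaw η) := by
  constructor
  rw [respLaw, withDensity_apply _ MeasurableSet.univ, Measure.restrict_univ]
  exact G.normalized η

/-- The moment generating function is read off from the normalization at the shifted parameter. -/
lemma lintegral_exp (η t : ℝ) :
    ∫⁻ y, ENNReal.ofReal (Real.exp (t * y)) ∂(G.respLaw η)
      = ENNReal.ofReal (Real.exp (G.b (η + t) - G.b η)) := by
  rw [respLaw, lintegral_withDensity_eq_lintegral_mul _ (G.measurable_density η).ennreal_ofReal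
    (by fun_prop)]
  have h : ∀ y, ((fun y => ENNReal.ofReal (G.density η y)) *
      fun y => ENNReal.ofReal (Real.exp (t * y))) y
      = ENNReal.ofReal (Real.exp (G.b (η + t) - G.b η)) *
        ENNReal.ofReal (Real.exp (y * (η + t) - G.b (η + t) + G.k y)) := fun y => by
    rw [Pi.mul_apply, density, ← ENNReal.ofReal_mul (Real.exp_pos _).le,
      ← ENNReal.ofReal_mul (Real.exp_pos _).le, ← Real.exp_add, ← Real.exp_add]
    ring_nf
  simp_rw [h]
  rw [lintegral_const_mul, G.normalized, mul_one]
  have := G.measurable_k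
  fun_prop

lemma integrable_exp (η t : ℝ) : Integrable (fun y => Real.exp (t * y)) (G.respLaw η) := by
  refine ⟨by fun_prop, ?_⟩
  rw [hasFiniteIntegral_iff_ofReal (ae_of_all _ fun y => (Real.exp_pos _).le), G.lintegral_exp]
  exact ENNReal.ofReal_lt_top

lemma integral_exp (η t : ℝ) :
    ∫ y, Real.exp (t * y) ∂(G.respLaw η) = Real.exp (G.b (η + t) - G.b η) := by
  rw [integral_eq_lintegral_of_nonneg_ae (ae_of_all _ fun y => (Real.exp_pos _).le)
    (by fun_prop), G.lintegral_exp, ENNReal.toReal_ofReal (Real.exp_pos _).le]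

lemma integrable_id_respLaw (η : ℝ) : Integrable (fun y : ℝ => y) (G.respLaw η) := by
  refine Integrable.mono' ((G.integrable_exp η 1).add (G.integrable_exp η (-1)))
    (by fun_prop) (ae_of_all _ fun y => ?_)
  simp only [Pi.add_apply, Real.norm_eq_abs]
  have h1 := Real.add_one_le_exp (1 * y)
  have h2 := Real.add_one_le_exp (-1 * y)
  have h3 := Real.exp_pos (1 * y)
  have h4 := Real.exp_pos (-1 * y)
  rw [abs_le]; constructor <;> linarith

/-- `1 + t y ≤ exp (t y)` shows that `exp (b (η + t) - b η) - t E[y]` is minimal at `t = 0`, where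
its derivative is `b' η - E[y]`. -/
lemma integral_id_respLaw (η : ℝ) : ∫ y, y ∂(G.respLaw η) = G.b' η := by
  set m := ∫ y, y ∂(G.respLaw η)
  have hle : ∀ t, 1 + t * m ≤ Real.exp (G.b (η + t) - G.b η) := fun t => by
    rw [← G.integral_exp, ← integral_const_mul]
    have h1 : (1 : ℝ) = ∫ _, (1 : ℝ) ∂(G.respLaw η) := by simp
    rw [h1, ← integral_add (integrable_const _) ((G.integrable_id_respLaw η).const_mul t)]
    refine integral_mono ((integrable_const _).add ((G.integrable_id_respLaw η).const_mul t))
      (G.integrable_exp η t) fun y => ?_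
    have := Real.add_one_le_exp (t * y)
    simp only
    linarith
  have hmin : IsLocalMin (fun t => Real.exp (G.b (η + t) - G.b η) - t * m) 0 :=
    Filter.Eventually.of_forall fun t => by
      have := hle t
      simp only [add_zero, sub_self, Real.exp_zero, zero_mul, sub_zero]
      linarith
  have hb : HasDerivAt (fun t => G.b (η + t) - G.b η) (G.b' η) 0 := by
    have h0 : HasDerivAt G.b (G.b' η) (η + 0) := by rw [add_zero]; exact G.hasDerivAt_b η
    exact (h0.comp_const_add η 0).sub_const _
  have hd := hb.exp.sub ((hasDerivAt_id (0 : ℝ)).mul_const m)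
  have := hmin.hasDerivAt_eq_zero hd
  simp at this
  linarith

end Family

/-! ### Quadratic forms and Gaussian integrals -/

section Quadratic

variable {m ι : Type*} [Fintype m] [Fintype ι]

lemma dotProduct_gram_mulVec [DecidableEq m] (A : Matrix m ι ℝ) (w : m → ℝ) (x y : ι → ℝ) :
    x ⬝ᵥ ((Aᵀ * diagonal w * A) *ᵥ y) = ∑ i, w i * (A *ᵥ x) i * (A *ᵥ y) i := by
  rw [← mulVec_mulVec, ← mulVec_mulVec, dotProduct_mulVec, vecMul_transpose]
  simp only [dotProduct, mulVec_diagonal]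
  exact Finset.sum_congr rfl fun i _ => by ring

lemma dotProduct_gram_mulVec_self [DecidableEq m] (A : Matrix m ι ℝ) (w : m → ℝ) (x : ι → ℝ) :
    x ⬝ᵥ ((Aᵀ * diagonal w * A) *ᵥ x) = ∑ i, w i * (A *ᵥ x) i ^ 2 := by
  rw [dotProduct_gram_mulVec]
  exact Finset.sum_congr rfl fun i _ => by ring

lemma posDef_gram [DecidableEq m] {A : Matrix m ι ℝ} {w : m → ℝ} (hw : ∀ i, 0 < w i)
    (hA : ∀ x, A *ᵥ x = 0 → x = 0) : (Aᵀ * diagonal w * A).PosDef := by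
  refine PosDef.of_dotProduct_mulVec_pos ?_ fun x hx => ?_
  · simp [IsHermitian, Matrix.mul_assoc]
  · rw [star_trivial, dotProduct_gram_mulVec_self]
    have hne : A *ᵥ x ≠ 0 := fun h => hx (hA x h)
    obtain ⟨i, hi⟩ := Function.ne_iff.1 hne
    refine Finset.sum_pos' (fun i _ => mul_nonneg (hw i).le (sq_nonneg _))
      ⟨i, Finset.mem_univ _, mul_pos (hw i) (by have : (A *ᵥ x) i ≠ 0 := hi; positivity)⟩

variable {F : Matrix ι ι ℝ}

lemma _root_.Matrix.PosDef.quad_nonneg (hF : F.PosDef) (x : ι → ℝ) : 0 ≤ x ⬝ᵥ (F *ᵥ x) := by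
  simpa using hF.posSemidef.dotProduct_mulVec_nonneg x

lemma _root_.Matrix.PosDef.isUnit_det [DecidableEq ι] (hF : F.PosDef) : IsUnit F.det := hF.det_pos.ne'.isUnit

lemma dotProduct_sq_le (x y : ι → ℝ) : (x ⬝ᵥ y) ^ 2 ≤ (x ⬝ᵥ x) * (y ⬝ᵥ y) := by
  have := Finset.sum_mul_sq_le_sq_mul_sq Finset.univ x y
  simpa [dotProduct, sq] using this

lemma dotProduct_self_nonneg' (x : ι → ℝ) : 0 ≤ x ⬝ᵥ x :=
  Finset.sum_nonneg fun i _ => mul_self_nonneg (x i)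

/-- A factorization `F = Pᵀ P` of a positive definite matrix. -/
lemma _root_.Matrix.PosDef.exists_factor [DecidableEq ι] (hF : F.PosDef) : ∃ P : Matrix ι ι ℝ, F = Pᵀ * P ∧ P.det ≠ 0 := by
  open scoped MatrixOrder in
  obtain ⟨P, hP⟩ := CStarAlgebra.nonneg_iff_eq_star_mul_self.1 (nonneg_iff_posSemidef.2 hF.posSemidef)
  rw [star_eq_conjTranspose, conjTranspose_eq_transpose_of_trivial] at hP
  refine ⟨P, hP, fun h => hF.det_pos.ne' ?_⟩
  rw [hP, det_mul, h, mul_zero]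

lemma quad_factor (P : Matrix ι ι ℝ) (x : ι → ℝ) :
    x ⬝ᵥ ((Pᵀ * P) *ᵥ x) = (P *ᵥ x) ⬝ᵥ (P *ᵥ x) := by
  rw [← mulVec_mulVec, dotProduct_mulVec, vecMul_transpose]

/-- A whitening transformation for a positive definite matrix. -/
lemma _root_.Matrix.PosDef.exists_whitening [DecidableEq ι] (hF : F.PosDef) : ∃ Q : Matrix ι ι ℝ,
    (∀ w, (Q *ᵥ w) ⬝ᵥ (F *ᵥ (Q *ᵥ w)) = w ⬝ᵥ w) ∧ ∀ h, ∃ w, Q *ᵥ w = h := by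
  obtain ⟨P, hP, hd⟩ := PosDef.exists_factor hF
  refine ⟨P⁻¹, fun w => ?_, fun h => ⟨P *ᵥ h, ?_⟩⟩
  · rw [hP, quad_factor, mulVec_mulVec, mul_nonsing_inv _ hd.isUnit, one_mulVec]
  · rw [mulVec_mulVec, nonsing_inv_mul _ hd.isUnit, one_mulVec]

/-- The Cauchy–Schwarz inequality for the dual norms of `F⁻¹` and `F`. -/
lemma _root_.Matrix.PosDef.dotProduct_sq_le [DecidableEq ι] (hF : F.PosDef) (x h : ι → ℝ) :
    (x ⬝ᵥ h) ^ 2 ≤ (x ⬝ᵥ (F⁻¹ *ᵥ x)) * (h ⬝ᵥ (F *ᵥ h)) := by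
  obtain ⟨P, hP, hd⟩ := PosDef.exists_factor hF
  have hu := hd.isUnit
  have h1 : x ⬝ᵥ h = (P⁻¹ᵀ *ᵥ x) ⬝ᵥ (P *ᵥ h) := by
    rw [dotProduct_mulVec, mulVec_transpose, vecMul_vecMul, nonsing_inv_mul _ hu, vecMul_one]
  have h2 : x ⬝ᵥ (F⁻¹ *ᵥ x) = (P⁻¹ᵀ *ᵥ x) ⬝ᵥ (P⁻¹ᵀ *ᵥ x) := by
    rw [hP, Matrix.mul_inv_rev, ← transpose_nonsing_inv, ← quad_factor, transpose_transpose]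
  rw [h1, h2, hP, quad_factor]
  exact SparseGLM.dotProduct_sq_le _ _

lemma continuous_quad (F : Matrix ι ι ℝ) : Continuous fun h : ι → ℝ => h ⬝ᵥ (F *ᵥ h) := by
  fun_prop

lemma quad_smul (F : Matrix ι ι ℝ) (t : ℝ) (h : ι → ℝ) :
    (t • h) ⬝ᵥ (F *ᵥ (t • h)) = t ^ 2 * (h ⬝ᵥ (F *ᵥ h)) := by
  rw [mulVec_smul, dotProduct_smul, smul_dotProduct, smul_eq_mul, smul_eq_mul]; ring

lemma isCompact_ellipsoid [DecidableEq ι] (hF : F.PosDef) (c : ι → ℝ) (r : ℝ) :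
    IsCompact {x : ι → ℝ | (x - c) ⬝ᵥ (F *ᵥ (x - c)) ≤ r ^ 2} := by
  have hcl : IsClosed {x : ι → ℝ | (x - c) ⬝ᵥ (F *ᵥ (x - c)) ≤ r ^ 2} :=
    isClosed_le ((continuous_quad F).comp (continuous_id.sub continuous_const)) continuous_const
  -- the coordinates are bounded by the dual norms of the standard basis vectors
  let B : ι → ℝ := fun j => √((Pi.single j 1 ⬝ᵥ (F⁻¹ *ᵥ Pi.single j 1)) * r ^ 2)
  refine (isCompact_Icc (a := c - B) (b := c + B)).of_isClosed_subset hcl fun x hx => ?_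
  have hb : ∀ j, |x j - c j| ≤ B j := fun j => by
    refine Real.abs_le_sqrt ?_
    have h := PosDef.dotProduct_sq_le hF (Pi.single j 1) (x - c)
    rw [single_one_dotProduct] at h
    refine h.trans (mul_le_mul_of_nonneg_left hx ?_)
    exact PosDef.quad_nonneg hF.inv _
  constructor <;> intro j <;> simp only [Pi.sub_apply, Pi.add_apply] <;>
    linarith [(abs_le.1 (hb j)).1, (abs_le.1 (hb j)).2]

/-- On the segment from the centre to a point outside an ellipsoid there is a boundary point, given
here with its coefficient. -/
lemma exists_boundary_point {r : ℝ} (hr : 0 < r) {h : ι → ℝ}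
    (hh : r ^ 2 < h ⬝ᵥ (F *ᵥ h)) :
    ∃ t : ℝ, 0 < t ∧ t < 1 ∧ (t • h) ⬝ᵥ (F *ᵥ (t • h)) = r ^ 2 := by
  have hq : 0 < h ⬝ᵥ (F *ᵥ h) := lt_trans (by positivity) hh
  have hs : 0 < √(h ⬝ᵥ (F *ᵥ h)) := Real.sqrt_pos.2 hq
  refine ⟨r / √(h ⬝ᵥ (F *ᵥ h)), by positivity, ?_, ?_⟩
  · rw [div_lt_one hs]
    exact Real.lt_sqrt_of_sq_lt hh
  · rw [quad_smul, div_pow, Real.sq_sqrt hq.le, div_mul_cancel₀ _ hq.ne']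

/-- A convex function that exceeds its value at the centre on the boundary of an ellipsoid has all
its sublevel points inside. -/
lemma quad_le_of_convex {f : (ι → ℝ) → ℝ} (hf : ConvexOn ℝ Set.univ f) {c : ι → ℝ} {r : ℝ}
    (hr : 0 < r) (hb : ∀ h, h ⬝ᵥ (F *ᵥ h) = r ^ 2 → f c < f (c + h)) {x : ι → ℝ}
    (hx : f x ≤ f c) : (x - c) ⬝ᵥ (F *ᵥ (x - c)) ≤ r ^ 2 := by
  by_contra! hlt
  obtain ⟨t, ht0, ht1, ht⟩ := exists_boundary_point hr hlt
  have h1 := hb _ ht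
  have h2 := hf.2 (Set.mem_univ c) (Set.mem_univ x) (sub_nonneg.2 ht1.le) ht0.le (by ring)
  have h3 : (1 - t) • c + t • x = c + t • (x - c) := by
    rw [sub_smul, one_smul, smul_sub]; abel
  rw [h3, smul_eq_mul, smul_eq_mul] at h2
  nlinarith

lemma exists_min_of_convex [DecidableEq ι] (hF : F.PosDef) {f : (ι → ℝ) → ℝ} (hf : ConvexOn ℝ Set.univ f)
    (hc : Continuous f) {c : ι → ℝ} {r : ℝ} (hr : 0 < r)
    (hb : ∀ h, h ⬝ᵥ (F *ᵥ h) = r ^ 2 → f c < f (c + h)) : ∃ x, ∀ y, f x ≤ f y := by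
  have hne : {x : ι → ℝ | (x - c) ⬝ᵥ (F *ᵥ (x - c)) ≤ r ^ 2}.Nonempty :=
    ⟨c, by simp; positivity⟩
  obtain ⟨x, -, hx⟩ := (isCompact_ellipsoid hF c r).exists_isMinOn hne hc.continuousOn
  refine ⟨x, fun y => ?_⟩
  rcases le_total (f y) (f c) with hy | hy
  · exact hx (quad_le_of_convex hf hr hb hy)
  · exact (hx (show c ∈ {x : ι → ℝ | (x - c) ⬝ᵥ (F *ᵥ (x - c)) ≤ r ^ 2} by
      simp; positivity)).trans hy

lemma integral_comp_mulVec [DecidableEq ι] {P : Matrix ι ι ℝ} (hP : P.det ≠ 0) {f : (ι → ℝ) → ℝ}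
    (hf : Continuous f) : ∫ x, f (P *ᵥ x) = |P.det|⁻¹ * ∫ x, f x := by
  have h := Real.map_matrix_volume_pi_eq_smul_volume_pi hP
  have h1 : ∫ x, f x ∂(Measure.map (toLin' P) volume) = ∫ x, f (P *ᵥ x) := by
    rw [integral_map (LinearMap.continuous_on_pi _).aemeasurable hf.aestronglyMeasurable]
    rfl
  rw [← h1, h, integral_smul_measure, ENNReal.toReal_ofReal (abs_nonneg _), abs_inv, smul_eq_mul]

lemma integral_exp_quad [DecidableEq ι] (hF : F.PosDef) {a : ℝ} (ha : 0 < a) :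
    ∫ h : ι → ℝ, Real.exp (-(a / 2) * (h ⬝ᵥ (F *ᵥ h)))
      = √(2 * Real.pi / a) ^ Fintype.card ι / √F.det := by
  obtain ⟨P, hP, hd⟩ := PosDef.exists_factor hF
  have h1 : ∀ h : ι → ℝ, Real.exp (-(a / 2) * (h ⬝ᵥ (F *ᵥ h)))
      = (fun w : ι → ℝ => Real.exp (-(a / 2) * (w ⬝ᵥ w))) (P *ᵥ h) := fun h => by
    rw [hP, quad_factor]
  simp_rw [h1]
  rw [integral_comp_mulVec hd (f := fun w : ι → ℝ => Real.exp (-(a / 2) * (w ⬝ᵥ w)))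
    (by fun_prop)]
  have h2 : ∀ w : ι → ℝ, Real.exp (-(a / 2) * (w ⬝ᵥ w))
      = ∏ i, Real.exp (-(a / 2) * w i ^ 2) := fun w => by
    rw [← Real.exp_sum, dotProduct, Finset.mul_sum]
    simp_rw [sq]
  simp_rw [h2]
  rw [integral_fintype_prod_volume_eq_pow (fun x : ℝ => Real.exp (-(a / 2) * x ^ 2)),
    integral_gaussian]
  have h3 : F.det = P.det ^ 2 := by rw [hP, det_mul, det_transpose, sq]
  rw [h3, Real.sqrt_sq_eq_abs, div_eq_inv_mul _ |P.det|, show Real.pi / (a / 2) = 2 * Real.pi / a by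
    field_simp]

lemma integrable_exp_quad [DecidableEq ι] (hF : F.PosDef) {a : ℝ} (ha : 0 < a) :
    Integrable fun h : ι → ℝ => Real.exp (-(a / 2) * (h ⬝ᵥ (F *ᵥ h))) := by
  -- the integral of a function that is not integrable would be zero
  refine Integrable.of_integral_ne_zero ?_
  rw [integral_exp_quad hF ha]
  have := hF.det_pos
  positivity

lemma normalPdf_eq [DecidableEq ι] (hF : F.PosDef) {l : ℝ} (hl : 0 < l) (μ x : ι → ℝ) :
    normalPdf μ (l • F)⁻¹ x = √F.det / √(2 * Real.pi / l) ^ Fintype.card ι *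
      Real.exp (-(l / 2) * ((x - μ) ⬝ᵥ (F *ᵥ (x - μ)))) := by
  have hu := PosDef.isUnit_det (hF.smul hl)
  have hd := hF.det_pos
  unfold normalPdf
  rw [nonsing_inv_nonsing_inv _ hu, smul_mulVec, dotProduct_smul, smul_eq_mul]
  congr 1
  · rw [det_smul, det_nonsing_inv, Ring.inverse_eq_inv', det_smul, ← Real.sqrt_inv]
    have : ((2 * Real.pi) ^ Fintype.card ι * (l ^ Fintype.card ι * F.det)⁻¹)⁻¹
        = F.det / (2 * Real.pi / l) ^ Fintype.card ι := by
      have := Real.pi_pos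
      rw [div_pow]
      field_simp
    rw [this, Real.sqrt_div hd.le]
    congr 1
    have h0 : 0 ≤ 2 * Real.pi / l := by have := Real.pi_pos; positivity
    rw [Real.sqrt_eq_rpow, Real.sqrt_eq_rpow, ← Real.rpow_natCast, ← Real.rpow_natCast,
      ← Real.rpow_mul h0, ← Real.rpow_mul h0, mul_comm (1 / 2 : ℝ)]
  · congr 1; ring

/-- Exponential moments of the quadratic form under the normal distribution. -/
lemma integral_exp_mul_normalPdf [DecidableEq ι] (hF : F.PosDef) {l c : ℝ} (hl : 0 < l) (hc : 0 ≤ c)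
    (μ : ι → ℝ) :
    Integrable (fun x => Real.exp (-(c / 2) * ((x - μ) ⬝ᵥ (F *ᵥ (x - μ)))) *
      normalPdf μ (l • F)⁻¹ x) ∧
    ∫ x, Real.exp (-(c / 2) * ((x - μ) ⬝ᵥ (F *ᵥ (x - μ)))) * normalPdf μ (l • F)⁻¹ x
      = (l / (l + c)) ^ ((Fintype.card ι : ℝ) / 2) := by
  have hlc : 0 < l + c := by linarith
  have h1 : ∀ x, Real.exp (-(c / 2) * ((x - μ) ⬝ᵥ (F *ᵥ (x - μ)))) * normalPdf μ (l • F)⁻¹ x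
      = √F.det / √(2 * Real.pi / l) ^ Fintype.card ι *
        (fun h => Real.exp (-((l + c) / 2) * (h ⬝ᵥ (F *ᵥ h)))) (x - μ) := fun x => by
    rw [normalPdf_eq hF hl, mul_left_comm, ← Real.exp_add]
    ring_nf
  have hd := hF.det_pos
  have hpi := Real.pi_pos
  simp_rw [h1]
  constructor
  · exact ((integrable_exp_quad hF hlc).comp_sub_right μ).const_mul _
  · rw [integral_const_mul, integral_sub_right_eq_self
      (fun h : ι → ℝ => Real.exp (-((l + c) / 2) * (h ⬝ᵥ (F *ᵥ h)))), integral_exp_quad hF hlc]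
    have h2 : √F.det / √(2 * Real.pi / l) ^ Fintype.card ι *
        (√(2 * Real.pi / (l + c)) ^ Fintype.card ι / √F.det)
        = (√(2 * Real.pi / (l + c)) / √(2 * Real.pi / l)) ^ Fintype.card ι := by
      rw [div_pow]
      field_simp
    rw [h2, ← Real.sqrt_div (by positivity)]
    have h3 : 2 * Real.pi / (l + c) / (2 * Real.pi / l) = l / (l + c) := by field_simp
    rw [h3, Real.sqrt_eq_rpow, ← Real.rpow_natCast, ← Real.rpow_mul (by positivity)]
    congr 1; ring

lemma normalPdf_nonneg [DecidableEq ι] (μ : ι → ℝ) (Q : Matrix ι ι ℝ) (x : ι → ℝ) : 0 ≤ normalPdf μ Q x := by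
  unfold normalPdf; positivity

lemma continuous_normalPdf [DecidableEq ι] (μ : ι → ℝ) (Q : Matrix ι ι ℝ) : Continuous (normalPdf μ Q) := by
  unfold normalPdf; fun_prop

end Quadratic

/-! ### A grid in the unit ball -/

section Grid

variable {ι : Type*}

/-- The points of the grid of spacing `1 / p` in the cube `[-1, 1]^ι`, indexed by
`ι → Fin (2 p + 1)`. -/
def gridPoint (p : ℕ) (k : ι → Fin (2 * p + 1)) : ι → ℝ := fun i => ((k i : ℕ) - (p : ℝ)) / p

lemma exists_gridPoint_near {p : ℕ} (hp : 0 < p) {u : ι → ℝ} (hu : ∀ i, |u i| ≤ 1) :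
    ∃ k, ∀ i, |gridPoint p k i - u i| ≤ 1 / p := by
  have hp' : (0 : ℝ) < p := by exact_mod_cast hp
  have key : ∀ i, ∃ j : Fin (2 * p + 1), |((j : ℕ) - (p : ℝ)) / p - u i| ≤ 1 / p := fun i => by
    obtain ⟨hl, hr⟩ := abs_le.1 (hu i)
    have h0 : 0 ≤ p * (u i + 1) := mul_nonneg hp'.le (by linarith)
    have h1 := Nat.floor_le h0
    have h2 := (Nat.lt_floor_add_one (p * (u i + 1))).le
    refine ⟨⟨⌊p * (u i + 1)⌋₊, ?_⟩, ?_⟩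
    · rw [Nat.lt_succ_iff, ← Nat.cast_le (α := ℝ)]
      push_cast
      nlinarith
    · have h3 : ((⌊p * (u i + 1)⌋₊ : ℝ) - p) / p - u i = (⌊p * (u i + 1)⌋₊ - p * (u i + 1)) / p := by
        field_simp
        ring
      rw [h3, abs_div, abs_of_pos hp', div_le_div_iff_of_pos_right hp', abs_le]
      constructor <;> linarith
  choose k hk using key
  exact ⟨k, hk⟩

variable [Fintype ι]

/-- A linear form that is bounded by `R` on the grid points of squared norm at most `2` has norm at
most `2 R`. -/
lemma dotProduct_self_le_of_grid {p : ℕ} (hp : 16 ≤ p) (hcard : Fintype.card ι ≤ p)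
    {v : ι → ℝ} {R : ℝ} (h : ∀ k, gridPoint p k ⬝ᵥ gridPoint p k ≤ 2 → v ⬝ᵥ gridPoint p k ≤ R) :
    v ⬝ᵥ v ≤ (2 * R) ^ 2 := by
  have hp' : (16 : ℝ) ≤ p := by exact_mod_cast hp
  rcases (dotProduct_self_nonneg' v).eq_or_lt with h0 | hpos
  · rw [← h0]; positivity
  set N := √(v ⬝ᵥ v) with hN
  have hNp : 0 < N := Real.sqrt_pos.2 hpos
  have hN2 : N ^ 2 = v ⬝ᵥ v := Real.sq_sqrt hpos.le
  set u : ι → ℝ := N⁻¹ • v with hu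
  have huu : u ⬝ᵥ u = 1 := by
    rw [hu, smul_dotProduct, dotProduct_smul, ← hN2, smul_eq_mul, smul_eq_mul]; field_simp
  have hvu : v ⬝ᵥ u = N := by
    rw [hu, dotProduct_smul, ← hN2, smul_eq_mul]; field_simp
  have hu1 : ∀ i, |u i| ≤ 1 := fun i => by
    rw [← sq_le_one_iff_abs_le_one, ← huu, dotProduct, sq]
    exact Finset.single_le_sum (f := fun i => u i * u i) (fun i _ => mul_self_nonneg (u i))
      (Finset.mem_univ i)
  obtain ⟨k, hk⟩ := exists_gridPoint_near (p := p) (by omega) hu1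
  set d : ι → ℝ := gridPoint p k - u with hd
  have hdd : d ⬝ᵥ d ≤ 1 / 16 := by
    have h1 : d ⬝ᵥ d ≤ ∑ _i : ι, (1 / (p : ℝ)) ^ 2 := by
      refine Finset.sum_le_sum fun i _ => ?_
      rw [← sq, ← sq_abs]
      exact pow_le_pow_left₀ (abs_nonneg _) (hk i) 2
    rw [Finset.sum_const, nsmul_eq_mul, Finset.card_univ] at h1
    have h2 : (Fintype.card ι : ℝ) ≤ p := by exact_mod_cast hcard
    have h3 : (Fintype.card ι : ℝ) * (1 / (p : ℝ)) ^ 2 ≤ p * (1 / (p : ℝ)) ^ 2 := by gcongr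
    have h4 : p * (1 / (p : ℝ)) ^ 2 = 1 / p := by field_simp
    have h5 : 1 / (p : ℝ) ≤ 1 / 16 := one_div_le_one_div_of_le (by norm_num) hp'
    linarith
  have hg : gridPoint p k = u + d := by rw [hd]; abel
  have hud : (u ⬝ᵥ d) ^ 2 ≤ 1 / 16 := by
    have := dotProduct_sq_le u d
    rw [huu, one_mul] at this
    exact this.trans hdd
  have hud' : u ⬝ᵥ d ≤ 1 / 4 := by nlinarith
  have hud'' : -(1 / 4) ≤ u ⬝ᵥ d := by nlinarith
  have hk2 := h k (by
    rw [hg, add_dotProduct, dotProduct_add, dotProduct_add, dotProduct_comm d u, huu]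
    linarith)
  have hvd : v ⬝ᵥ d = N * (u ⬝ᵥ d) := by
    rw [hu, smul_dotProduct, smul_eq_mul]; field_simp
  rw [hg, dotProduct_add, hvu, hvd] at hk2
  rw [← hN2]
  have : N ≤ 2 * R := by nlinarith
  exact pow_le_pow_left₀ hNp.le this 2

end Grid

/-! ### The negative log-likelihood -/

section Loss

variable {m ι : Type*} [Fintype m] [Fintype ι] (G : Family) (A : Matrix m ι ℝ) (z : m → ℝ)

/-- The negative log-likelihood with design `A` and responses `z`, without the terms `k (z i)`. The
choice `z = b'(η₀)` gives the expected negative log-likelihood. -/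
def loss (θ : ι → ℝ) : ℝ := ∑ i, (G.b ((A *ᵥ θ) i) - z i * (A *ᵥ θ) i)

lemma continuous_loss : Continuous (loss G A z) := by
  have := G.continuous_b
  unfold loss
  fun_prop

lemma convexOn_loss : ConvexOn ℝ Set.univ (loss G A z) := by
  refine ⟨convex_univ, fun x _ y _ s t hs ht hst => ?_⟩
  simp only [loss, smul_eq_mul, Finset.mul_sum, ← Finset.sum_add_distrib]
  refine Finset.sum_le_sum fun i _ => ?_
  have h := G.strictConvex.convexOn.2 (Set.mem_univ ((A *ᵥ x) i)) (Set.mem_univ ((A *ᵥ y) i))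
    hs ht hst
  have h2 : (A *ᵥ (s • x + t • y)) i = s * (A *ᵥ x) i + t * (A *ᵥ y) i := by
    simp [mulVec_add, mulVec_smul]
  simp only [smul_eq_mul] at h
  rw [h2]
  linarith

lemma loss_add (θ h : ι → ℝ) : loss G A z (θ + h) = loss G A z θ
    + ∑ i, G.breg ((A *ᵥ θ) i) ((A *ᵥ h) i) + ∑ i, (G.b' ((A *ᵥ θ) i) - z i) * (A *ᵥ h) i := by
  simp only [loss, ← Finset.sum_add_distrib, mulVec_add, Pi.add_apply, Family.breg]
  exact Finset.sum_congr rfl fun i _ => by ring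

variable {G A z}

/-- The score equation. -/
lemma score_eq_zero {θ : ι → ℝ} (hθ : ∀ x, loss G A z θ ≤ loss G A z x) (h : ι → ℝ) :
    ∑ i, (G.b' ((A *ᵥ θ) i) - z i) * (A *ᵥ h) i = 0 := by
  have hd : HasDerivAt (fun t : ℝ => ∑ i, (G.b ((A *ᵥ θ) i + t * (A *ᵥ h) i)
      - z i * ((A *ᵥ θ) i + t * (A *ᵥ h) i)))
      (∑ i, (G.b' ((A *ᵥ θ) i + 0 * (A *ᵥ h) i) * (A *ᵥ h) i - z i * (A *ᵥ h) i)) 0 :=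
    HasDerivAt.fun_sum fun i _ => (G.hasDerivAt_b_line _ _ 0).sub
      ((Family.hasDerivAt_line _ _ 0).const_mul (z i))
  have hmin : IsLocalMin (fun t : ℝ => ∑ i, (G.b ((A *ᵥ θ) i + t * (A *ᵥ h) i)
      - z i * ((A *ᵥ θ) i + t * (A *ᵥ h) i))) 0 := Filter.Eventually.of_forall fun t => by
    have := hθ (θ + t • h)
    simpa [loss, mulVec_add, mulVec_smul] using this
  have := hmin.hasDerivAt_eq_zero hd
  simpa [sub_mul] using this

lemma loss_add_of_min {θ : ι → ℝ} (hθ : ∀ x, loss G A z θ ≤ loss G A z x) (h : ι → ℝ) :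
    loss G A z (θ + h) = loss G A z θ + ∑ i, G.breg ((A *ᵥ θ) i) ((A *ᵥ h) i) := by
  rw [loss_add, score_eq_zero hθ, add_zero]

lemma Family.breg_pos (G : Family) {x δ : ℝ} (hδ : δ ≠ 0) : 0 < G.breg x δ := by
  have h := G.strictConvex.2 (Set.mem_univ x) (Set.mem_univ (x + δ)) (by simpa using hδ)
    (show (0 : ℝ) < 1 / 2 by norm_num) (show (0 : ℝ) < 1 / 2 by norm_num) (by norm_num)
  have h2 := G.breg_nonneg x (δ / 2)
  simp only [smul_eq_mul] at h
  rw [show 1 / 2 * x + 1 / 2 * (x + δ) = x + δ / 2 by ring] at h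
  unfold Family.breg at *
  linarith

lemma loss_min_unique (hA : ∀ x, A *ᵥ x = 0 → x = 0) {θ θ' : ι → ℝ}
    (hθ : ∀ x, loss G A z θ ≤ loss G A z x) (hθ' : ∀ x, loss G A z θ' ≤ loss G A z x) :
    θ' = θ := by
  have h := loss_add_of_min hθ (θ' - θ)
  rw [add_sub_cancel, le_antisymm (hθ' θ) (hθ θ')] at h
  have h0 : ∑ i, G.breg ((A *ᵥ θ) i) ((A *ᵥ (θ' - θ)) i) = 0 := by linarith
  rw [Finset.sum_eq_zero_iff_of_nonneg fun i _ => G.breg_nonneg _ _] at h0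
  refine sub_eq_zero.1 (hA _ (funext fun i => ?_))
  by_contra hi
  exact (G.breg_pos hi).ne' (h0 i (Finset.mem_univ i))

/-- Weighted Minkowski bounds for the sum of a short and a long vector. -/
lemma sum_weighted_add_sq {w d a : m → ℝ} (hw : ∀ i, 0 ≤ w i) {ρ : ℝ}
    (hd : ∑ i, w i * d i ^ 2 ≤ ρ ^ 2) (ha : ∑ i, w i * a i ^ 2 ≤ (4 * ρ) ^ 2) :
    ∑ i, w i * (d i + a i) ^ 2 ≤ (5 * ρ) ^ 2 ∧
    ∑ i, w i * a i ^ 2 - 8 * ρ ^ 2 ≤ ∑ i, w i * (d i + a i) ^ 2 := by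
  have hd0 : 0 ≤ ∑ i, w i * d i ^ 2 := Finset.sum_nonneg fun i _ => mul_nonneg (hw i) (sq_nonneg _)
  have ha0 : 0 ≤ ∑ i, w i * a i ^ 2 := Finset.sum_nonneg fun i _ => mul_nonneg (hw i) (sq_nonneg _)
  have hexp : ∑ i, w i * (d i + a i) ^ 2
      = ∑ i, w i * d i ^ 2 + 2 * ∑ i, w i * (d i * a i) + ∑ i, w i * a i ^ 2 := by
    rw [Finset.mul_sum, ← Finset.sum_add_distrib, ← Finset.sum_add_distrib]
    exact Finset.sum_congr rfl fun i _ => by ring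
  have hcs : (∑ i, w i * (d i * a i)) ^ 2 ≤ (∑ i, w i * d i ^ 2) * ∑ i, w i * a i ^ 2 := by
    have h := Finset.sum_mul_sq_le_sq_mul_sq Finset.univ (fun i => √(w i) * d i)
      (fun i => √(w i) * a i)
    have e : ∀ i, √(w i) * √(w i) = w i := fun i => Real.mul_self_sqrt (hw i)
    have e1 : ∀ i, √(w i) * d i * (√(w i) * a i) = w i * (d i * a i) := fun i => by
      rw [mul_mul_mul_comm, e]
    simpa only [e1, mul_pow, Real.sq_sqrt (hw _)] using h
  have hb : (∑ i, w i * (d i * a i)) ^ 2 ≤ (4 * ρ ^ 2) ^ 2 := by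
    refine hcs.trans ((mul_le_mul hd ha ha0 (sq_nonneg _)).trans (le_of_eq (by ring)))
  have hb' := abs_le_of_sq_le_sq' hb (by positivity)
  rw [hexp]
  constructor <;> nlinarith [hb'.1, hb'.2]

end Loss

section Fixed

variable {n p : ℕ} (G : Family) (D : Problem n p)

/-! ### Restriction of the design to a model -/

lemma XS_mulVec (S : Finset (Fin p)) (θ : S → ℝ) : D.XS S *ᵥ θ = D.X *ᵥ extend S θ := by
  ext i
  simp only [mulVec, dotProduct, Problem.XS, submatrix_apply, id]
  have h : ∀ j : S, D.X i j * θ j = D.X i j * extend S θ j := fun j => by simp [extend]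
  rw [Finset.sum_congr rfl fun j _ => h j,
    Finset.sum_coe_sort S fun j => D.X i j * extend S θ j]
  refine Finset.sum_subset (Finset.subset_univ S) fun j _ hj => ?_
  simp [extend, hj]

lemma extend_dotProduct_self (S : Finset (Fin p)) (θ : S → ℝ) :
    extend S θ ⬝ᵥ extend S θ = θ ⬝ᵥ θ := by
  simp only [dotProduct]
  have h : ∀ j : S, θ j * θ j = extend S θ j * extend S θ j := fun j => by simp [extend]
  rw [Finset.sum_congr rfl fun j _ => h j,
    Finset.sum_coe_sort S fun j => extend S θ j * extend S θ j]
  symm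
  refine Finset.sum_subset (Finset.subset_univ S) fun j _ hj => ?_
  simp [extend, hj]

lemma supp_extend_subset (S : Finset (Fin p)) (θ : S → ℝ) : supp (extend S θ) ⊆ S := fun j hj => by
  by_contra h
  simp [supp, extend, h] at hj

lemma supp_extend_sub_subset (S : Finset (Fin p)) (θ : S → ℝ) (θ' : Fin p → ℝ) :
    supp (extend S θ - θ') ⊆ S ∪ supp θ' := fun j hj => by
  by_contra h
  simp only [supp, Finset.mem_union, not_or, Finset.mem_filter, Finset.mem_univ, true_and,
    not_not] at h hj
  exact hj (by simp [extend, h.1, h.2])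

lemma fisher_quad (S : Finset (Fin p)) (θ h : S → ℝ) : h ⬝ᵥ (fisher G D S θ *ᵥ h)
    = ∑ i, G.b'' ((D.XS S *ᵥ θ) i) * (D.XS S *ᵥ h) i ^ 2 :=
  dotProduct_gram_mulVec_self _ _ _

lemma fisherFull_quad (v : Fin p → ℝ) : v ⬝ᵥ (fisherFull G D *ᵥ v)
    = ∑ i, G.b'' ((D.X *ᵥ D.θ₀) i) * (D.X *ᵥ v) i ^ 2 :=
  dotProduct_gram_mulVec_self _ _ _

/-- The weighted squared norm of a linear predictor at the true coefficient. -/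
def trueQuad (η : Fin n → ℝ) : ℝ := ∑ i, G.b'' ((D.X *ᵥ D.θ₀) i) * η i ^ 2

lemma trueQuad_nonneg (η : Fin n → ℝ) : 0 ≤ trueQuad G D η :=
  Finset.sum_nonneg fun _ _ => mul_nonneg (G.b''_nonneg _) (sq_nonneg _)

lemma phi2_set_nonneg {s r : ℝ} (hr : r ∈ {r : ℝ | ∃ θ : Fin p → ℝ, 0 < (supp θ).card ∧
    ((supp θ).card : ℝ) ≤ s ∧ r = (θ ⬝ᵥ (((n : ℝ)⁻¹ • (D.Xᵀ * W₀ G D * D.X)) *ᵥ θ)) / (θ ⬝ᵥ θ)}) :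
    0 ≤ r := by
  obtain ⟨θ, -, -, rfl⟩ := hr
  rw [smul_mulVec, dotProduct_smul, smul_eq_mul]
  have h := fisherFull_quad G D θ
  rw [fisherFull] at h
  rw [h]
  exact div_nonneg (mul_nonneg (by positivity) (trueQuad_nonneg G D _)) (dotProduct_self_nonneg' _)

lemma n_pos_of_phi2_pos {s : ℝ} (h : 0 < phi2 D s (W₀ G D)) : 0 < n := by
  rcases Nat.eq_zero_or_pos n with rfl | hn
  · exfalso
    rw [phi2, Real.sqrt_pos] at h
    refine absurd h (not_lt.2 (Real.sInf_nonpos fun r hr => ?_))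
    obtain ⟨θ, -, -, rfl⟩ := hr
    simp
  · exact hn

/-- The defining property of the sparse singular value. -/
lemma phi2_sq_mul_le {s : ℝ} (h : 0 < phi2 D s (W₀ G D)) {θ : Fin p → ℝ}
    (hθ : ((supp θ).card : ℝ) ≤ s) :
    n * phi2 D s (W₀ G D) ^ 2 * (θ ⬝ᵥ θ) ≤ trueQuad G D (D.X *ᵥ θ) := by
  have hn : (0 : ℝ) < n := by exact_mod_cast n_pos_of_phi2_pos G D h
  rcases Nat.eq_zero_or_pos (supp θ).card with h0 | hc
  · have : θ = 0 := by
      ext j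
      by_contra hj
      have : j ∈ supp θ := by simpa [supp] using hj
      rw [Finset.card_eq_zero.1 h0] at this
      simp at this
    subst this
    simpa using trueQuad_nonneg G D _
  · have hpos : 0 < θ ⬝ᵥ θ := by
      obtain ⟨j, hj⟩ := Finset.card_pos.1 hc
      have hj' : θ j ≠ 0 := by simpa [supp] using hj
      exact Finset.sum_pos' (fun i _ => mul_self_nonneg (θ i))
        ⟨j, Finset.mem_univ _, mul_self_pos.2 hj'⟩
    have hle : phi2 D s (W₀ G D) ^ 2
        ≤ (θ ⬝ᵥ (((n : ℝ)⁻¹ • (D.Xᵀ * W₀ G D * D.X)) *ᵥ θ)) / (θ ⬝ᵥ θ) := by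
      rw [phi2, Real.sq_sqrt (Real.sqrt_pos.1 h).le]
      exact csInf_le ⟨0, fun r hr => phi2_set_nonneg G D hr⟩ ⟨θ, hc, hθ, rfl⟩
    have hq := fisherFull_quad G D θ
    rw [fisherFull] at hq
    rw [smul_mulVec, dotProduct_smul, smul_eq_mul, hq, le_div_iff₀ hpos] at hle
    rw [trueQuad, mul_assoc]
    calc (n : ℝ) * (phi2 D s (W₀ G D) ^ 2 * (θ ⬝ᵥ θ)) ≤ n * ((n : ℝ)⁻¹ * _) := by gcongr
      _ = _ := by field_simp

lemma phi2_sq_mul_le_restrict {s : ℝ} (h : 0 < phi2 D s (W₀ G D)) {S : Finset (Fin p)}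
    (hS : (S.card : ℝ) ≤ s) (x : S → ℝ) :
    n * phi2 D s (W₀ G D) ^ 2 * (x ⬝ᵥ x) ≤ trueQuad G D (D.XS S *ᵥ x) := by
  rw [XS_mulVec, ← extend_dotProduct_self]
  refine phi2_sq_mul_le G D h (le_trans ?_ hS)
  exact_mod_cast Finset.card_le_card (supp_extend_subset S x)

lemma XS_injective {s : ℝ} (h : 0 < phi2 D s (W₀ G D)) {S : Finset (Fin p)}
    (hS : (S.card : ℝ) ≤ s) (x : S → ℝ) (hx : D.XS S *ᵥ x = 0) : x = 0 := by
  have h1 := phi2_sq_mul_le_restrict G D h hS x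
  have hn : (0 : ℝ) < n := by exact_mod_cast n_pos_of_phi2_pos G D h
  rw [hx] at h1
  have h2 : trueQuad G D 0 = 0 := by simp [trueQuad]
  rw [h2] at h1
  have h3 : x ⬝ᵥ x ≤ 0 := by
    by_contra! hlt
    have : 0 < n * phi2 D s (W₀ G D) ^ 2 * (x ⬝ᵥ x) := by positivity
    linarith
  exact dotProduct_self_eq_zero.1 (le_antisymm h3 (dotProduct_self_nonneg' _))

lemma abs_le_maxNorm (i : Fin n) (j : Fin p) : |D.X i j| ≤ maxNorm D :=
  (le_ciSup (f := fun j => |D.X i j|) (Set.finite_range _).bddAbove j).trans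
    (le_ciSup (f := fun i => ⨆ j, |D.X i j|) (Set.finite_range _).bddAbove i)

lemma mulVec_sq_le (v : Fin p → ℝ) (i : Fin n) :
    (D.X *ᵥ v) i ^ 2 ≤ maxNorm D ^ 2 * (supp v).card * (v ⬝ᵥ v) := by
  have h0 : (D.X *ᵥ v) i = ∑ j ∈ supp v, D.X i j * v j := by
    simp only [mulVec, dotProduct]
    symm
    refine Finset.sum_subset (Finset.subset_univ _) fun j _ hj => ?_
    have : v j = 0 := by simpa [supp] using hj
    rw [this, mul_zero]
  rw [h0]
  refine (Finset.sum_mul_sq_le_sq_mul_sq _ _ _).trans (mul_le_mul ?_ ?_ ?_ ?_)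
  · refine (Finset.sum_le_card_nsmul _ _ (maxNorm D ^ 2) fun j _ => ?_).trans
      (le_of_eq (by rw [nsmul_eq_mul, mul_comm]))
    rw [← sq_abs]
    exact pow_le_pow_left₀ (abs_nonneg _) (abs_le_maxNorm D i j) 2
  · simp only [dotProduct, ← sq]
    exact Finset.sum_le_sum_of_subset_of_nonneg (Finset.subset_univ _) fun j _ _ => sq_nonneg _
  · exact Finset.sum_nonneg fun j _ => sq_nonneg _
  · positivity

/-! ### The best parameter of a model -/

instance : IsProbabilityMeasure (law G D) :=
  inferInstanceAs (IsProbabilityMeasure (Measure.pi fun i => G.respLaw ((D.X *ᵥ D.θ₀) i)))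

lemma law_eq : law G D = Measure.pi fun i => G.respLaw ((D.X *ᵥ D.θ₀) i) := rfl

lemma integrable_resp (i : Fin n) : Integrable (fun Y : Fin n → ℝ => Y i) (law G D) :=
  (measurePreserving_eval (fun i => G.respLaw ((D.X *ᵥ D.θ₀) i)) i).integrable_comp_of_integrable
    (G.integrable_id_respLaw _)

lemma integral_resp (i : Fin n) : ∫ Y, Y i ∂(law G D) = G.b' ((D.X *ᵥ D.θ₀) i) := by
  have h := measurePreserving_eval (fun i => G.respLaw ((D.X *ᵥ D.θ₀) i)) i
  rw [← G.integral_id_respLaw, ← h.map_eq]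
  exact (integral_map h.measurable.aemeasurable aestronglyMeasurable_id).symm

lemma logLik_eq (S : Finset (Fin p)) (θ : S → ℝ) (Y : Fin n → ℝ) :
    logLik G D S θ Y = ∑ i, G.k (Y i) - loss G (D.XS S) Y θ := by
  rw [logLik, loss, ← Finset.sum_sub_distrib]
  refine Finset.sum_congr rfl fun i _ => ?_
  rw [Family.density, Real.log_exp]; ring

lemma isMLE_iff (S : Finset (Fin p)) (Y : Fin n → ℝ) (θ : S → ℝ) :
    IsMLE G D S Y θ ↔ ∀ x, loss G (D.XS S) Y θ ≤ loss G (D.XS S) Y x := by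
  simp only [IsMLE, logLik_eq, sub_le_sub_iff_left]

/-- The expected response. -/
def meanResp : Fin n → ℝ := fun i => G.b' ((D.X *ᵥ D.θ₀) i)

lemma isBest_iff (S : Finset (Fin p)) (θ : S → ℝ) :
    IsBest G D S θ ↔
      ∀ x, loss G (D.XS S) (meanResp G D) θ ≤ loss G (D.XS S) (meanResp G D) x := by
  have key : ∀ x : S → ℝ, ∫ Y, (logLik G D S x Y - logLik G D S θ Y) ∂(law G D)
      = loss G (D.XS S) (meanResp G D) θ - loss G (D.XS S) (meanResp G D) x := fun x => by
    have h1 : ∀ Y, logLik G D S x Y - logLik G D S θ Y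
        = ∑ i, (Y i * ((D.XS S *ᵥ x) i - (D.XS S *ᵥ θ) i)
          + (G.b ((D.XS S *ᵥ θ) i) - G.b ((D.XS S *ᵥ x) i))) := fun Y => by
      rw [logLik_eq, logLik_eq, sub_sub_sub_cancel_left, loss, loss, ← Finset.sum_sub_distrib]
      exact Finset.sum_congr rfl fun i _ => by ring
    have hint : ∀ i, Integrable (fun Y : Fin n → ℝ =>
        Y i * ((D.XS S *ᵥ x) i - (D.XS S *ᵥ θ) i)) (law G D) :=
      fun i => (integrable_resp G D i).mul_const _
    simp_rw [h1]
    rw [integral_finsetSum Finset.univ (f := fun i (Y : Fin n → ℝ) =>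
        Y i * ((D.XS S *ᵥ x) i - (D.XS S *ᵥ θ) i)
          + (G.b ((D.XS S *ᵥ θ) i) - G.b ((D.XS S *ᵥ x) i)))
        fun i _ => (hint i).add (integrable_const _), loss, loss, ← Finset.sum_sub_distrib]
    refine Finset.sum_congr rfl fun i _ => ?_
    rw [integral_add (hint i) (integrable_const _), integral_mul_const, integral_resp,
      integral_const, probReal_univ, meanResp, smul_eq_mul, one_mul]
    ring
  simp only [IsBest, key, sub_nonpos]

variable {G D} {C₃ Kdim Kth : ℝ}

/-- The constant in the sample size condition: it makes the linear predictors of the best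
parameters so close to the true ones that the weights `b''` agree up to a factor `2`. -/
def sampleConst (C₃ Kdim Kth : ℝ) : ℝ := 100 * (Kdim + 1) * Kth * (1 + C₃ ^ 2)

/-- A sparse vector of squared information norm of order `s₀ log p` has uniformly small linear
predictors, by the sample size condition. -/
lemma abs_mulVec_le_of_trueQuad_le (hK : 1 < Kdim) (hKt : 0 < Kth) (hp : 1 < p)
    (hs : 0 < D.s₀) (hφ : 0 < phi2 D ((Kdim + 1) * D.s₀) (W₀ G D))
    (hn : sampleConst C₃ Kdim Kth * (maxNorm D ^ 2 / phi2 D ((Kdim + 1) * D.s₀) (W₀ G D) ^ 2)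
      * (D.s₀ : ℝ) ^ 2 * Real.log p ≤ n)
    {v : Fin p → ℝ} (hv : ((supp v).card : ℝ) ≤ (Kdim + 1) * D.s₀)
    (hq : trueQuad G D (D.X *ᵥ v) ≤ 25 * (Kth * D.s₀ * Real.log p)) (i : Fin n) :
    C₃ * |(D.X *ᵥ v) i| ≤ 1 / 2 := by
  set φ := phi2 D ((Kdim + 1) * D.s₀) (W₀ G D)
  have hn0 : (0 : ℝ) < n := by exact_mod_cast n_pos_of_phi2_pos G D hφ
  have hs0 : (0 : ℝ) < D.s₀ := by exact_mod_cast hs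
  have hl : 0 < Real.log p := Real.log_pos (by exact_mod_cast hp)
  have h1 := mulVec_sq_le D v i
  have h2 := phi2_sq_mul_le G D hφ hv
  have hvv : v ⬝ᵥ v ≤ 25 * (Kth * D.s₀ * Real.log p) / (n * φ ^ 2) := by
    rw [le_div_iff₀ (by positivity), mul_comm]
    exact h2.trans hq
  have h3 : (D.X *ᵥ v) i ^ 2 ≤ maxNorm D ^ 2 * ((Kdim + 1) * D.s₀)
      * (25 * (Kth * D.s₀ * Real.log p) / (n * φ ^ 2)) := by
    refine h1.trans ?_
    have := dotProduct_self_nonneg' v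
    gcongr
  have h4 : 4 * (1 + C₃ ^ 2) * (maxNorm D ^ 2 * ((Kdim + 1) * D.s₀)
      * (25 * (Kth * D.s₀ * Real.log p) / (n * φ ^ 2))) ≤ 1 := by
    have e : 4 * (1 + C₃ ^ 2) * (maxNorm D ^ 2 * ((Kdim + 1) * D.s₀)
      * (25 * (Kth * D.s₀ * Real.log p) / (n * φ ^ 2)))
      = (sampleConst C₃ Kdim Kth * (maxNorm D ^ 2 / φ ^ 2)
      * (D.s₀ : ℝ) ^ 2 * Real.log p) / n := by
      unfold sampleConst; field_simp; ring
    rw [e, div_le_one hn0]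
    exact hn
  have h5 : (C₃ * |(D.X *ᵥ v) i|) ^ 2 ≤ (1 / 2) ^ 2 := by
    rw [mul_pow, sq_abs]
    nlinarith [sq_nonneg ((D.X *ᵥ v) i), sq_nonneg C₃]
  exact le_of_sq_le_sq h5 (by norm_num)

lemma loss_meanResp (S : Finset (Fin p)) (θ : S → ℝ) : loss G (D.XS S) (meanResp G D) θ
    = ∑ i, G.breg ((D.X *ᵥ D.θ₀) i) ((D.X *ᵥ (extend S θ - D.θ₀)) i)
      + ∑ i, (G.b ((D.X *ᵥ D.θ₀) i) - meanResp G D i * (D.X *ᵥ D.θ₀) i) := by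
  rw [loss, ← Finset.sum_add_distrib]
  refine Finset.sum_congr rfl fun i _ => ?_
  rw [Family.breg, mulVec_sub, ← XS_mulVec, Pi.sub_apply, add_sub_cancel, meanResp]
  ring

/-- In a model that contains a good approximation of the true coefficient the best parameter exists
and its linear predictors are close to the true ones: otherwise, by convexity, the expected loss on
an ellipsoid around the approximation would be smaller than at its centre. -/
lemma best_spec (hpos : ∀ x, 0 < G.b'' x) (hsc : G.SelfConcordant C₃)
    (hK : 1 < Kdim) (hKt : 0 < Kth) (hp : 1 < p)
    (hs : 0 < D.s₀) (hφ : 0 < phi2 D ((Kdim + 1) * D.s₀) (W₀ G D))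
    (hn : sampleConst C₃ Kdim Kth * (maxNorm D ^ 2 / phi2 D ((Kdim + 1) * D.s₀) (W₀ G D) ^ 2)
      * (D.s₀ : ℝ) ^ 2 * Real.log p ≤ n)
    {S : Finset (Fin p)} (hS : ((S ∪ D.S₀).card : ℝ) ≤ (Kdim + 1) * D.s₀)
    (hθ : ∃ θ : S → ℝ,
      (extend S θ - D.θ₀) ⬝ᵥ (fisherFull G D *ᵥ (extend S θ - D.θ₀)) ≤ Kth * D.s₀ * Real.log p) :
    IsBest G D S (best G D S) ∧
      ∀ i, C₃ * |(D.XS S *ᵥ best G D S) i - (D.X *ᵥ D.θ₀) i| ≤ 1 / 2 := by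
  have hs0 : (0 : ℝ) < D.s₀ := by exact_mod_cast hs
  have hl : 0 < Real.log p := Real.log_pos (by exact_mod_cast hp)
  obtain ⟨θ, hθ⟩ := hθ
  rw [fisherFull_quad] at hθ
  set f := loss G (D.XS S) (meanResp G D) with hf
  set ρ := √(Kth * D.s₀ * Real.log p) with hρ
  have hρ0 : 0 < ρ := Real.sqrt_pos.2 (by positivity)
  have hρ2 : ρ ^ 2 = Kth * D.s₀ * Real.log p := Real.sq_sqrt (by positivity)
  rw [← hρ2] at hθ
  have hsup : ∀ x : S → ℝ, ((supp (extend S x - D.θ₀)).card : ℝ) ≤ (Kdim + 1) * D.s₀ := fun x =>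
    le_trans (by exact_mod_cast Finset.card_le_card (supp_extend_sub_subset S x D.θ₀)) hS
  have hsmall : ∀ x : S → ℝ, trueQuad G D (D.X *ᵥ (extend S x - D.θ₀)) ≤ (5 * ρ) ^ 2 → ∀ i,
      C₃ * |(D.X *ᵥ (extend S x - D.θ₀)) i| ≤ 1 / 2 := fun x hx =>
    abs_mulVec_le_of_trueQuad_le hK hKt hp hs hφ hn (hsup x) (by rw [← hρ2]; linarith)
  have hadd : ∀ x i, (D.X *ᵥ (extend S x - D.θ₀)) i
      = (D.X *ᵥ (extend S θ - D.θ₀)) i + (D.XS S *ᵥ (x - θ)) i := fun x i => by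
    rw [mulVec_sub, mulVec_sub, mulVec_sub, ← XS_mulVec, ← XS_mulVec]
    simp
  have hw : ∀ i, 0 ≤ G.b'' ((D.X *ᵥ D.θ₀) i) := fun i => G.b''_nonneg _
  have hS' : (S.card : ℝ) ≤ (Kdim + 1) * D.s₀ := by
    refine le_trans ?_ hS
    exact_mod_cast Finset.card_le_card Finset.subset_union_left
  have hF := posDef_gram (A := D.XS S) (w := fun i => G.b'' ((D.X *ᵥ D.θ₀) i)) (fun i => hpos _)
    (XS_injective G D hφ hS')
  -- on the ellipsoid of radius `4 ρ` around the approximation the squared distance from the truth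
  -- is at least `8 ρ²` and at most `25 ρ²`, against `ρ²` at the centre
  have hbd : ∀ h : S → ℝ, h ⬝ᵥ (((D.XS S)ᵀ * diagonal (fun i => G.b'' ((D.X *ᵥ D.θ₀) i)) *
      D.XS S) *ᵥ h) = (4 * ρ) ^ 2 → f θ < f (θ + h) := fun h hh => by
    rw [dotProduct_gram_mulVec_self] at hh
    obtain ⟨h1, h2⟩ := sum_weighted_add_sq (d := fun i => (D.X *ᵥ (extend S θ - D.θ₀)) i) hw
      hθ hh.le
    have e : ∀ i, (D.X *ᵥ (extend S θ - D.θ₀)) i + (D.XS S *ᵥ h) i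
        = (D.X *ᵥ (extend S (θ + h) - D.θ₀)) i := fun i => by rw [hadd (θ + h), add_sub_cancel_left]
    simp only [e] at h1 h2
    rw [hf, loss_meanResp, loss_meanResp, add_lt_add_iff_right]
    have hu : ∑ i, G.breg ((D.X *ᵥ D.θ₀) i) ((D.X *ᵥ (extend S θ - D.θ₀)) i) ≤ ρ ^ 2 :=
      (Finset.sum_le_sum fun i _ => hsc.breg_le_of_le hpos
        (hsmall θ (hθ.trans (by nlinarith)) i)).trans hθ
    have hlow : (∑ i, G.b'' ((D.X *ᵥ D.θ₀) i) * (D.X *ᵥ (extend S (θ + h) - D.θ₀)) i ^ 2) / 4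
        ≤ ∑ i, G.breg ((D.X *ᵥ D.θ₀) i) ((D.X *ᵥ (extend S (θ + h) - D.θ₀)) i) := by
      rw [Finset.sum_div]
      exact Finset.sum_le_sum fun i _ => hsc.le_breg_of_le hpos (hsmall (θ + h) h1 i)
    nlinarith
  have hex : ∃ x, IsBest G D S x := by
    obtain ⟨x, hx⟩ := exists_min_of_convex hF (convexOn_loss G _ _) (continuous_loss G _ _)
      (by positivity) hbd
    exact ⟨x, (isBest_iff G D S x).2 hx⟩
  have hbest : IsBest G D S (best G D S) := by
    rw [best, dif_pos hex]; exact hex.choose_spec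
  refine ⟨hbest, fun i => ?_⟩
  have hq := quad_le_of_convex (convexOn_loss G (D.XS S) (meanResp G D)) (by positivity) hbd
    ((isBest_iff G D S _).1 hbest θ)
  rw [dotProduct_gram_mulVec_self] at hq
  obtain ⟨h1, -⟩ := sum_weighted_add_sq (d := fun i => (D.X *ᵥ (extend S θ - D.θ₀)) i) hw
    hθ hq
  simp only [← hadd] at h1
  have := hsmall _ h1 i
  rwa [mulVec_sub, ← XS_mulVec] at this

end Fixed

section Fixed

variable {n p : ℕ} (G : Family) (D : Problem n p)

/-! ### Concentration of the score -/

/-- The score of the full model at the true coefficient in the direction with linear predictor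
`a`. -/
def noise (a Y : Fin n → ℝ) : ℝ := ∑ i, a i * (Y i - meanResp G D i)

lemma measurable_noise (a : Fin n → ℝ) : Measurable (noise G D a) := by
  unfold noise; fun_prop

/-- The factor `1` is the argument of the moment generating function in Chernoff's bound. -/
lemma exp_noise (a Y : Fin n → ℝ) : Real.exp (1 * noise G D a Y)
    = ∏ i, (fun i y => Real.exp (a i * y) * Real.exp (-(a i * meanResp G D i))) i (Y i) := by
  rw [one_mul, noise, Real.exp_sum]
  refine Finset.prod_congr rfl fun i _ => ?_
  simp only
  rw [← Real.exp_add]; ring_nf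

lemma integrable_exp_noise (a : Fin n → ℝ) :
    Integrable (fun Y => Real.exp (1 * noise G D a Y)) (law G D) := by
  simp_rw [exp_noise]
  exact Integrable.fintype_prod_dep fun i => (G.integrable_exp _ _).mul_const _

lemma integral_exp_noise (a : Fin n → ℝ) :
    ∫ Y, Real.exp (1 * noise G D a Y) ∂(law G D)
      = Real.exp (∑ i, G.breg ((D.X *ᵥ D.θ₀) i) (a i)) := by
  simp_rw [exp_noise]
  rw [law_eq, integral_fintype_prod_eq_prod (f := fun i y =>
    Real.exp (a i * y) * Real.exp (-(a i * meanResp G D i))), Real.exp_sum]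
  refine Finset.prod_congr rfl fun i _ => ?_
  rw [integral_mul_const, G.integral_exp, ← Real.exp_add, Family.breg, meanResp]
  ring_nf

/-- Chernoff's bound. -/
lemma measure_noise_ge_le (a : Fin n → ℝ) (R : ℝ) : law G D {Y | R ≤ noise G D a Y}
    ≤ ENNReal.ofReal (Real.exp (-R + ∑ i, G.breg ((D.X *ᵥ D.θ₀) i) (a i))) := by
  have h := ProbabilityTheory.measure_ge_le_exp_mul_mgf (μ := law G D) (X := noise G D a) R
    zero_le_one (integrable_exp_noise G D a)
  rw [ProbabilityTheory.mgf, integral_exp_noise, ← Real.exp_add, neg_one_mul] at h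
  rw [← ENNReal.ofReal_toReal (measure_ne_top (law G D) _)]
  exact ENNReal.ofReal_le_ofReal h

variable {G D} {Cdev : ℝ}

lemma measure_scaled_noise_ge_le (hd : G.Doubling Cdev) (hC : 0 ≤ Cdev) {a : Fin n → ℝ} {t : ℝ}
    (ht : 0 ≤ t) (ha : ∀ i, t * |a i| ≤ 1 / 2) (hq : trueQuad G D a ≤ 4) :
    law G D {Y | (5 + 2 * Cdev) * t ≤ noise G D a Y}
      ≤ ENNReal.ofReal (Real.exp (-(5 * t ^ 2))) := by
  have hsub : {Y | (5 + 2 * Cdev) * t ≤ noise G D a Y}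
      ⊆ {Y | (5 + 2 * Cdev) * t ^ 2 ≤ noise G D (t • a) Y} := fun Y hY => by
    have : noise G D (t • a) Y = t * noise G D a Y := by
      simp only [noise, Finset.mul_sum, Pi.smul_apply, smul_eq_mul, mul_assoc]
    have hY' : (5 + 2 * Cdev) * t ≤ noise G D a Y := hY
    change (5 + 2 * Cdev) * t ^ 2 ≤ noise G D (t • a) Y
    rw [this]
    nlinarith
  refine (measure_mono hsub).trans ((measure_noise_ge_le G D _ _).trans ?_)
  refine ENNReal.ofReal_le_ofReal (Real.exp_le_exp.2 ?_)
  have h1 : ∑ i, G.breg ((D.X *ᵥ D.θ₀) i) ((t • a) i)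
      ≤ Cdev * t ^ 2 / 2 * trueQuad G D a := by
    rw [trueQuad, Finset.mul_sum]
    refine Finset.sum_le_sum fun i _ => ?_
    have h2 : |(t • a) i| ≤ 1 / 2 := by
      rw [Pi.smul_apply, smul_eq_mul, abs_mul, abs_of_nonneg ht]; exact ha i
    refine (hd.breg_le h2).trans (le_of_eq ?_)
    rw [Pi.smul_apply, smul_eq_mul]; ring
  have h3 : Cdev * t ^ 2 / 2 * trueQuad G D a ≤ Cdev * t ^ 2 / 2 * 4 :=
    mul_le_mul_of_nonneg_left hq (by positivity)
  linarith

lemma sum_nonempty_pow_le (hp : 2 ≤ p) :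
    ∑ S : Finset (Fin p) with S.Nonempty, (((p : ℝ) ^ 3)⁻¹) ^ S.card ≤ (p : ℝ)⁻¹ := by
  have hp' : (2 : ℝ) ≤ p := by exact_mod_cast hp
  have h1 := Fintype.sum_pow_mul_eq_add_pow (Fin p) (((p : ℝ) ^ 3)⁻¹) 1
  simp only [one_pow, mul_one, Fintype.card_fin] at h1
  have h2 : ∑ S : Finset (Fin p), (((p : ℝ) ^ 3)⁻¹) ^ S.card
      = ∑ S : Finset (Fin p) with S.Nonempty, (((p : ℝ) ^ 3)⁻¹) ^ S.card + 1 := by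
    rw [← Finset.sum_filter_add_sum_filter_not Finset.univ (fun S : Finset (Fin p) => S.Nonempty)]
    congr 1
    have : (Finset.univ.filter fun S : Finset (Fin p) => ¬ S.Nonempty) = {∅} := by
      ext S; simp
    rw [this]; simp
  have h3 : (((p : ℝ) ^ 3)⁻¹ + 1) ^ p ≤ Real.exp (((p : ℝ) ^ 2)⁻¹) := by
    have e : ((p : ℝ) ^ 2)⁻¹ = p * ((p : ℝ) ^ 3)⁻¹ := by field_simp
    rw [e, Real.exp_nat_mul]
    exact pow_le_pow_left₀ (by positivity) (Real.add_one_le_exp _) p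
  have h4 : ((p : ℝ) ^ 2)⁻¹ ≤ 1 := inv_le_one_of_one_le₀ (by nlinarith)
  have h5 := Family.exp_sub_one_le (by positivity) h4
  have h6 : 2 * ((p : ℝ) ^ 2)⁻¹ ≤ (p : ℝ)⁻¹ := by
    rw [← div_eq_mul_inv, ← one_div, div_le_div_iff₀ (by positivity) (by positivity)]
    nlinarith
  linarith

/-- Simultaneous concentration of the score in many models. Directions are parametrized by matrices
`Q S` which bound the linear predictors on balls. The union bound runs over the models and over the
grid points in the ball of each of them: there are at most `p ^ (2 |S|)` of these, and each
exceptional event has probability at most `p ^ (-5 |S|)`. -/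
lemma exists_noise_event (hd : G.Doubling Cdev) (hC : 0 ≤ Cdev) (hp : 16 ≤ p)
    (T : Set (Finset (Fin p))) (hT : ∀ S ∈ T, S.Nonempty)
    (Q : ∀ S : Finset (Fin p), Matrix S S ℝ)
    (hQ : ∀ S ∈ T, ∀ w : S → ℝ, w ⬝ᵥ w ≤ 2 →
      (∀ i, √(S.card * Real.log p) * |(D.XS S *ᵥ (Q S *ᵥ w)) i| ≤ 1 / 2) ∧
        trueQuad G D (D.XS S *ᵥ (Q S *ᵥ w)) ≤ 4) :
    ∃ E : Set (Fin n → ℝ), MeasurableSet E ∧ ENNReal.ofReal (1 - (p : ℝ)⁻¹) ≤ law G D E ∧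
      ∀ Y ∈ E, ∀ S ∈ T, ∀ w : S → ℝ, noise G D (D.XS S *ᵥ (Q S *ᵥ w)) Y ^ 2
        ≤ (2 * ((5 + 2 * Cdev) * √(S.card * Real.log p))) ^ 2 * (w ⬝ᵥ w) := by
  classical
  have hp' : (16 : ℝ) ≤ p := by exact_mod_cast hp
  have hl : 0 ≤ Real.log p := Real.log_nonneg (by linarith)
  set t : Finset (Fin p) → ℝ := fun S => √(S.card * Real.log p) with ht
  let bad : (S : Finset (Fin p)) → (S → Fin (2 * p + 1)) → Set (Fin n → ℝ) := fun S k =>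
    if S ∈ T ∧ gridPoint p k ⬝ᵥ gridPoint p k ≤ 2 then
      {Y | (5 + 2 * Cdev) * t S ≤ noise G D (D.XS S *ᵥ (Q S *ᵥ gridPoint p k)) Y}
    else ∅
  have hbadm : ∀ S k, MeasurableSet (bad S k) := fun S k => by
    simp only [bad]
    split_ifs
    · exact measurableSet_le measurable_const (measurable_noise _ _ _)
    · exact MeasurableSet.empty
  have hcard : ∀ S : Finset (Fin p), S.Nonempty →
      ∑ k : S → Fin (2 * p + 1), law G D (bad S k)
        ≤ ENNReal.ofReal ((((p : ℝ) ^ 3)⁻¹) ^ S.card) := fun S hS => by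
    have h1 : ∀ k, law G D (bad S k) ≤ ENNReal.ofReal (((p : ℝ) ^ (5 * S.card))⁻¹) := fun k => by
      simp only [bad]
      split_ifs with hk
      · obtain ⟨ha, hq⟩ := hQ S hk.1 _ hk.2
        refine (measure_scaled_noise_ge_le hd hC (Real.sqrt_nonneg _) ha hq).trans
          (ENNReal.ofReal_le_ofReal (le_of_eq ?_))
        rw [Real.sq_sqrt (by positivity), Real.exp_neg]
        congr 1
        rw [← mul_assoc, show (5 : ℝ) * S.card = ((5 * S.card : ℕ) : ℝ) by push_cast; ring,
          Real.exp_nat_mul, Real.exp_log (by linarith)]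
      · simp
    refine (Finset.sum_le_card_nsmul _ _ _ fun k _ => h1 k).trans ?_
    rw [Finset.card_univ, Fintype.card_fun, Fintype.card_fin, Fintype.card_coe, nsmul_eq_mul,
      ← ENNReal.ofReal_natCast, ← ENNReal.ofReal_mul (by positivity)]
    refine ENNReal.ofReal_le_ofReal ?_
    push_cast
    have h2 : (2 * (p : ℝ) + 1) ≤ (p : ℝ) ^ 2 := by nlinarith
    have h3 : ((p : ℝ) ^ (5 * S.card))⁻¹ = (((p : ℝ) ^ 5)⁻¹) ^ S.card := by
      rw [pow_mul, inv_pow]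
    rw [h3, ← mul_pow]
    refine pow_le_pow_left₀ (by positivity) ?_ _
    calc (2 * (p : ℝ) + 1) * ((p : ℝ) ^ 5)⁻¹ ≤ (p : ℝ) ^ 2 * ((p : ℝ) ^ 5)⁻¹ := by gcongr
      _ = ((p : ℝ) ^ 3)⁻¹ := by field_simp
  set B : Set (Fin n → ℝ) := ⋃ S ∈ (Finset.univ.filter fun S : Finset (Fin p) => S.Nonempty),
    ⋃ k, bad S k with hB
  have hBm : MeasurableSet B :=
    Finset.measurableSet_biUnion _ fun S _ => MeasurableSet.iUnion fun k => hbadm S k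
  have hBle : law G D B ≤ ENNReal.ofReal ((p : ℝ)⁻¹) := by
    refine (measure_biUnion_finset_le _ _).trans ?_
    refine (Finset.sum_le_sum fun S hS => (measure_iUnion_fintype_le _ _).trans
      (hcard S (Finset.mem_filter.1 hS).2)).trans ?_
    rw [← ENNReal.ofReal_sum_of_nonneg fun S _ => by positivity]
    exact ENNReal.ofReal_le_ofReal (sum_nonempty_pow_le (by omega))
  refine ⟨Bᶜ, hBm.compl, ?_, fun Y hY S hS w => ?_⟩
  · rw [prob_compl_eq_one_sub hBm, ENNReal.ofReal_sub _ (by positivity), ENNReal.ofReal_one]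
    exact tsub_le_tsub_left hBle 1
  · -- the noise is the linear form with coefficient vector `v`
    set v : S → ℝ := (Q S)ᵀ *ᵥ ((D.XS S)ᵀ *ᵥ (Y - meanResp G D)) with hv
    have hvw : ∀ w : S → ℝ, noise G D (D.XS S *ᵥ (Q S *ᵥ w)) Y = v ⬝ᵥ w := fun w => by
      have : noise G D (D.XS S *ᵥ (Q S *ᵥ w)) Y
          = (Y - meanResp G D) ⬝ᵥ (D.XS S *ᵥ (Q S *ᵥ w)) := by
        simp only [noise, dotProduct, Pi.sub_apply]
        exact Finset.sum_congr rfl fun i _ => mul_comm _ _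
      rw [this, hv, mulVec_transpose, mulVec_transpose, ← dotProduct_mulVec, ← dotProduct_mulVec]
    have hvv : v ⬝ᵥ v ≤ (2 * ((5 + 2 * Cdev) * t S)) ^ 2 := by
      refine dotProduct_self_le_of_grid hp
        (by rw [Fintype.card_coe]; simpa using Finset.card_le_univ S) fun k hk => ?_
      rw [← hvw]
      by_contra! hlt
      refine hY ?_
      simp only [hB, Set.mem_iUnion, Finset.mem_filter, Finset.mem_univ, true_and, exists_prop]
      refine ⟨S, hT S hS, k, ?_⟩
      simp only [bad]
      rw [if_pos ⟨hS, hk⟩]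
      exact hlt.le
    rw [hvw]
    exact (dotProduct_sq_le v w).trans
      (mul_le_mul_of_nonneg_right hvv (dotProduct_self_nonneg' w))

/-! ### The design regularity -/

variable (G D)

lemma zeta_nonneg (S : Finset (Fin p)) : 0 ≤ zeta G D S :=
  Real.iSup_nonneg fun _ => Real.sqrt_nonneg _

lemma mulVec_sq_le_zeta {S : Finset (Fin p)} (hF : (fisher G D S (best G D S)).PosDef)
    (h : S → ℝ) (i : Fin n) :
    (D.XS S *ᵥ h) i ^ 2 ≤ zeta G D S ^ 2 * (h ⬝ᵥ (fisher G D S (best G D S) *ᵥ h)) := by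
  refine (PosDef.dotProduct_sq_le hF (D.XS S i) h).trans
    (mul_le_mul_of_nonneg_right ?_ (hF.quad_nonneg h))
  rw [← Real.sqrt_le_left (zeta_nonneg G D S)]
  exact le_ciSup (f := fun i => √((D.XS S i) ⬝ᵥ ((fisher G D S (best G D S))⁻¹ *ᵥ (D.XS S i))))
    (Set.finite_range _).bddAbove i

end Fixed

/-! ### Laplace approximation with a normal weight -/

section Laplace

variable {ι : Type*} [Fintype ι] [DecidableEq ι] {F : Matrix ι ι ℝ}

lemma integrable_normalPdf (hF : F.PosDef) {l : ℝ} (hl : 0 < l) (μ : ι → ℝ) :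
    Integrable (normalPdf μ (l • F)⁻¹) ∧ ∫ x, normalPdf μ (l • F)⁻¹ x = 1 := by
  have h := integral_exp_mul_normalPdf hF hl le_rfl μ
  simp only [zero_div, neg_zero, zero_mul, Real.exp_zero, one_mul, add_zero, div_self hl.ne',
    Real.one_rpow] at h
  exact h

lemma rpow_ratio_le {l α δ s : ℝ} (hl : 0 < l) (hα : 0 < α) (hδ0 : 0 ≤ δ) (hδ : δ ≤ 1 / 2)
    (hs : 0 ≤ s) (hsδ : s * δ ≤ 1) :
    (1 + α / l) ^ (s / 2) * (l / (l + α * (1 - δ))) ^ (s / 2) ≤ 1 + 2 * (s * δ) := by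
  have h1 : 0 < l + α * (1 - δ) := by nlinarith
  rw [← Real.mul_rpow (by positivity) (by positivity)]
  have h2 : (1 + α / l) * (l / (l + α * (1 - δ))) ≤ Real.exp (2 * δ) := by
    have e : (1 + α / l) * (l / (l + α * (1 - δ))) = (l + α) / (l + α * (1 - δ)) := by field_simp
    rw [e, div_le_iff₀ h1]
    have h3 := Real.add_one_le_exp (2 * δ)
    have h4 : l + α ≤ (2 * δ + 1) * (l + α * (1 - δ)) := by
      nlinarith [mul_nonneg hδ0 hl.le, mul_nonneg (mul_nonneg hδ0 hα.le) (by linarith : 0 ≤ 1 - 2 * δ)]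
    exact h4.trans (mul_le_mul_of_nonneg_right h3 h1.le)
  refine (Real.rpow_le_rpow (by positivity) h2 (by positivity)).trans ?_
  rw [← Real.exp_mul, show 2 * δ * (s / 2) = s * δ by ring]
  linarith [Family.exp_sub_one_le (mul_nonneg hs hδ0) hsδ]

lemma le_rpow_ratio {l α δ s : ℝ} (hl : 0 < l) (hα : 0 < α) (hδ0 : 0 ≤ δ) (hs : 0 ≤ s) :
    1 - s * δ ≤ (1 + α / l) ^ (s / 2) * (l / (l + α * (1 + δ))) ^ (s / 2) := by
  have h1 : 0 < l + α * (1 + δ) := by positivity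
  rw [← Real.mul_rpow (by positivity) (by positivity)]
  have h2 : Real.exp (-δ) ≤ (1 + α / l) * (l / (l + α * (1 + δ))) := by
    have e : (1 + α / l) * (l / (l + α * (1 + δ))) = (l + α) / (l + α * (1 + δ)) := by field_simp
    rw [e, le_div_iff₀ h1, Real.exp_neg, inv_mul_le_iff₀ (Real.exp_pos _)]
    have h3 := Real.add_one_le_exp δ
    have h4 : l + α * (1 + δ) ≤ (δ + 1) * (l + α) := by nlinarith
    exact h4.trans (mul_le_mul_of_nonneg_right h3 (by positivity))
  refine le_trans ?_ (Real.rpow_le_rpow (Real.exp_pos _).le h2 (by positivity))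
  rw [← Real.exp_mul]
  have := Real.add_one_le_exp (-δ * (s / 2))
  nlinarith [mul_nonneg hs hδ0]

/-- Laplace approximation. If `g` is close to half the quadratic form of `F` on an ellipsoid and is
bounded below outside of it, then replacing `g` by the quadratic form changes the exponential
integral against the normal density with precision `l F` only by a small relative error. Outside the
ellipsoid the normal density is only used through its total mass. -/
lemma abs_one_sub_laplace_le (hF : F.PosDef) {l α δ r ε : ℝ} (hl : 0 < l) (hα : 0 < α)
    (hδ0 : 0 ≤ δ) (hδ : δ ≤ 1 / 2) (hsδ : Fintype.card ι * δ ≤ 1)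
    {g : (ι → ℝ) → ℝ} (hg : Continuous g) (hg0 : ∀ h, 0 ≤ g h)
    (hin : ∀ h, h ⬝ᵥ (F *ᵥ h) ≤ r ^ 2 →
      |g h - h ⬝ᵥ (F *ᵥ h) / 2| ≤ δ / 2 * (h ⬝ᵥ (F *ᵥ h)))
    (hout : ∀ h, r ^ 2 < h ⬝ᵥ (F *ᵥ h) → r ^ 2 / 4 ≤ g h)
    (hε : (1 + α / l) ^ ((Fintype.card ι : ℝ) / 2) * Real.exp (-(α * r ^ 2 / 4)) ≤ ε)
    (μ : ι → ℝ) :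
    |1 - (1 + α / l) ^ ((Fintype.card ι : ℝ) / 2) *
      ∫ x, Real.exp (-(α * g (x - μ))) * normalPdf μ (l • F)⁻¹ x|
      ≤ 2 * (Fintype.card ι * δ) + ε := by
  set s : ℝ := (Fintype.card ι : ℝ)
  have hs0 : 0 ≤ s := Nat.cast_nonneg _
  obtain ⟨hN, hN1⟩ := integrable_normalPdf hF hl μ
  have hNn := normalPdf_nonneg μ (l • F)⁻¹
  have hJ : Integrable (fun x => Real.exp (-(α * g (x - μ))) * normalPdf μ (l • F)⁻¹ x) := by
    refine hN.mono' ?_ (ae_of_all _ fun x => ?_)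
    · have := continuous_normalPdf μ (l • F)⁻¹
      exact Continuous.aestronglyMeasurable (by fun_prop)
    · rw [Real.norm_eq_abs, abs_of_nonneg (mul_nonneg (Real.exp_pos _).le (hNn x))]
      refine mul_le_of_le_one_left (hNn x) (Real.exp_le_one_iff.2 ?_)
      have := mul_nonneg hα.le (hg0 (x - μ))
      linarith
  obtain ⟨hu, hu1⟩ := integral_exp_mul_normalPdf hF hl (c := α * (1 - δ)) (by nlinarith) μ
  obtain ⟨hw, hw1⟩ := integral_exp_mul_normalPdf hF hl (c := α * (1 + δ)) (by positivity) μ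
  set e := Real.exp (-(α * r ^ 2 / 4)) with he
  have heN : ∫ x, e * normalPdf μ (l • F)⁻¹ x = e := by rw [integral_const_mul, hN1, mul_one]
  have hup : ∫ x, Real.exp (-(α * g (x - μ))) * normalPdf μ (l • F)⁻¹ x
      ≤ (l / (l + α * (1 - δ))) ^ (s / 2) + e := by
    rw [← hu1, ← heN, ← integral_add hu (hN.const_mul e)]
    refine integral_mono hJ (hu.add (hN.const_mul e)) fun x => ?_
    simp only
    rw [← add_mul]
    refine mul_le_mul_of_nonneg_right ?_ (hNn x)
    rcases le_or_gt ((x - μ) ⬝ᵥ (F *ᵥ (x - μ))) (r ^ 2) with hx | hx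
    · have h1 := (abs_le.1 (hin _ hx)).1
      refine le_add_of_le_of_nonneg (Real.exp_le_exp.2 ?_) (Real.exp_pos _).le
      nlinarith
    · have h1 := hout _ hx
      refine le_add_of_nonneg_of_le (Real.exp_pos _).le (Real.exp_le_exp.2 ?_)
      nlinarith
  have hlo : (l / (l + α * (1 + δ))) ^ (s / 2) - e
      ≤ ∫ x, Real.exp (-(α * g (x - μ))) * normalPdf μ (l • F)⁻¹ x := by
    rw [← hw1, ← heN, ← integral_sub hw (hN.const_mul e)]
    refine integral_mono (hw.sub (hN.const_mul e)) hJ fun x => ?_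
    simp only
    rw [← sub_mul]
    refine mul_le_mul_of_nonneg_right ?_ (hNn x)
    rw [sub_le_iff_le_add]
    rcases le_or_gt ((x - μ) ⬝ᵥ (F *ᵥ (x - μ))) (r ^ 2) with hx | hx
    · have h1 := (abs_le.1 (hin _ hx)).2
      refine le_add_of_le_of_nonneg (Real.exp_le_exp.2 ?_) (Real.exp_pos _).le
      nlinarith
    · refine le_add_of_nonneg_of_le (Real.exp_pos _).le (Real.exp_le_exp.2 ?_)
      nlinarith [mul_nonneg hα.le hδ0, mul_nonneg hα.le (sq_nonneg r),
        mul_le_mul_of_nonneg_left hx.le hα.le,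
        mul_nonneg (mul_nonneg hα.le hδ0) (hF.quad_nonneg (x - μ))]
  have hc0 : 0 ≤ (1 + α / l) ^ (s / 2) := by positivity
  have h1 := rpow_ratio_le hl hα hδ0 hδ hs0 hsδ
  have h2 := le_rpow_ratio hl hα hδ0 hs0
  have h3 := mul_le_mul_of_nonneg_left hup hc0
  have h4 := mul_le_mul_of_nonneg_left hlo hc0
  rw [mul_add] at h3
  rw [mul_sub] at h4
  have h5 := mul_nonneg hs0 hδ0
  rw [abs_le]
  constructor <;> linarith

end Laplace

section Fixed

variable {n p : ℕ} {G : Family} {D : Problem n p} {Cdev C₃ : ℝ}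

/-! ### The maximum likelihood estimate of a model -/

lemma loss_best_add {S : Finset (Fin p)} (hb : IsBest G D S (best G D S)) (Y : Fin n → ℝ)
    (h : S → ℝ) : loss G (D.XS S) Y (best G D S + h) = loss G (D.XS S) Y (best G D S)
      + ∑ i, G.breg ((D.XS S *ᵥ best G D S) i) ((D.XS S *ᵥ h) i) - noise G D (D.XS S *ᵥ h) Y := by
  have h0 := score_eq_zero ((isBest_iff G D S _).1 hb) h
  have h1 : ∑ i, (G.b' ((D.XS S *ᵥ best G D S) i) - Y i) * (D.XS S *ᵥ h) i
      = ∑ i, (G.b' ((D.XS S *ᵥ best G D S) i) - meanResp G D i) * (D.XS S *ᵥ h) i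
        - noise G D (D.XS S *ᵥ h) Y := by
    rw [noise, ← Finset.sum_sub_distrib]
    exact Finset.sum_congr rfl fun i _ => by ring
  rw [loss_add, h1, h0]
  ring

/-- When the score is small compared with the curvature, the maximum likelihood estimate exists, is
unique, and is close to the best parameter. -/
lemma mle_spec (hd : G.Doubling Cdev) (hC : 1 ≤ Cdev) {S : Finset (Fin p)}
    (hA : ∀ x, D.XS S *ᵥ x = 0 → x = 0) (hb : IsBest G D S (best G D S)) {Y : Fin n → ℝ}
    {N : ℝ} (hN0 : 0 < N) (hN : ∀ h : S → ℝ, noise G D (D.XS S *ᵥ h) Y ^ 2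
      ≤ N ^ 2 * (h ⬝ᵥ (fisher G D S (best G D S) *ᵥ h)))
    (hζ : zeta G D S * (3 * Cdev * N) ≤ 1 / 2) :
    (∃! θ, IsMLE G D S Y θ) ∧ IsMLE G D S Y (mle G D S Y) ∧
      (mle G D S Y - best G D S) ⬝ᵥ (fisher G D S (best G D S) *ᵥ (mle G D S Y - best G D S))
        ≤ (3 * Cdev * N) ^ 2 := by
  have hC0 : 0 < Cdev := by linarith
  have hF : (fisher G D S (best G D S)).PosDef := posDef_gram (fun i => hd.b''_pos _) hA
  set r := 3 * Cdev * N with hr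
  have hr0 : 0 < r := by positivity
  have hbd : ∀ h, h ⬝ᵥ (fisher G D S (best G D S) *ᵥ h) = r ^ 2 →
      loss G (D.XS S) Y (best G D S) < loss G (D.XS S) Y (best G D S + h) := fun h hh => by
    have h1 : ∀ i, |(D.XS S *ᵥ h) i| ≤ 1 / 2 := fun i => by
      have := mulVec_sq_le_zeta G D hF h i
      rw [hh, ← mul_pow] at this
      exact (abs_le_of_sq_le_sq this (mul_nonneg (zeta_nonneg G D S) hr0.le)).trans hζ
    have h2 : r ^ 2 / Cdev / 2
        ≤ ∑ i, G.breg ((D.XS S *ᵥ best G D S) i) ((D.XS S *ᵥ h) i) := by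
      rw [← hh, fisher_quad, Finset.sum_div, Finset.sum_div]
      refine Finset.sum_le_sum fun i _ => ?_
      refine le_trans (le_of_eq ?_) (hd.le_breg hC (h1 i))
      ring
    have h3 : noise G D (D.XS S *ᵥ h) Y ≤ N * r := by
      have := hN h
      rw [hh, ← mul_pow] at this
      exact (le_abs_self _).trans (abs_le_of_sq_le_sq this (by positivity))
    rw [loss_best_add hb]
    -- the radius is chosen so that the curvature exceeds the contribution `N r` of the score
    have h4 : r ^ 2 / Cdev / 2 = 3 / 2 * (N * r) := by rw [hr]; field_simp
    have h5 : 0 < N * r := by positivity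
    linarith
  obtain ⟨x, hx⟩ := exists_min_of_convex hF (convexOn_loss G (D.XS S) Y)
    (continuous_loss G (D.XS S) Y) hr0 hbd
  have hex : ∃ θ, IsMLE G D S Y θ := ⟨x, (isMLE_iff G D S Y x).2 hx⟩
  have hmle : IsMLE G D S Y (mle G D S Y) := by
    rw [mle, dif_pos hex]; exact hex.choose_spec
  refine ⟨⟨_, hmle, fun θ hθ => loss_min_unique hA ((isMLE_iff G D S Y _).1 hmle)
    ((isMLE_iff G D S Y θ).1 hθ)⟩, hmle, ?_⟩
  exact quad_le_of_convex (convexOn_loss G (D.XS S) Y) hr0 hbd ((isMLE_iff G D S Y _).1 hmle _)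

/-! ### The marginal likelihood of a model -/

/-- The drop of the log-likelihood from its maximum. -/
def drop (G : Family) (D : Problem n p) (S : Finset (Fin p)) (Y : Fin n → ℝ) (h : S → ℝ) : ℝ :=
  ∑ i, G.breg ((D.XS S *ᵥ mle G D S Y) i) ((D.XS S *ᵥ h) i)

lemma continuous_drop (S : Finset (Fin p)) (Y : Fin n → ℝ) : Continuous (drop G D S Y) := by
  have := G.continuous_b
  unfold drop Family.breg
  fun_prop

lemma logLik_eq_sub_drop {S : Finset (Fin p)} {Y : Fin n → ℝ} (hm : IsMLE G D S Y (mle G D S Y))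
    (θ : S → ℝ) :
    logLik G D S θ Y = logLik G D S (mle G D S Y) Y - drop G D S Y (θ - mle G D S Y) := by
  have h := loss_add_of_min ((isMLE_iff G D S Y _).1 hm) (θ - mle G D S Y)
  rw [add_sub_cancel] at h
  rw [logLik_eq, logLik_eq, h, drop]
  ring

lemma marginal_div_laplace {S : Finset (Fin p)} {Y : Fin n → ℝ}
    (hm : IsMLE G D S Y (mle G D S Y)) {α : ℝ} (hα : 0 < α) (hl : 0 < D.lam) :
    marginal G D α S Y / laplace G D α S Y
      = (1 + α / D.lam) ^ ((S.card : ℝ) / 2) * ∫ θ : S → ℝ,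
        Real.exp (-(α * drop G D S Y (θ - mle G D S Y))) * slab G D S Y θ := by
  have h1 : ∀ θ : S → ℝ, Real.exp (α * logLik G D S θ Y) * slab G D S Y θ
      = Real.exp (α * logLik G D S (mle G D S Y) Y) *
        (Real.exp (-(α * drop G D S Y (θ - mle G D S Y))) * slab G D S Y θ) := fun θ => by
    rw [← mul_assoc, ← Real.exp_add, logLik_eq_sub_drop hm θ]
    ring_nf
  have hpos : 0 < 1 + α / D.lam := by positivity
  rw [marginal, laplace]
  simp_rw [h1]
  rw [integral_const_mul, mul_div_mul_left _ _ (Real.exp_pos _).ne', neg_div,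
    Real.rpow_neg hpos.le, div_inv_eq_mul, mul_comm]

/-- Outside an ellipsoid on whose boundary the drop is at least `c`, it is at least `c`. -/
lemma le_drop_of_boundary {S : Finset (Fin p)} {Y : Fin n → ℝ}
    (hm : IsMLE G D S Y (mle G D S Y)) {F : Matrix S S ℝ} {r c : ℝ} (hr : 0 < r)
    (hb : ∀ h, h ⬝ᵥ (F *ᵥ h) = r ^ 2 → c ≤ drop G D S Y h) {h : S → ℝ}
    (hh : r ^ 2 < h ⬝ᵥ (F *ᵥ h)) : c ≤ drop G D S Y h := by
  obtain ⟨t, ht0, ht1, ht⟩ := exists_boundary_point hr hh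
  have hmin := (isMLE_iff G D S Y _).1 hm
  have h1 := (convexOn_loss G (D.XS S) Y).2 (Set.mem_univ (mle G D S Y))
    (Set.mem_univ (mle G D S Y + h)) (sub_nonneg.2 ht1.le) ht0.le (by ring)
  have h2 : (1 - t) • mle G D S Y + t • (mle G D S Y + h) = mle G D S Y + t • h := by
    rw [sub_smul, one_smul, smul_add]; abel
  rw [h2, loss_add_of_min hmin, loss_add_of_min hmin, smul_eq_mul, smul_eq_mul] at h1
  have h3 := hb _ ht
  have h4 : 0 ≤ drop G D S Y h := Finset.sum_nonneg fun i _ => G.breg_nonneg _ _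
  unfold drop at *
  nlinarith

end Fixed

/-! ### The Laplace approximation of one model -/

section Constants

/-- The constant in the bound of the score by a multiple of `√(|S| log p)`. -/
def scoreConst (Cdev : ℝ) : ℝ := 2 * (5 + 2 * Cdev)

/-- The constant in the distance of the maximum likelihood estimate from the best parameter. -/
def mleConst (Cdev : ℝ) : ℝ := 3 * Cdev * scoreConst Cdev

/-- The localization radius of the Laplace approximation is this multiple of `√(|S| log p)`. Outside
the drop of the likelihood outweighs the normalizing factor `(1 + α / λ)^(|S| / 2)`. -/
def tailConst (α A₅ : ℝ) : ℝ := √(2 * (A₅ + 3) / α)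

/-- The smallest admissible value of the constant `M`. -/
def radiusConst (Cdev C₃ α A₅ : ℝ) : ℝ :=
  4 + mleConst Cdev * (1 + |C₃|) + 6 * |C₃| * tailConst α A₅

end Constants

section Fixed

variable {n p : ℕ} {G : Family} {D : Problem n p} {Cdev C₃ : ℝ}

lemma radius_eq {M : ℝ} (hM : 0 ≤ M) (s : ℕ) : radius p M s = M * √(s * Real.log p) := by
  rw [radius, mul_assoc, Real.sqrt_mul (sq_nonneg M), Real.sqrt_sq hM]

lemma sigmaMaxSq_nonneg : 0 ≤ sigmaMaxSq G D := Real.iSup_nonneg fun _ => G.b''_nonneg _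

lemma b''_le_sigmaMaxSq (i : Fin n) : G.b'' ((D.X *ᵥ D.θ₀) i) ≤ sigmaMaxSq G D :=
  le_ciSup (f := fun i => G.b'' ((D.X *ᵥ D.θ₀) i)) (Set.finite_range _).bddAbove i

lemma delta_nonneg {Kdim Kcub M : ℝ} (hK : 0 ≤ Kcub) (S : Finset (Fin p)) :
    0 ≤ delta G D Kdim Kcub M S := by
  refine le_min ?_ ?_
  · exact mul_nonneg (mul_nonneg zero_le_two (Real.sqrt_nonneg _)) (zeta_nonneg G D S)
  · have h1 : 0 ≤ phi2 D ((Kdim + 1) * D.s₀) (W₀ G D) := Real.sqrt_nonneg _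
    have h2 : 0 ≤ sigmaMaxSq G D := sigmaMaxSq_nonneg
    have h3 : 0 ≤ radius p M S.card := Real.sqrt_nonneg _
    positivity

lemma sum_abs_cube_le {S : Finset (Fin p)} {K : ℝ} (hn : 0 < n)
    (hK : ∀ u : S → ℝ, u ⬝ᵥ u = 1 → (n : ℝ)⁻¹ * ∑ i, |(D.XS S *ᵥ u) i| ^ 3 ≤ K) (h : S → ℝ) :
    ∑ i, |(D.XS S *ᵥ h) i| ^ 3 ≤ n * K * √(h ⬝ᵥ h) ^ 3 := by
  have hn' : (0 : ℝ) < n := by exact_mod_cast hn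
  rcases (dotProduct_self_nonneg' h).eq_or_lt with h0 | hpos
  · have : h = 0 := dotProduct_self_eq_zero.1 h0.symm
    subst this
    simp
  · set N := √(h ⬝ᵥ h)
    have hN : 0 < N := Real.sqrt_pos.2 hpos
    have hN2 : N ^ 2 = h ⬝ᵥ h := Real.sq_sqrt hpos.le
    have h1 := hK (N⁻¹ • h) (by
      rw [smul_dotProduct, dotProduct_smul, ← hN2, smul_eq_mul, smul_eq_mul]; field_simp)
    rw [inv_mul_le_iff₀ hn'] at h1
    have h2 : ∑ i, |(D.XS S *ᵥ (N⁻¹ • h)) i| ^ 3 = (N ^ 3)⁻¹ * ∑ i, |(D.XS S *ᵥ h) i| ^ 3 := by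
      rw [Finset.mul_sum]
      refine Finset.sum_congr rfl fun i _ => ?_
      rw [mulVec_smul, Pi.smul_apply, smul_eq_mul, abs_mul, mul_pow, abs_of_pos (inv_pos.2 hN),
        inv_pow]
    rw [h2, inv_mul_le_iff₀ (by positivity)] at h1
    linarith

/-- The normalizing factor times the decay outside of the localization radius. -/
lemma tail_le {α A₅ l : ℝ} {s : ℕ} (hα : 0 < α) (hα1 : α ≤ 1) (hA : 0 < A₅) (hp : 16 ≤ p)
    (hs : 1 ≤ s) (hl : (p : ℝ) ^ (-A₅) ≤ l) :
    (1 + α / l) ^ ((s : ℝ) / 2)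
      * Real.exp (-(α * (tailConst α A₅ * √(s * Real.log p)) ^ 2 / 4)) ≤ 1 / p := by
  have hp' : (16 : ℝ) ≤ p := by exact_mod_cast hp
  have hp0 : (0 : ℝ) < p := by linarith
  have hs' : (1 : ℝ) ≤ s := by exact_mod_cast hs
  have hlog : 0 < Real.log p := Real.log_pos (by linarith)
  have hl0 : 0 < l := lt_of_lt_of_le (by positivity) hl
  have hq : 1 ≤ (p : ℝ) ^ A₅ := Real.one_le_rpow (by linarith) hA.le
  have h1 : α / l ≤ (p : ℝ) ^ A₅ := by
    rw [div_le_iff₀ hl0]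
    have := mul_le_mul_of_nonneg_left hl (by positivity : 0 ≤ (p : ℝ) ^ A₅)
    rw [← Real.rpow_add hp0, add_neg_cancel, Real.rpow_zero] at this
    linarith
  have h2 : 1 + α / l ≤ Real.exp ((A₅ + 1) * Real.log p) := by
    rw [mul_comm, ← Real.rpow_def_of_pos hp0, Real.rpow_add hp0, Real.rpow_one]
    nlinarith
  have h3 : (1 + α / l) ^ ((s : ℝ) / 2) ≤ Real.exp ((A₅ + 1) * Real.log p * (s / 2)) := by
    rw [Real.exp_mul]
    exact Real.rpow_le_rpow (by positivity) h2 (by positivity)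
  have h4 : α * (tailConst α A₅ * √(s * Real.log p)) ^ 2 / 4
      = (A₅ + 3) / 2 * (s * Real.log p) := by
    rw [mul_pow, tailConst, Real.sq_sqrt (by positivity), Real.sq_sqrt (by positivity)]
    field_simp
    ring
  rw [h4]
  calc _ ≤ Real.exp ((A₅ + 1) * Real.log p * (s / 2))
        * Real.exp (-((A₅ + 3) / 2 * (s * Real.log p))) := by gcongr
    _ = Real.exp (-(s * Real.log p)) := by rw [← Real.exp_add]; ring_nf
    _ ≤ Real.exp (-Real.log p) := Real.exp_le_exp.2 (by nlinarith)
    _ = 1 / p := by rw [Real.exp_neg, Real.exp_log hp0, one_div]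

/-- The cubic remainder of the log-likelihood, relative to the information at the estimate. The two
bounds correspond to the two terms in the minimum that defines `delta`. -/
lemma abs_drop_sub_le (hpos : ∀ x, 0 < G.b'' x) (hsc : G.SelfConcordant C₃)
    {Kdim Kcub M : ℝ} (hKc : 0 < Kcub) (hφ : 0 < phi2 D ((Kdim + 1) * D.s₀) (W₀ G D))
    {S : Finset (Fin p)} (hS : (S.card : ℝ) ≤ (Kdim + 1) * D.s₀)
    (hcub : ∀ u : S → ℝ, u ⬝ᵥ u = 1 → (n : ℝ)⁻¹ * ∑ i, |(D.XS S *ᵥ u) i| ^ 3 ≤ Kcub)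
    (hF : (fisher G D S (best G D S)).PosDef) {Y : Fin n → ℝ}
    (h01 : ∀ i, G.b'' ((D.X *ᵥ D.θ₀) i) ≤ 2 * G.b'' ((D.XS S *ᵥ best G D S) i))
    (h10 : ∀ i, G.b'' ((D.XS S *ᵥ best G D S) i) ≤ 2 * G.b'' ((D.X *ᵥ D.θ₀) i))
    (h12 : ∀ i, G.b'' ((D.XS S *ᵥ best G D S) i) ≤ 2 * G.b'' ((D.XS S *ᵥ mle G D S Y) i))
    (h21 : ∀ i, G.b'' ((D.XS S *ᵥ mle G D S Y) i) ≤ 2 * G.b'' ((D.XS S *ᵥ best G D S) i))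
    {K : ℝ} (hK : 0 ≤ K) (hM0 : 0 ≤ M) (hM : 6 * C₃ * K ≤ M)
    (hζ : radius p M S.card * zeta G D S ≤ 1 / 5) {h : S → ℝ}
    (hh : h ⬝ᵥ (fisher G D S (mle G D S Y) *ᵥ h) ≤ (K * √(S.card * Real.log p)) ^ 2) :
    |drop G D S Y h - h ⬝ᵥ (fisher G D S (mle G D S Y) *ᵥ h) / 2|
      ≤ delta G D Kdim Kcub M S / 2 * (h ⬝ᵥ (fisher G D S (mle G D S Y) *ᵥ h)) := by
  have hC := hsc.nonneg hpos
  have hn := n_pos_of_phi2_pos G D hφ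
  have hn' : (0 : ℝ) < n := by exact_mod_cast hn
  set φ := phi2 D ((Kdim + 1) * D.s₀) (W₀ G D)
  set t := √(S.card * Real.log p)
  have ht0 : 0 ≤ t := Real.sqrt_nonneg _
  have hζ0 := zeta_nonneg G D S
  rw [radius_eq hM0] at hζ
  set q := h ⬝ᵥ (fisher G D S (mle G D S Y) *ᵥ h) with hq
  set a : Fin n → ℝ := D.XS S *ᵥ h with ha
  have hqs : q = ∑ i, G.b'' ((D.XS S *ᵥ mle G D S Y) i) * a i ^ 2 := fisher_quad G D S _ h
  have hq0 : 0 ≤ q := by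
    rw [hqs]; exact Finset.sum_nonneg fun i _ => mul_nonneg (hpos _).le (sq_nonneg _)
  have hsqrt2 : √2 ^ 2 = 2 := Real.sq_sqrt (by norm_num)
  have hsqrt2l : 1.4 ≤ √2 := Real.le_sqrt_of_sq_le (by norm_num)
  have hsqrt2u : √2 ≤ 1.5 := Real.sqrt_le_left (by norm_num) |>.2 (by norm_num)
  have hqb : h ⬝ᵥ (fisher G D S (best G D S) *ᵥ h) ≤ 2 * q := by
    rw [fisher_quad, hqs, Finset.mul_sum]
    refine Finset.sum_le_sum fun i _ => ?_
    nlinarith [mul_le_mul_of_nonneg_right (h12 i) (sq_nonneg (a i))]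
  have hai : ∀ i, |a i| ≤ zeta G D S * (√2 * (K * t)) := fun i => by
    refine abs_le_of_sq_le_sq ?_ (by positivity)
    refine (mulVec_sq_le_zeta G D hF h i).trans ?_
    rw [mul_pow, mul_pow, hsqrt2]
    exact mul_le_mul_of_nonneg_left (hqb.trans (by linarith)) (sq_nonneg _)
  have hCai : ∀ i, C₃ * |a i| ≤ M * t * zeta G D S / 2 := fun i => by
    have h1 := mul_le_mul_of_nonneg_left (hai i) hC
    have h2 : C₃ * (zeta G D S * (√2 * (K * t))) = (C₃ * K * √2) * (t * zeta G D S) := by ring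
    have h3 : C₃ * K * √2 ≤ M / 2 := by
      have := mul_le_mul_of_nonneg_left hsqrt2u (mul_nonneg hC hK)
      nlinarith [mul_nonneg hC hK]
    have h4 := mul_le_mul_of_nonneg_right h3 (mul_nonneg ht0 hζ0)
    nlinarith
  -- the sum of the third order remainders
  have hrem : |drop G D S Y h - q / 2|
      ≤ ∑ i, C₃ * G.b'' ((D.XS S *ᵥ mle G D S Y) i) * |a i| ^ 3 := by
    rw [hqs, Finset.sum_div, drop, ← Finset.sum_sub_distrib]
    refine (Finset.abs_sum_le_sum_abs _ _).trans (Finset.sum_le_sum fun i _ => ?_)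
    exact hsc.abs_breg_sub_le hpos ((hCai i).trans (by linarith))
  refine hrem.trans ?_
  rw [delta, radius_eq hM0]
  have hmin : ∀ {x y z : ℝ}, z ≤ x / 2 * q → z ≤ y / 2 * q → z ≤ min x y / 2 * q := by
    intro x y z hx hy
    rcases min_choice x y with h | h <;> rw [h] <;> assumption
  refine hmin ?_ ?_
  · rw [hqs, Finset.mul_sum]
    refine Finset.sum_le_sum fun i _ => ?_
    have h1 : |a i| ^ 3 = |a i| * a i ^ 2 := by rw [pow_succ, sq_abs, mul_comm]
    have h2 : 0 ≤ G.b'' ((D.XS S *ᵥ mle G D S Y) i) * a i ^ 2 :=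
      mul_nonneg (hpos _).le (sq_nonneg _)
    have h3 := mul_le_mul_of_nonneg_right (hCai i) h2
    have h4 : 0 ≤ M * t * zeta G D S * (G.b'' ((D.XS S *ᵥ mle G D S Y) i) * a i ^ 2) := by
      positivity
    rw [h1]
    nlinarith
  · have hσ : 0 ≤ sigmaMaxSq G D := sigmaMaxSq_nonneg
    have h1 : ∑ i, C₃ * G.b'' ((D.XS S *ᵥ mle G D S Y) i) * |a i| ^ 3
        ≤ 4 * C₃ * sigmaMaxSq G D * ∑ i, |a i| ^ 3 := by
      rw [Finset.mul_sum]
      refine Finset.sum_le_sum fun i _ => mul_le_mul_of_nonneg_right ?_ (by positivity)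
      have h2 := h21 i
      have h3 := h10 i
      have h4 := b''_le_sigmaMaxSq (G := G) (D := D) i
      have h5 := mul_le_mul_of_nonneg_left (by linarith :
        G.b'' ((D.XS S *ᵥ mle G D S Y) i) ≤ 4 * sigmaMaxSq G D) hC
      linarith
    have h2 := sum_abs_cube_le hn hcub h
    -- the Euclidean norm of `h` is bounded by the sparse singular value
    have h3 : √(h ⬝ᵥ h) ≤ 2 * √q / (√n * φ) := by
      have h4 := phi2_sq_mul_le_restrict G D hφ hS h
      have h5 : trueQuad G D a ≤ 4 * q := by
        rw [hqs, Finset.mul_sum]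
        refine Finset.sum_le_sum fun i _ => ?_
        have := mul_le_mul_of_nonneg_right ((h01 i).trans (mul_le_mul_of_nonneg_left (h12 i)
          zero_le_two)) (sq_nonneg (a i))
        linarith
      rw [le_div_iff₀ (by positivity)]
      refine le_of_sq_le_sq ?_ (by positivity)
      rw [mul_pow, mul_pow, mul_pow, Real.sq_sqrt (dotProduct_self_nonneg' h),
        Real.sq_sqrt hn'.le, Real.sq_sqrt hq0]
      change n * φ ^ 2 * (h ⬝ᵥ h) ≤ trueQuad G D a at h4
      linarith
    have hqt : √q ≤ K * t := by
      rw [Real.sqrt_le_left (by positivity)]; exact hh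
    have h4 : √(h ⬝ᵥ h) ^ 3 ≤ 8 * (q * (K * t)) / (n * √n * φ ^ 3) := by
      refine (pow_le_pow_left₀ (Real.sqrt_nonneg _) h3 3).trans ?_
      have e1 : (2 * √q / (√n * φ)) ^ 3 = 8 * (√q ^ 2 * √q) / (√n ^ 2 * √n * φ ^ 3) := by
        field_simp; ring
      rw [e1, Real.sq_sqrt hq0, Real.sq_sqrt hn'.le]
      gcongr
    calc _ ≤ 4 * C₃ * sigmaMaxSq G D * (n * Kcub * (8 * (q * (K * t)) / (n * √n * φ ^ 3))) := by
          refine h1.trans ?_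
          gcongr
          exact h2.trans (by gcongr)
      _ = (32 * (C₃ * K)) * (Kcub / φ ^ 3 * sigmaMaxSq G D * t / √n * q) := by
          field_simp; ring
      _ ≤ (4 * √2 * M) * (Kcub / φ ^ 3 * sigmaMaxSq G D * t / √n * q) := by
          refine mul_le_mul_of_nonneg_right ?_ (by positivity)
          nlinarith [mul_nonneg hC hK, mul_le_mul_of_nonneg_right hsqrt2l hM0]
      _ = _ := by ring

lemma radiusConst_bounds {α A₅ M : ℝ} (hC : 0 ≤ C₃) (hm : 0 ≤ mleConst Cdev)
    (hM : radiusConst Cdev C₃ α A₅ ≤ M) :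
    4 ≤ M ∧ mleConst Cdev ≤ M ∧ C₃ * mleConst Cdev ≤ M ∧ 6 * C₃ * tailConst α A₅ ≤ M := by
  rw [radiusConst, abs_of_nonneg hC, mul_add, mul_one] at hM
  have h1 := mul_nonneg hC hm
  have h2 : 0 ≤ 6 * C₃ * tailConst α A₅ := mul_nonneg (by positivity) (Real.sqrt_nonneg _)
  refine ⟨?_, ?_, ?_, ?_⟩ <;> linarith

/-- The linear predictors of the maximum likelihood estimate are close to those of the best
parameter. -/
lemma mle_sub_best_le {M t : ℝ} (hC : 0 ≤ C₃) (hm : 0 ≤ mleConst Cdev) (ht : 0 ≤ t)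
    (hM : C₃ * mleConst Cdev ≤ M) {S : Finset (Fin p)}
    (hF : (fisher G D S (best G D S)).PosDef) {Y : Fin n → ℝ}
    (hζ : M * t * zeta G D S ≤ 1 / 5)
    (hdist : (mle G D S Y - best G D S) ⬝ᵥ (fisher G D S (best G D S) *ᵥ
      (mle G D S Y - best G D S)) ≤ (mleConst Cdev * t) ^ 2) (i : Fin n) :
    C₃ * |(D.XS S *ᵥ mle G D S Y) i - (D.XS S *ᵥ best G D S) i| ≤ 1 / 2 := by
  have hζ0 := zeta_nonneg G D S
  have h1 := mulVec_sq_le_zeta G D hF (mle G D S Y - best G D S) i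
  have h2 : (D.XS S *ᵥ (mle G D S Y - best G D S)) i ^ 2
      ≤ (zeta G D S * (mleConst Cdev * t)) ^ 2 := by
    rw [mul_pow (zeta G D S)]
    exact h1.trans (mul_le_mul_of_nonneg_left hdist (sq_nonneg _))
  have h3 := abs_le_of_sq_le_sq h2 (by positivity)
  rw [mulVec_sub, Pi.sub_apply] at h3
  have h4 := mul_le_mul_of_nonneg_left h3 hC
  have h5 := mul_le_mul_of_nonneg_right hM (mul_nonneg ht hζ0)
  have h6 : C₃ * (zeta G D S * (mleConst Cdev * t))
      = C₃ * mleConst Cdev * (t * zeta G D S) := by ring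
  linarith

/-- The Laplace approximation of one model, given the bound of the score. -/
lemma laplace_accurate (hd : G.Doubling Cdev) (hCd : 1 ≤ Cdev) (hsc : G.SelfConcordant C₃)
    {α A₅ Kdim Kcub M : ℝ} (hα : 0 < α) (hα1 : α ≤ 1) (hA₅ : 0 < A₅) (hp : 16 ≤ p)
    (hl : (p : ℝ) ^ (-A₅) ≤ D.lam) (hKc : 0 < Kcub)
    (hφ : 0 < phi2 D ((Kdim + 1) * D.s₀) (W₀ G D))
    {S : Finset (Fin p)} (hS : (S.card : ℝ) ≤ (Kdim + 1) * D.s₀) (hne : S.Nonempty)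
    (hb : IsBest G D S (best G D S))
    (hclose : ∀ i, C₃ * |(D.XS S *ᵥ best G D S) i - (D.X *ᵥ D.θ₀) i| ≤ 1 / 2)
    (hcub : ∀ u : S → ℝ, u ⬝ᵥ u = 1 → (n : ℝ)⁻¹ * ∑ i, |(D.XS S *ᵥ u) i| ^ 3 ≤ Kcub)
    (hM : radiusConst Cdev C₃ α A₅ ≤ M)
    (hζ : radius p M S.card * zeta G D S ≤ 1 / 5)
    (hδ : S.card * delta G D Kdim Kcub M S ≤ 1 / 36) {Y : Fin n → ℝ}
    (hN : ∀ h : S → ℝ, noise G D (D.XS S *ᵥ h) Y ^ 2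
      ≤ (scoreConst Cdev * √(S.card * Real.log p)) ^ 2
        * (h ⬝ᵥ (fisher G D S (best G D S) *ᵥ h))) :
    (∃! θ, IsMLE G D S Y θ) ∧
      |1 - marginal G D α S Y / laplace G D α S Y| ≤ tau G D Kdim Kcub M S := by
  have hpos : ∀ x, 0 < G.b'' x := hd.b''_pos
  have hC := hsc.nonneg hpos
  have hp' : (16 : ℝ) ≤ p := by exact_mod_cast hp
  have hp0 : (0 : ℝ) < p := by linarith
  have hl0 : 0 < D.lam := lt_of_lt_of_le (by positivity) hl
  have hs1 : (1 : ℝ) ≤ S.card := by exact_mod_cast hne.card_pos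
  have hlog : 0 < Real.log p := Real.log_pos (by linarith)
  obtain ⟨t, ht⟩ : ∃ t, t = √(S.card * Real.log p) := ⟨_, rfl⟩
  have ht0 : 0 < t := by rw [ht]; exact Real.sqrt_pos.2 (by positivity)
  have hζ0 := zeta_nonneg G D S
  have hsc0 : 0 < scoreConst Cdev := by unfold scoreConst; linarith
  have hmle0 : 0 < mleConst Cdev := by unfold mleConst; positivity
  have htail0 : 0 < tailConst α A₅ := Real.sqrt_pos.2 (by positivity)
  obtain ⟨hM4, hM1, hM2, hM3⟩ := radiusConst_bounds hC hmle0.le hM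
  have hM0 : 0 ≤ M := by linarith
  have hζ' := hζ
  rw [radius_eq hM0, ← ht] at hζ'
  rw [← ht] at hN
  have hA := XS_injective G D hφ hS
  have hF : (fisher G D S (best G D S)).PosDef := posDef_gram (fun i => hpos _) hA
  have hFm : (fisher G D S (mle G D S Y)).PosDef := posDef_gram (fun i => hpos _) hA
  have e2 : 3 * Cdev * (scoreConst Cdev * t) = mleConst Cdev * t := by rw [mleConst]; ring
  have hK2 : zeta G D S * (3 * Cdev * (scoreConst Cdev * t)) ≤ 1 / 2 := by
    have := mul_le_mul_of_nonneg_right hM1 (mul_nonneg ht0.le hζ0)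
    rw [e2]
    linarith
  obtain ⟨hex, hmle, hdist⟩ := mle_spec hd hCd hA hb (mul_pos hsc0 ht0) hN hK2
  rw [e2] at hdist
  refine ⟨hex, ?_⟩
  have hmb := mle_sub_best_le hC hmle0.le ht0.le hM2 hF hζ' hdist
  have h21 : ∀ i, G.b'' ((D.XS S *ᵥ mle G D S Y) i) ≤ 2 * G.b'' ((D.XS S *ᵥ best G D S) i) :=
    fun i => hsc.b''_le_two_mul hpos (hmb i)
  have h12 : ∀ i, G.b'' ((D.XS S *ᵥ best G D S) i) ≤ 2 * G.b'' ((D.XS S *ᵥ mle G D S Y) i) :=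
    fun i => hsc.b''_le_two_mul hpos (by rw [abs_sub_comm]; exact hmb i)
  have h10 : ∀ i, G.b'' ((D.XS S *ᵥ best G D S) i) ≤ 2 * G.b'' ((D.X *ᵥ D.θ₀) i) :=
    fun i => hsc.b''_le_two_mul hpos (hclose i)
  have h01 : ∀ i, G.b'' ((D.X *ᵥ D.θ₀) i) ≤ 2 * G.b'' ((D.XS S *ᵥ best G D S) i) :=
    fun i => hsc.b''_le_two_mul hpos (by rw [abs_sub_comm]; exact hclose i)
  have hδ0 : 0 ≤ delta G D Kdim Kcub M S := delta_nonneg hKc.le S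
  have hδ1 : delta G D Kdim Kcub M S ≤ 1 / 36 := by nlinarith
  obtain ⟨r, hr⟩ : ∃ r, r = tailConst α A₅ * √(S.card * Real.log p) := ⟨_, rfl⟩
  have hr0 : 0 < r := by rw [hr, ← ht]; exact mul_pos htail0 ht0
  have hin : ∀ h : S → ℝ, h ⬝ᵥ (fisher G D S (mle G D S Y) *ᵥ h) ≤ r ^ 2 →
      |drop G D S Y h - h ⬝ᵥ (fisher G D S (mle G D S Y) *ᵥ h) / 2|
        ≤ delta G D Kdim Kcub M S / 2 * (h ⬝ᵥ (fisher G D S (mle G D S Y) *ᵥ h)) := fun h hh =>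
    abs_drop_sub_le hpos hsc hKc hφ hS hcub hF h01 h10 h12 h21 htail0.le hM0 hM3 hζ
      (by rw [← hr]; exact hh)
  have hout : ∀ h : S → ℝ, r ^ 2 < h ⬝ᵥ (fisher G D S (mle G D S Y) *ᵥ h) →
      r ^ 2 / 4 ≤ drop G D S Y h := fun h hh => by
    refine le_drop_of_boundary hmle hr0 (fun h' hh' => ?_) hh
    have h1 := (abs_le.1 (hin h' hh'.le)).1
    rw [hh'] at h1
    nlinarith [sq_nonneg r]
  have hcardS : Fintype.card S = S.card := Fintype.card_coe S
  have key := abs_one_sub_laplace_le (ε := 1 / (p : ℝ)) hFm hl0 hα hδ0 (by linarith)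
    (by rw [hcardS]; linarith) (continuous_drop S Y)
    (fun h => Finset.sum_nonneg fun i _ => G.breg_nonneg _ _) hin hout
    (by rw [hcardS, hr]; exact tail_le hα hα1 hA₅ hp hne.card_pos hl) (mle G D S Y)
  rw [marginal_div_laplace hmle hα hl0]
  simp only [hcardS] at key
  refine key.trans ?_
  rw [tau]
  have h1 : 1 / (p : ℝ) ≤ 2 / p := by gcongr; norm_num
  have h2 : 0 ≤ S.card * delta G D Kdim Kcub M S := by positivity
  linarith

end Fixed

section Fixed

variable {n p : ℕ} {G : Family} {D : Problem n p} {Cdev C₃ : ℝ}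

/-! ### Posterior ratios -/

lemma PriorCond.w_pos {A₁ A₂ A₃ A₄ : ℝ} (h : PriorCond D A₁ A₂ A₃ A₄) (hA₁ : 0 < A₁)
    (hp : 0 < p) : ∀ s, s ≤ D.smax → 0 < D.w s := by
  have hp' : (0 : ℝ) < p := by exact_mod_cast hp
  have h0 : 0 < D.w 0 := by
    refine lt_of_le_of_ne (h.nonneg 0) fun h0 => ?_
    have hz : ∀ s, s ≤ D.smax → D.w s = 0 := by
      intro s
      induction s with
      | zero => exact fun _ => h0.symm
      | succ k ih =>
        intro hk
        have := h.upper (k + 1) (by omega) hk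
        rw [Nat.add_sub_cancel, ih (by omega), mul_zero] at this
        exact le_antisymm this (h.nonneg _)
    have ht := h.total
    rw [Finset.sum_eq_zero fun s hs => hz s (by rw [Finset.mem_range] at hs; omega)] at ht
    exact zero_ne_one ht
  intro s
  induction s with
  | zero => exact fun _ => h0
  | succ k ih =>
    intro hk
    have h1 := h.lower (k + 1) (by omega) hk
    rw [Nat.add_sub_cancel] at h1
    have h2 := ih (by omega)
    exact lt_of_lt_of_le (by positivity) h1

lemma PriorCond.priorMass_nonneg {A₁ A₂ A₃ A₄ : ℝ} (h : PriorCond D A₁ A₂ A₃ A₄)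
    (S : Finset (Fin p)) : 0 ≤ priorMass D S :=
  div_nonneg (h.nonneg _) (Nat.cast_nonneg _)

lemma PriorCond.priorMass_S₀_pos {A₁ A₂ A₃ A₄ : ℝ} (h : PriorCond D A₁ A₂ A₃ A₄) (hA₁ : 0 < A₁)
    (hp : 0 < p) : 0 < priorMass D D.S₀ := by
  refine div_pos (h.w_pos hA₁ hp _ h.le_smax) ?_
  have : D.S₀.card ≤ p := by simpa using Finset.card_le_univ D.S₀
  exact_mod_cast Nat.choose_pos this

lemma marginal_nonneg (α : ℝ) (S : Finset (Fin p)) (Y : Fin n → ℝ) : 0 ≤ marginal G D α S Y :=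
  integral_nonneg fun _ => mul_nonneg (Real.exp_pos _).le (normalPdf_nonneg _ _ _)

lemma laplace_pos {α : ℝ} (hα : 0 < α) (hl : 0 < D.lam) (S : Finset (Fin p)) (Y : Fin n → ℝ) :
    0 < laplace G D α S Y := by
  unfold laplace; positivity

lemma marginal_bounds {α τ : ℝ} (hα : 0 < α) (hl : 0 < D.lam) {S : Finset (Fin p)}
    {Y : Fin n → ℝ} (h : |1 - marginal G D α S Y / laplace G D α S Y| ≤ τ) :
    (1 - τ) * laplace G D α S Y ≤ marginal G D α S Y ∧
      marginal G D α S Y ≤ (1 + τ) * laplace G D α S Y := by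
  have hp := laplace_pos (G := G) hα hl S Y
  obtain ⟨h1, h2⟩ := abs_le.1 h
  rw [← le_div_iff₀ hp, ← div_le_iff₀ hp]
  constructor <;> linarith

lemma postMass_ratio {A₁ A₂ A₃ A₄ α : ℝ} (h : PriorCond D A₁ A₂ A₃ A₄) (hA₁ : 0 < A₁)
    (hp : 0 < p) (S : Finset (Fin p)) {Y : Fin n → ℝ} (hm : 0 < marginal G D α D.S₀ Y) :
    postMass G D α S Y / postMass G D α D.S₀ Y
      = priorMass D S * marginal G D α S Y / (priorMass D D.S₀ * marginal G D α D.S₀ Y) := by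
  have h0 := h.priorMass_S₀_pos hA₁ hp
  have hsum : 0 < ∑ S' : Finset (Fin p), priorMass D S' * marginal G D α S' Y :=
    Finset.sum_pos' (fun S' _ => mul_nonneg (h.priorMass_nonneg S') (marginal_nonneg α S' Y))
      ⟨D.S₀, Finset.mem_univ _, mul_pos h0 hm⟩
  rw [postMass, postMass, div_div_div_cancel_right₀ hsum.ne']

/-- Accurate marginal likelihoods give accurate posterior ratios. -/
lemma postMass_ratio_le {A₁ A₂ A₃ A₄ α τ τ₀ : ℝ} (h : PriorCond D A₁ A₂ A₃ A₄) (hA₁ : 0 < A₁)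
    (hp : 0 < p) (hα : 0 < α) (hl : 0 < D.lam) {S : Finset (Fin p)} {Y : Fin n → ℝ}
    (hτ₀ : τ₀ < 1)
    (hS : |1 - marginal G D α S Y / laplace G D α S Y| ≤ τ)
    (hS₀ : |1 - marginal G D α D.S₀ Y / laplace G D α D.S₀ Y| ≤ τ₀) :
    postMass G D α S Y / postMass G D α D.S₀ Y ≤ (1 + τ) / (1 - τ₀) *
      (priorMass D S * laplace G D α S Y / (priorMass D D.S₀ * laplace G D α D.S₀ Y)) := by
  have hπ₀ := h.priorMass_S₀_pos hA₁ hp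
  have hπ := h.priorMass_nonneg S
  have hL₀ := laplace_pos (G := G) hα hl D.S₀ Y
  have hτ' : 0 < 1 - τ₀ := sub_pos.2 hτ₀
  obtain ⟨h1, -⟩ := marginal_bounds hα hl hS₀
  obtain ⟨-, h2⟩ := marginal_bounds hα hl hS
  have hm : 0 < marginal G D α D.S₀ Y := lt_of_lt_of_le (by positivity) h1
  rw [postMass_ratio h hA₁ hp S hm, div_mul_div_comm]
  have hnum : 0 ≤ priorMass D S * marginal G D α S Y := mul_nonneg hπ (marginal_nonneg α S Y)
  refine div_le_div₀ ?_ ?_ (by positivity) ?_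
  · exact le_trans hnum (by nlinarith)
  · nlinarith
  · nlinarith

/-! ### The result at a fixed sample size -/

lemma models_card {Kdim Kth : ℝ} {S : Finset (Fin p)} (hS : S ∈ models G D Kdim Kth) :
    ((S ∪ D.S₀).card : ℝ) ≤ (Kdim + 1) * D.s₀ := by
  have h1 : ((S ∪ D.S₀).card : ℝ) ≤ S.card + D.s₀ := by
    exact_mod_cast Finset.card_union_le S D.S₀
  have := hS.1
  linarith

lemma card_le_of_union {S T : Finset (Fin p)} {K : ℝ} (h : ((S ∪ T).card : ℝ) ≤ K) :
    (S.card : ℝ) ≤ K := by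
  refine le_trans ?_ h
  exact_mod_cast Finset.card_le_card Finset.subset_union_left

lemma extend_restrict_eq {S : Finset (Fin p)} {θ : Fin p → ℝ} (h : supp θ ⊆ S) :
    extend S (fun j : S => θ j) = θ := by
  ext j
  by_cases hj : j ∈ S
  · simp [extend, hj]
  · have : θ j = 0 := by
      by_contra hne
      exact hj (h (by simpa [supp] using hne))
    simp [extend, hj, this]

lemma exists_approx_of_S₀_subset {K : ℝ} (hK : 0 ≤ K) {S : Finset (Fin p)} (h : D.S₀ ⊆ S) :
    ∃ θ : S → ℝ,
      (extend S θ - D.θ₀) ⬝ᵥ (fisherFull G D *ᵥ (extend S θ - D.θ₀)) ≤ K :=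
  ⟨fun j => D.θ₀ j, by rw [extend_restrict_eq h, sub_self, zero_dotProduct]; exact hK⟩

lemma s₀_pos (h : D.θ₀ ≠ 0) : 0 < D.s₀ := by
  obtain ⟨j, hj⟩ := Function.ne_iff.1 h
  exact Finset.card_pos.2 ⟨j, by simpa [Problem.S₀, supp] using hj⟩

lemma S₀_mem_models {Kdim Kth : ℝ} (hK : 1 ≤ Kdim) (hKt : 0 ≤ Kth) (hp : 1 ≤ p) :
    D.S₀ ∈ models G D Kdim Kth := by
  have hl : 0 ≤ Real.log p := Real.log_nonneg (by exact_mod_cast hp)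
  refine ⟨?_, exists_approx_of_S₀_subset (by positivity) (Finset.Subset.refl _)⟩
  change (D.s₀ : ℝ) ≤ Kdim * D.s₀
  have : (0 : ℝ) ≤ D.s₀ := Nat.cast_nonneg _
  nlinarith

/-- The result at a fixed sample size: on the event of `exists_noise_event`, with whitened directions,
the Laplace approximation holds in all models of the class, `S₀` among them. -/
lemma laplaceAccurate_of (hd : G.Doubling Cdev) (hCd : 1 ≤ Cdev) (hsc : G.SelfConcordant C₃)
    {α A₁ A₂ A₃ A₄ A₅ Kdim Kth Kcub M : ℝ} (hα : 0 < α) (hα1 : α ≤ 1) (hA₁ : 0 < A₁)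
    (hA₅ : 0 < A₅) (hK : 1 < Kdim) (hKt : 0 < Kth) (hKc : 0 < Kcub) (hθ : D.θ₀ ≠ 0)
    (hprior : PriorCond D A₁ A₂ A₃ A₄) (hl : (p : ℝ) ^ (-A₅) ≤ D.lam)
    (hφ : 0 < phi2 D ((Kdim + 1) * D.s₀) (W₀ G D))
    (hn : sampleConst C₃ Kdim Kth * (maxNorm D ^ 2 / phi2 D ((Kdim + 1) * D.s₀) (W₀ G D) ^ 2)
      * (D.s₀ : ℝ) ^ 2 * Real.log p ≤ n)
    (hcub : CubicBound G D Kdim Kth Kcub)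
    (hζ : ∀ S ∈ modelsBar G D Kdim Kth, radius p M S.card * zeta G D S ≤ 1 / 5)
    (hδ : ∀ S ∈ models G D Kdim Kth, S.card * delta G D Kdim Kcub M S ≤ 1 / 36)
    (hM : radiusConst Cdev C₃ α A₅ ≤ M) (hp : 16 ≤ p) :
    LaplaceAccurate G D α Kdim Kth Kcub M := by
  have hpos : ∀ x, 0 < G.b'' x := hd.b''_pos
  have hC := hsc.nonneg hpos
  have hp' : (16 : ℝ) ≤ p := by exact_mod_cast hp
  have hl0 : 0 < D.lam := lt_of_lt_of_le (by positivity) hl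
  have hs0 := s₀_pos hθ
  have hmle0 : 0 ≤ mleConst Cdev := by unfold mleConst scoreConst; positivity
  obtain ⟨hM4, -⟩ := radiusConst_bounds hC hmle0 hM
  have hτ : ∀ S ∈ models G D Kdim Kth, tau G D Kdim Kcub M S ≤ 1 / 3 := fun S hS => by
    have h1 := hδ S hS
    have h2 : 2 / (p : ℝ) ≤ 1 / 8 := by
      rw [div_le_div_iff₀ (by linarith) (by norm_num)]; linarith
    rw [tau]
    linarith
  have hbest : ∀ S ∈ models G D Kdim Kth, _ := fun S hS =>
    best_spec hpos hsc hK hKt (by omega : 1 < p) hs0 hφ hn (models_card hS) hS.2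
  have hF : ∀ S ∈ models G D Kdim Kth, (fisher G D S (best G D S)).PosDef := fun S hS =>
    posDef_gram (fun i => hpos _) (XS_injective G D hφ (card_le_of_union (models_card hS)))
  have hQ : ∀ S : Finset (Fin p), ∃ Q : Matrix S S ℝ, S ∈ models G D Kdim Kth →
      (∀ w, (Q *ᵥ w) ⬝ᵥ (fisher G D S (best G D S) *ᵥ (Q *ᵥ w)) = w ⬝ᵥ w) ∧
        ∀ h, ∃ w, Q *ᵥ w = h := fun S => by
    by_cases hS : S ∈ models G D Kdim Kth
    · obtain ⟨Q, hQ⟩ := (hF S hS).exists_whitening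
      exact ⟨Q, fun _ => hQ⟩
    · exact ⟨0, fun h => absurd h hS⟩
  choose Q hQ using hQ
  obtain ⟨E, hEm, hEp, hE⟩ := exists_noise_event (D := D) hd (by linarith) hp
    {S | S ∈ models G D Kdim Kth ∧ S.Nonempty} (fun S hS => hS.2) Q fun S hS w hw => by
      have hq := (hQ S hS.1).1 w
      have hζS := hζ S (Or.inl hS.1)
      rw [radius_eq (by linarith)] at hζS
      have ht0 : 0 ≤ √(S.card * Real.log p) := Real.sqrt_nonneg _
      have hζ0 := zeta_nonneg G D S
      have htζ : √(S.card * Real.log p) * zeta G D S ≤ 1 / 20 := by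
        nlinarith [mul_nonneg ht0 hζ0]
      -- whitening turns the Euclidean ball into a ball of the information norm
      constructor
      · intro i
        have h1 := mulVec_sq_le_zeta G D (hF S hS.1) (Q S *ᵥ w) i
        rw [hq] at h1
        have h2 : (√(S.card * Real.log p) * |(D.XS S *ᵥ (Q S *ᵥ w)) i|) ^ 2 ≤ (1 / 2) ^ 2 := by
          rw [mul_pow, sq_abs]
          calc _ ≤ √(S.card * Real.log p) ^ 2 * (zeta G D S ^ 2 * 2) := by
                gcongr
                exact h1.trans (by gcongr)
            _ = (√(S.card * Real.log p) * zeta G D S) ^ 2 * 2 := by ring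
            _ ≤ (1 / 20) ^ 2 * 2 := by gcongr
            _ ≤ _ := by norm_num
        exact le_of_sq_le_sq h2 (by norm_num)
      · rw [fisher_quad] at hq
        have h1 : trueQuad G D (D.XS S *ᵥ (Q S *ᵥ w)) ≤ 2 * (w ⬝ᵥ w) := by
          rw [← hq, trueQuad, Finset.mul_sum]
          refine Finset.sum_le_sum fun i _ => ?_
          rw [← mul_assoc]
          refine mul_le_mul_of_nonneg_right (hsc.b''_le_two_mul hpos ?_) (sq_nonneg _)
          rw [abs_sub_comm]
          exact (hbest S hS.1).2 i
        linarith
  have hlap : ∀ Y ∈ E, ∀ S ∈ models G D Kdim Kth, S.Nonempty → (∃! θ, IsMLE G D S Y θ) ∧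
      |1 - marginal G D α S Y / laplace G D α S Y| ≤ tau G D Kdim Kcub M S :=
    fun Y hY S hS hne => by
      refine laplace_accurate hd hCd hsc hα hα1 hA₅ hp hl hKc hφ (card_le_of_union (models_card hS))
        hne (hbest S hS).1 (hbest S hS).2 (hcub S (Or.inl hS)) hM (hζ S (Or.inl hS)) (hδ S hS)
        fun h => ?_
      obtain ⟨w, rfl⟩ := (hQ S hS).2 h
      rw [(hQ S hS).1 w, scoreConst, mul_assoc 2]
      exact hE Y hY S ⟨hS, hne⟩ w
  have hS₀ : D.S₀ ∈ models G D Kdim Kth := S₀_mem_models hK.le hKt.le (by omega)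
  refine ⟨fun S hS _ => hτ S hS, E, hEm, hEp, fun Y hY S hS hne => ?_⟩
  obtain ⟨h1, h2⟩ := hlap Y hY S hS hne
  obtain ⟨-, h3⟩ := hlap Y hY D.S₀ hS₀ (Finset.card_pos.1 hs0)
  have hτS := hτ S hS
  have hτ₀ := hτ _ hS₀
  have h4 := postMass_ratio_le hprior hA₁ (by omega) hα hl0 (by linarith) h2 h3
  refine ⟨h1, h2, h4, h4.trans (mul_le_mul_of_nonneg_right ?_ ?_)⟩
  · rw [div_le_iff₀ (by linarith)]; linarith
  · have := laplace_pos (G := G) hα hl0 S Y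
    have := laplace_pos (G := G) hα hl0 D.S₀ Y
    have := hprior.priorMass_nonneg S
    have := hprior.priorMass_nonneg D.S₀
    positivity

/-! ### Bounds for the asymptotic form -/

lemma zeta_sq_le (hpos : ∀ x, 0 < G.b'' x) {s : ℝ} (hφ : 0 < phi2 D s (W₀ G D))
    {S : Finset (Fin p)} (hS : (S.card : ℝ) ≤ s)
    (h01 : ∀ i, G.b'' ((D.X *ᵥ D.θ₀) i) ≤ 2 * G.b'' ((D.XS S *ᵥ best G D S) i)) :
    zeta G D S ^ 2 ≤ 2 * (S.card * maxNorm D ^ 2) / (n * phi2 D s (W₀ G D) ^ 2) := by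
  have hn : (0 : ℝ) < n := by exact_mod_cast n_pos_of_phi2_pos G D hφ
  set φ := phi2 D s (W₀ G D)
  have hF : (fisher G D S (best G D S)).PosDef :=
    posDef_gram (fun i => hpos _) (XS_injective G D hφ hS)
  have hB : 0 ≤ 2 * (S.card * maxNorm D ^ 2) / (n * φ ^ 2) := by positivity
  have hz : zeta G D S ≤ √(2 * (S.card * maxNorm D ^ 2) / (n * φ ^ 2)) := by
    refine Real.iSup_le (fun i => Real.sqrt_le_sqrt ?_) (Real.sqrt_nonneg _)
    set x := D.XS S i
    set y := (fisher G D S (best G D S))⁻¹ *ᵥ x with hy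
    have hFy : fisher G D S (best G D S) *ᵥ y = x := by
      rw [hy, mulVec_mulVec, mul_nonsing_inv _ hF.isUnit_det, one_mulVec]
    have hq : x ⬝ᵥ y = y ⬝ᵥ (fisher G D S (best G D S) *ᵥ y) := by rw [hFy, dotProduct_comm]
    have h1 := phi2_sq_mul_le_restrict G D hφ hS y
    have h2 : trueQuad G D (D.XS S *ᵥ y) ≤ 2 * (x ⬝ᵥ y) := by
      rw [hq, fisher_quad, trueQuad, Finset.mul_sum]
      refine Finset.sum_le_sum fun i _ => ?_
      rw [← mul_assoc]
      exact mul_le_mul_of_nonneg_right (h01 i) (sq_nonneg _)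
    have h3 := dotProduct_sq_le x y
    have h4 : x ⬝ᵥ x ≤ S.card * maxNorm D ^ 2 := by
      have : x ⬝ᵥ x ≤ ∑ _j : S, maxNorm D ^ 2 := by
        refine Finset.sum_le_sum fun j _ => ?_
        rw [← sq, ← sq_abs]
        exact pow_le_pow_left₀ (abs_nonneg _) (abs_le_maxNorm D i j) 2
      rwa [Finset.sum_const, Finset.card_univ, Fintype.card_coe, nsmul_eq_mul] at this
    have h0 : 0 ≤ x ⬝ᵥ y := by rw [hq]; exact hF.quad_nonneg y
    rw [le_div_iff₀ (by positivity)]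
    rcases h0.eq_or_lt with h0 | h0
    · rw [← h0, zero_mul]; positivity
    · have h5 : (x ⬝ᵥ y) * ((x ⬝ᵥ y) * (n * φ ^ 2))
          ≤ (x ⬝ᵥ y) * (2 * (S.card * maxNorm D ^ 2)) := by
        calc _ = (x ⬝ᵥ y) ^ 2 * (n * φ ^ 2) := by ring
          _ ≤ (x ⬝ᵥ x) * (y ⬝ᵥ y) * (n * φ ^ 2) := by gcongr
          _ = (x ⬝ᵥ x) * (n * φ ^ 2 * (y ⬝ᵥ y)) := by ring
          _ ≤ (S.card * maxNorm D ^ 2) * (2 * (x ⬝ᵥ y)) :=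
            mul_le_mul h4 (h1.trans h2)
              (mul_nonneg (by positivity) (dotProduct_self_nonneg' y)) (by positivity)
          _ = _ := by ring
      exact le_of_mul_le_mul_left h5 h0
  calc zeta G D S ^ 2 ≤ √(2 * (S.card * maxNorm D ^ 2) / (n * φ ^ 2)) ^ 2 :=
        pow_le_pow_left₀ (zeta_nonneg G D S) hz 2
    _ = _ := Real.sq_sqrt hB

/-- The bound on the radius follows from the sample size condition, for a model with a good
approximation of the true coefficient. -/
lemma radius_mul_zeta_le (hpos : ∀ x, 0 < G.b'' x) (hsc : G.SelfConcordant C₃)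
    {Kdim Kth M : ℝ} (hK : 1 < Kdim) (hKt : 0 < Kth) (hM : 0 ≤ M) (hp : 1 < p)
    (hs : 0 < D.s₀) (hφ : 0 < phi2 D ((Kdim + 1) * D.s₀) (W₀ G D))
    (hn : sampleConst C₃ Kdim Kth * (maxNorm D ^ 2 / phi2 D ((Kdim + 1) * D.s₀) (W₀ G D) ^ 2)
      * (D.s₀ : ℝ) ^ 2 * Real.log p ≤ n)
    (hsmall : 50 * M ^ 2 * (Kdim + 1) ^ 2 * (maxNorm D ^ 2 * (D.s₀ : ℝ) ^ 2 * Real.log p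
      / phi2 D ((Kdim + 1) * D.s₀) (W₀ G D) ^ 2 / n) ≤ 1)
    {S : Finset (Fin p)} (hS : S ∈ modelsBar G D Kdim Kth) :
    radius p M S.card * zeta G D S ≤ 1 / 5 := by
  have hl : 0 < Real.log p := Real.log_pos (by exact_mod_cast hp)
  have hcard : ((S ∪ D.S₀).card : ℝ) ≤ (Kdim + 1) * D.s₀ := by
    rcases hS with hS | ⟨T, hT, rfl⟩
    · exact models_card hS
    · simp only [Finset.union_assoc, Finset.union_self]
      exact models_card hT
  have happ : ∃ θ : S → ℝ, (extend S θ - D.θ₀) ⬝ᵥ (fisherFull G D *ᵥ (extend S θ - D.θ₀))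
      ≤ Kth * D.s₀ * Real.log p := by
    rcases hS with hS | ⟨T, hT, rfl⟩
    · exact hS.2
    · exact exists_approx_of_S₀_subset (by positivity) Finset.subset_union_right
  have hbest := (best_spec hpos hsc hK hKt hp hs hφ hn hcard happ).2
  have hcard' := card_le_of_union hcard
  have hz := zeta_sq_le hpos hφ hcard' fun i => hsc.b''_le_two_mul hpos (by
    rw [abs_sub_comm]; exact hbest i)
  have hn' : (0 : ℝ) < n := by exact_mod_cast n_pos_of_phi2_pos G D hφ
  set φ := phi2 D ((Kdim + 1) * D.s₀) (W₀ G D)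
  have hs0 : (0 : ℝ) < D.s₀ := by exact_mod_cast hs
  rw [radius_eq hM]
  refine le_of_sq_le_sq ?_ (by norm_num)
  rw [mul_pow, mul_pow, Real.sq_sqrt (by positivity)]
  calc M ^ 2 * (S.card * Real.log p) * zeta G D S ^ 2
      ≤ M ^ 2 * (((Kdim + 1) * D.s₀) * Real.log p)
        * (2 * (((Kdim + 1) * D.s₀) * maxNorm D ^ 2) / (n * φ ^ 2)) := by
        gcongr
        exact hz.trans (by gcongr)
    _ = 50 * M ^ 2 * (Kdim + 1) ^ 2 * (maxNorm D ^ 2 * (D.s₀ : ℝ) ^ 2 * Real.log p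
      / φ ^ 2 / n) / 25 := by field_simp; ring
    _ ≤ (1 / 5) ^ 2 := by norm_num; linarith

lemma zeta_le_zetaMax {Kdim Kth : ℝ} {S : Finset (Fin p)} (hS : S ∈ models G D Kdim Kth) :
    zeta G D S ≤ zetaMax G D Kdim Kth :=
  le_ciSup (f := fun S : models G D Kdim Kth => zeta G D S) (Set.finite_range _).bddAbove ⟨S, hS⟩

/-- The product of the model size and `delta`, bounded through the largest size in the class. -/
lemma card_mul_delta_le {Kdim Kth Kcub M : ℝ} (hK : 1 < Kdim) (hKc : 0 < Kcub) (hM : 0 ≤ M)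
    (hp : 1 ≤ p) {S : Finset (Fin p)} (hS : S ∈ models G D Kdim Kth) :
    S.card * delta G D Kdim Kcub M S ≤ (2 * M + 12 * Kcub * M) * Kdim ^ 2 * min
      (√((D.s₀ : ℝ) ^ 3 * Real.log p) * zetaMax G D Kdim Kth)
      (sigmaMaxSq G D / phi2 D ((Kdim + 1) * D.s₀) (W₀ G D) ^ 3
        * √((D.s₀ : ℝ) ^ 3 * Real.log p / n)) := by
  have hl : 0 ≤ Real.log p := Real.log_nonneg (by exact_mod_cast hp)
  set φ := phi2 D ((Kdim + 1) * D.s₀) (W₀ G D) with hφ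
  have hφ0 : 0 ≤ φ := Real.sqrt_nonneg _
  have hσ : 0 ≤ sigmaMaxSq G D := sigmaMaxSq_nonneg
  set u := √((D.s₀ : ℝ) ^ 3 * Real.log p) with hu
  have hu0 : 0 ≤ u := Real.sqrt_nonneg _
  have hs : (0 : ℝ) ≤ D.s₀ := Nat.cast_nonneg _
  have hKd : √Kdim ≤ Kdim := by
    rw [Real.sqrt_le_left (by linarith)]; nlinarith
  -- `|S| * radius` is at most a constant multiple of `√(s₀³ log p)`
  have hcr : S.card * radius p M S.card ≤ M * Kdim ^ 2 * u := by
    have h1 : radius p M S.card ≤ M * (√Kdim * √(D.s₀ * Real.log p)) := by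
      rw [radius_eq hM, ← Real.sqrt_mul (by linarith)]
      refine mul_le_mul_of_nonneg_left (Real.sqrt_le_sqrt ?_) hM
      rw [← mul_assoc]
      exact mul_le_mul_of_nonneg_right hS.1 hl
    have h2 : u = D.s₀ * √(D.s₀ * Real.log p) := by
      rw [hu, show (D.s₀ : ℝ) ^ 3 * Real.log p = (D.s₀ : ℝ) ^ 2 * (D.s₀ * Real.log p) by ring,
        Real.sqrt_mul (sq_nonneg _), Real.sqrt_sq hs]
    calc S.card * radius p M S.card
        ≤ (Kdim * D.s₀) * (M * (Kdim * √(D.s₀ * Real.log p))) := by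
          refine mul_le_mul hS.1 (h1.trans (by gcongr)) (Real.sqrt_nonneg _) (by positivity)
      _ = M * Kdim ^ 2 * u := by rw [h2]; ring
  have hζ := zeta_le_zetaMax hS
  have hζ0 := zeta_nonneg G D S
  have hsqrt2 : √2 ≤ 1.5 := Real.sqrt_le_left (by norm_num) |>.2 (by norm_num)
  have hcr0 : 0 ≤ S.card * radius p M S.card := mul_nonneg (Nat.cast_nonneg _) (Real.sqrt_nonneg _)
  rw [mul_min_of_nonneg _ _ (by positivity)]
  refine le_min ?_ ?_
  · refine (mul_le_mul_of_nonneg_left (min_le_left _ _) (Nat.cast_nonneg _)).trans ?_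
    calc S.card * (2 * radius p M S.card * zeta G D S)
        = 2 * ((S.card * radius p M S.card) * zeta G D S) := by ring
      _ ≤ 2 * ((M * Kdim ^ 2 * u) * zetaMax G D Kdim Kth) := by gcongr
      _ ≤ _ := by
        have : 0 ≤ 12 * Kcub * M * Kdim ^ 2 * (u * zetaMax G D Kdim Kth) :=
          mul_nonneg (by positivity) (mul_nonneg hu0 (hζ0.trans hζ))
        linarith
  · refine (mul_le_mul_of_nonneg_left (min_le_right _ _) (Nat.cast_nonneg _)).trans ?_
    rw [Real.sqrt_div (by positivity), ← hu]
    calc S.card * (8 * √2 * Kcub / φ ^ 3 * sigmaMaxSq G D * radius p M S.card / √n)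
        = √2 * (8 * Kcub / φ ^ 3 * sigmaMaxSq G D * (S.card * radius p M S.card) / √n) := by ring
      _ ≤ 1.5 * (8 * Kcub / φ ^ 3 * sigmaMaxSq G D * (M * Kdim ^ 2 * u) / √n) := by gcongr
      _ = 12 * Kcub * M * Kdim ^ 2 * (sigmaMaxSq G D / φ ^ 3 * (u / √n)) := by ring
      _ ≤ _ := by
        have : 0 ≤ 2 * M * Kdim ^ 2 * (sigmaMaxSq G D / φ ^ 3 * (u / √n)) := by positivity
        linarith

end Fixed

lemma eventually_const_mul_le {f : ℕ → ℝ} (hf : Tendsto f atTop (𝓝 0)) {c : ℝ} {ε : ℝ}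
    (hε : 0 < ε) : ∀ᶠ n in atTop, c * f n ≤ ε := by
  have h := hf.const_mul c
  rw [mul_zero] at h
  exact (h.eventually (gt_mem_nhds hε)).mono fun n hn => hn.le

end

end SparseGLM

theorem theorem4p1 :
    -- `C` depends on `(C₃, Kdim, Kth)`, and `C'` on `(Cdev, C₃, α, A₅, A₆, A₈)` only
    ∃ (C : ℝ → ℝ → ℝ → ℝ) (C' : ℝ → ℝ → ℝ → ℝ → ℝ → ℝ → ℝ),
      -- the non-asymptotic form
      (∀ (G : SparseGLM.Family) (Cdev C₃ : ℝ), 1 ≤ Cdev → G.Doubling Cdev →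
        G.SelfConcordant C₃ →
        ∀ (α A₁ A₂ A₃ A₄ A₅ A₆ A₇ A₈ Kdim Kth Kcub M : ℝ), 0 < α → α ≤ 1 →
        0 < A₁ → 0 < A₂ → 0 < A₃ → 0 < A₄ → 0 < A₅ → 0 < A₆ → 0 ≤ A₇ → 0 < A₈ →
        1 < Kdim → 0 < Kth → 0 < Kcub →
        ∀ (n p : ℕ) (D : SparseGLM.Problem n p), D.θ₀ ≠ 0 →
        SparseGLM.PriorCond D A₁ A₂ A₃ A₄ →
        (p : ℝ) ^ (-A₅) ≤ D.lam → D.lam ≤ A₆ * (p : ℝ) ^ (-A₇) →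
        0 < SparseGLM.phi2 D ((Kdim + 1) * D.s₀) (SparseGLM.W₀ G D) →
        C C₃ Kdim Kth *
          (SparseGLM.maxNorm D ^ 2
            / SparseGLM.phi2 D ((Kdim + 1) * D.s₀) (SparseGLM.W₀ G D) ^ 2)
          * (D.s₀ : ℝ) ^ 2 * Real.log p ≤ n →
        SparseGLM.CubicBound G D Kdim Kth Kcub →
        (∀ S ∈ SparseGLM.models G D Kdim Kth, SparseGLM.rhoMax G D S ≤ (p : ℝ) ^ A₈) →
        (∀ S ∈ SparseGLM.modelsBar G D Kdim Kth,
          SparseGLM.radius p M S.card * SparseGLM.zeta G D S ≤ 1 / 5) →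
        (∀ S ∈ SparseGLM.models G D Kdim Kth,
          S.card * SparseGLM.delta G D Kdim Kcub M S ≤ 1 / 36) →
        C' Cdev C₃ α A₅ A₆ A₈ ≤ M → C' Cdev C₃ α A₅ A₆ A₈ * M ≤ p →
        SparseGLM.LaplaceAccurate G D α Kdim Kth Kcub M) ∧
      -- the asymptotic form, under (A1)--(A4)
      (∀ (G : SparseGLM.Family) (Cdev C₃ : ℝ), 1 ≤ Cdev → G.Doubling Cdev →
        G.SelfConcordant C₃ →
        ∀ (α A₁ A₂ A₃ A₄ A₅ A₆ A₇ A₈ Kdim Kth Kcub Cp : ℝ),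
        0 < A₁ → 0 < A₂ → 0 < A₃ → 0 < A₄ → 0 < A₅ → 0 < A₆ → 0 ≤ A₇ → 0 < A₈ →
        1 < Kdim → 0 < Kth → 0 < Kcub → 0 < Cp →
        ∀ (p : ℕ → ℕ) (D : ∀ n, SparseGLM.Problem n (p n))
          (Dn : ℕ → ℝ) (θbar : ∀ n (S : Finset (Fin (p n))), S → ℝ),
        (∀ᶠ n : ℕ in Filter.atTop, (n : ℝ) ^ Cp ≤ p n) →
        (∀ᶠ n in Filter.atTop, (D n).θ₀ ≠ 0) →
        (∀ᶠ n in Filter.atTop, SparseGLM.PriorCond (D n) A₁ A₂ A₃ A₄) →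
        SparseGLM.CondA1 G D Dn θbar →
        SparseGLM.CondA2 G D α Dn A₄ A₅ A₆ A₇ →
        SparseGLM.CondA3 G D Kdim →
        SparseGLM.CondA4 G D Kdim Kth Kcub A₈ →
        ∀ M : ℝ, C' Cdev C₃ α A₅ A₆ A₈ ≤ M →
          ∀ᶠ n in Filter.atTop, SparseGLM.LaplaceAccurate G (D n) α Kdim Kth Kcub M) := by
  refine ⟨SparseGLM.sampleConst, fun Cdev C₃ α A₅ _ _ => SparseGLM.radiusConst Cdev C₃ α A₅,
    ?_, ?_⟩
  · intro G Cdev C₃ hCd hd hsc α A₁ A₂ A₃ A₄ A₅ A₆ A₇ A₈ Kdim Kth Kcub M hα hα1 hA₁ _ _ _ hA₅ _ _ _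
      hK hKt hKc n p D hθ hprior hl _ hφ hn hcub _ hζ hδ hM hp
    have hm : 0 ≤ SparseGLM.mleConst Cdev := by
      unfold SparseGLM.mleConst SparseGLM.scoreConst; positivity
    have h4 := (SparseGLM.radiusConst_bounds (hsc.nonneg hd.b''_pos) hm
      (le_refl (SparseGLM.radiusConst Cdev C₃ α A₅))).1
    have hp16 : (16 : ℝ) ≤ p := by nlinarith
    exact SparseGLM.laplaceAccurate_of hd hCd hsc hα hα1 hA₁ hA₅ hK hKt hKc hθ hprior hl hφ hn hcub
      hζ hδ hM (by exact_mod_cast hp16)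
  · intro G Cdev C₃ hCd hd hsc α A₁ A₂ A₃ A₄ A₅ A₆ A₇ A₈ Kdim Kth Kcub Cp hA₁ _ _ _ hA₅ _ _ _
      hK hKt hKc hCp p D Dn θbar hpn hθ hprior _ hA2 hA3 hA4 M hM
    have hpos := hd.b''_pos
    have hm : 0 ≤ SparseGLM.mleConst Cdev := by
      unfold SparseGLM.mleConst SparseGLM.scoreConst; positivity
    have hM4 := (SparseGLM.radiusConst_bounds (hsc.nonneg hpos) hm hM).1
    have hp16 : ∀ᶠ n in Filter.atTop, 16 ≤ p n := by
      have h := ((tendsto_rpow_atTop hCp).comp tendsto_natCast_atTop_atTop).eventually_ge_atTop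
        (16 : ℝ)
      filter_upwards [h, hpn] with n h1 h2
      have : (16 : ℝ) ≤ p n := le_trans h1 h2
      exact_mod_cast this
    filter_upwards [hp16, hθ, hprior, hA2.lam_lower, hA3.phi2_pos, hA4.cubic,
      SparseGLM.eventually_const_mul_le hA3.size (c := SparseGLM.sampleConst C₃ Kdim Kth) one_pos,
      SparseGLM.eventually_const_mul_le hA3.size (c := 50 * M ^ 2 * (Kdim + 1) ^ 2) one_pos,
      SparseGLM.eventually_const_mul_le hA4.size (c := (2 * M + 12 * Kcub * M) * Kdim ^ 2)
        (show (0 : ℝ) < 1 / 36 by norm_num)] with n hp hθ hprior hl hφ hcub hs1 hs2 hs3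
    have hn0 : (0 : ℝ) < n := by exact_mod_cast SparseGLM.n_pos_of_phi2_pos G (D n) hφ
    have hn : SparseGLM.sampleConst C₃ Kdim Kth * (SparseGLM.maxNorm (D n) ^ 2
        / SparseGLM.phi2 (D n) ((Kdim + 1) * (D n).s₀) (SparseGLM.W₀ G (D n)) ^ 2)
        * ((D n).s₀ : ℝ) ^ 2 * Real.log (p n) ≤ n := by
      rw [← mul_div_assoc, div_le_one hn0] at hs1
      refine le_trans (le_of_eq ?_) hs1
      ring
    exact SparseGLM.laplaceAccurate_of hd hCd hsc hA2.alpha_pos hA2.alpha_lt.le hA₁ hA₅ hK hKt hKc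
      hθ hprior hl hφ hn hcub
      (fun S hS => SparseGLM.radius_mul_zeta_le hpos hsc hK hKt (by linarith) (by omega)
        (SparseGLM.s₀_pos hθ) hφ hn hs2 hS)
      (fun S hS => (SparseGLM.card_mul_delta_le hK hKc (by linarith) (by omega) hS).trans hs3)
      hM hp
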